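/- Let $k$ be a field of characteristic $0$ and $K=k[[h]]$. All completions are $h$-adic, and all topological Hopf algebras are assumed to have bijective antipode. A topological Hopf algebra over $K$ is an $h$-adically complete $K$-algebra $A_h$ with a coproduct $\Delta: A_h\to A_h\widehat\otimes_K A_h$, a counit $\varepsilon: A_h\to K$ and an antipode $S$ satisfying the Hopf algebra axioms with completed tensor products. It is a Hopf deformation of a Hopf algebra $A_0$ over $k$ if $A_h\simeq A_0[[h]]$ as a $K$-module and $A_h/hA_h\simeq A_0$ as Hopf algebras. Let $A_h,B_h,C_h$ be Hopf deformations of Hopf $k$-algebras $A_0,B_0,C_0$, and let $B_h\to A_h$ and $C_h\to A_h$ be morphisms of topological Hopf algebras such that $A_h$ is flat as a right $B_h$-module and as a right $C_h$-module. Assume that $B_0$ is noetherian and that there is an integer $d_{B_h}$ such that $$\mathrm{Ext}^i_{B_0}(k,B_0)=0\ \text{ for } i\neq d_{B_h},\qquad \mathrm{Ext}^{d_{B_h}}_{B_0}(k,B_0)\simeq k,$$ where $B_0$ acts on $k$ through its counit; assume likewise that $C_0$ is noetherian and satisfies the same condition with an integer $d_{C_h}$. Put $\Omega_{B_h}=\mathrm{Ext}^{d_{B_h}}_{B_h}(K,B_h)$,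 where $B_h$ acts on $K$ through its counit, with the right $B_h$-module structure given by right multiplication on $B_h$, and define $\Omega_{C_h}$ similarly. Let $V$ (resp. $W$) be a left $B_h$-module (resp. $C_h$-module) which is free of finite rank over $K$. Let $V^*=\mathrm{Hom}_K(V,K)$, with its transposed right $B_h$-action $(f\cdot u)(v)=f(uv)$, and endow $\Omega_{B_h}\otimes_K V^*$ with the right $B_h$-module structure $$(\omega\otimes f)\cdot u=\lim_{n\to\infty}\sum_j \omega\cdot u'_{j,n}\otimes f\cdot S^2(u''_{j,n}),\qquad \Delta(u)=\lim_{n\to\infty}\sum_j u'_{j,n}\otimes u''_{j,n};$$ define the right $C_h$-module $\Omega_{C_h}\otimes_K W^*$ in the same way. Then for every integer $n$ there is an isomorphism of $K$-modules $$\mathrm{Ext}^{n+d_{B_h}}_{A_h}\bigl(A_h\otimes_{B_h}V,\;A_h\otimes_{C_h}W\bigr)\;\simeq\;\mathrm{Ext}^{n+d_{C_h}}_{A_h^{op}}\bigl((\Omega_{C_h}\otimes_K W^*)\otimes_{C_h}A_h,\;(\Omega_{B_h}\otimes_K V^*)\otimes_{B_h}A_h\bigr),$$ where $\mathrm{Ext}_{A_h^{op}}$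 is taken in the category of right $A_h$-modules and Ext groups of negative degree are zero. -/

import Mathlib

open CategoryTheory TensorProduct
open scoped PowerSeries

universe u

noncomputable section

namespace HopfDuality

section Completion

/-! Completions of algebras, and completed tensor products, over a commutative ring `K` with an
ideal `I`. The reduction of a module `M` modulo `I ^ n` is written `(K ⧸ I ^ n) ⊗[K] M`. -/

variable {K : Type*} [CommRing K] (I : Ideal K)

/-- The transition map from the reduction modulo `I ^ n` to the reduction modulo `I ^ m`,
for `m ≤ n`. -/
def trans (R : Type*) [Ring R] [Algebra K R] {m n : ℕ} (h : m ≤ n) :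
    (K ⧸ I ^ n) ⊗[K] R →ₐ[K] (K ⧸ I ^ m) ⊗[K] R :=
  Algebra.TensorProduct.map (Ideal.Quotient.factorₐ K (Ideal.pow_le_pow_right h)) (AlgHom.id K R)

/-- The `I`-adic completion `lim_n R / I ^ n R` of a not necessarily commutative
`K`-algebra `R`. -/
def Completion (R : Type*) [Ring R] [Algebra K R] :
    Subalgebra K (∀ n : ℕ, (K ⧸ I ^ n) ⊗[K] R) where
  carrier := {x | ∀ (m n : ℕ) (h : m ≤ n), trans I R h (x n) = x m}
  mul_mem' hx hy m n h := by
    simp only [Pi.mul_apply, map_mul, hx m n h, hy m n h]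
  add_mem' hx hy m n h := by
    simp only [Pi.add_apply, map_add, hx m n h, hy m n h]
  algebraMap_mem' r m n h := by
    simp only [Pi.algebraMap_apply, AlgHom.commutes]

/-- The reduction modulo `I ^ n` of an element of the completion. -/
def Completion.eval (R : Type*) [Ring R] [Algebra K R] (n : ℕ) :
    Completion I R →ₐ[K] (K ⧸ I ^ n) ⊗[K] R :=
  (Pi.evalAlgHom K (fun n : ℕ => (K ⧸ I ^ n) ⊗[K] R) n).comp (Completion I R).val

/-- The canonical map from an algebra to its completion. -/
def Completion.of (R : Type*) [Ring R] [Algebra K R] : R →ₐ[K] Completion I R :=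
  AlgHom.codRestrict
    (AlgHom.pi fun _ : ℕ => Algebra.TensorProduct.includeRight) _ (by
      intro x m n h
      simp [trans])

/-- The map induced on completions by a homomorphism of algebras. -/
def Completion.map {R S : Type*} [Ring R] [Algebra K R] [Ring S] [Algebra K S] (f : R →ₐ[K] S) :
    Completion I R →ₐ[K] Completion I S :=
  AlgHom.codRestrict
    (AlgHom.pi fun n : ℕ =>
      (Algebra.TensorProduct.map (AlgHom.id K (K ⧸ I ^ n)) f).comp (Completion.eval I R n)) _ (by
      intro x m n h
      have key : (trans I S h).comp (Algebra.TensorProduct.map (AlgHom.id K (K ⧸ I ^ n)) f) =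
          (Algebra.TensorProduct.map (AlgHom.id K (K ⧸ I ^ m)) f).comp (trans I R h) := by
        ext <;> simp [trans]
      have := DFunLike.congr_fun key (Completion.eval I R n x)
      simp only [AlgHom.comp_apply] at this
      simp only [AlgHom.pi_apply, AlgHom.comp_apply, this]
      congr 1
      exact x.2 m n h)

theorem exists_one_tmul (M : Type*) [AddCommGroup M] [Module K M] (J : Ideal K)
    (x : (K ⧸ J) ⊗[K] M) : ∃ y : M, x = (1 : K ⧸ J) ⊗ₜ[K] y := by
  obtain ⟨y, hy⟩ := Submodule.Quotient.mk_surjective _ (TensorProduct.quotTensorEquivQuotSMul M J x)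
  refine ⟨y, (TensorProduct.quotTensorEquivQuotSMul M J).injective ?_⟩
  rw [← hy, TensorProduct.quotTensorEquivQuotSMul_mk_one_tmul]

theorem one_tmul_eq_iff (M : Type*) [AddCommGroup M] [Module K M] (J : Ideal K) (x y : M) :
    (1 : K ⧸ J) ⊗ₜ[K] x = (1 : K ⧸ J) ⊗ₜ[K] y ↔ x ≡ y [SMOD (J • ⊤ : Submodule K M)] := by
  rw [← (TensorProduct.quotTensorEquivQuotSMul M J).injective.eq_iff,
    TensorProduct.quotTensorEquivQuotSMul_mk_one_tmul,
    TensorProduct.quotTensorEquivQuotSMul_mk_one_tmul]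
  rfl

theorem Completion.of_bijective (R : Type*) [Ring R] [Algebra K R] [IsAdicComplete I R] :
    Function.Bijective (Completion.of I R) := by
  constructor
  · rw [injective_iff_map_eq_zero]
    intro x hx
    refine IsHausdorff.haus (I := I) inferInstance x fun n => ?_
    rw [← one_tmul_eq_iff, TensorProduct.tmul_zero]
    exact congrFun (congrArg Subtype.val hx) n
  · intro x
    choose y hy using fun n => exists_one_tmul R (I ^ n) (x.1 n)
    obtain ⟨L, hL⟩ := IsPrecomplete.prec (I := I) (M := R) inferInstance (f := y) (by
      intro m n h
      rw [← one_tmul_eq_iff, ← hy m, ← x.2 m n h, hy n]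
      simp [trans])
    refine ⟨L, Subtype.ext (funext fun n => ?_)⟩
    rw [hy n]
    exact ((one_tmul_eq_iff R (I ^ n) _ _).2 (hL n)).symm

/-- A complete algebra is its own completion. -/
def Completion.equiv (R : Type*) [Ring R] [Algebra K R] [IsAdicComplete I R] :
    R ≃ₐ[K] Completion I R :=
  AlgEquiv.ofBijective (Completion.of I R) (Completion.of_bijective I R)

theorem isAdicComplete_congr {M N : Type*} [AddCommGroup M] [Module K M] [AddCommGroup N]
    [Module K N] (e : M ≃ₗ[K] N) [IsAdicComplete I M] : IsAdicComplete I N := by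
  have hmap : ∀ n : ℕ, Submodule.map e.toLinearMap (I ^ n • ⊤ : Submodule K M) = I ^ n • ⊤ := by
    intro n
    rw [Submodule.map_smul'']
    simp
  have hiff : ∀ (n : ℕ) (x y : N), x ≡ y [SMOD (I ^ n • ⊤ : Submodule K N)] ↔
      e.symm x ≡ e.symm y [SMOD (I ^ n • ⊤ : Submodule K M)] := by
    intro n x y
    rw [SModEq.sub_mem, SModEq.sub_mem, ← hmap, ← map_sub]
    constructor
    · rintro ⟨z, hz, hz'⟩
      have : z = e.symm (x - y) := by rw [← hz']; simp
      exact this ▸ hz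
    · intro h
      exact ⟨_, h, by simp⟩
  refine { haus' := fun x hx => ?_, prec' := fun f hf => ?_ }
  · refine e.symm.injective ?_
    rw [map_zero]
    refine IsHausdorff.haus (I := I) inferInstance _ fun n => ?_
    simpa using (hiff n x 0).1 (hx n)
  · obtain ⟨L, hL⟩ := IsPrecomplete.prec (I := I) (M := M) inferInstance
      (f := fun n => e.symm (f n)) (fun {m n} h => (hiff m _ _).1 (hf h))
    exact ⟨e L, fun n => (hiff n _ _).2 (by simpa using hL n)⟩

theorem isAdicComplete_pi {M : Type*} [AddCommGroup M] [Module K M] [IsAdicComplete I M]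
    (ι : Type*) [Finite ι] : IsAdicComplete I (ι → M) := by
  classical
  have := Fintype.ofFinite ι
  have hiff : ∀ (n : ℕ) (x y : ι → M), x ≡ y [SMOD (I ^ n • ⊤ : Submodule K (ι → M))] ↔
      ∀ i, x i ≡ y i [SMOD (I ^ n • ⊤ : Submodule K M)] := by
    intro n x y
    simp only [SModEq.sub_mem]
    constructor
    · intro h i
      have := Submodule.mem_map_of_mem (f := LinearMap.proj (R := K) (φ := fun _ : ι => M) i) h
      rw [Submodule.map_smul''] at this
      exact Submodule.smul_mono le_rfl le_top this
    · intro h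
      have hsum : x - y = ∑ i, LinearMap.single K (fun _ : ι => M) i ((x - y) i) := by
        exact (Finset.univ_sum_single (x - y)).symm
      rw [hsum]
      refine Submodule.sum_mem _ fun i _ => ?_
      have := Submodule.mem_map_of_mem (f := LinearMap.single K (fun _ : ι => M) i) (h i)
      rw [Submodule.map_smul''] at this
      exact Submodule.smul_mono le_rfl le_top this
  refine { haus' := fun x hx => ?_, prec' := fun f hf => ?_ }
  · funext i
    exact IsHausdorff.haus (I := I) inferInstance _ fun n => (hiff n x 0).1 (hx n) i
  · choose L hL using fun i => IsPrecomplete.prec (I := I) (M := M) inferInstance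
      (f := fun n => f n i) (fun {m n} h => (hiff m _ _).1 (hf h) i)
    exact ⟨L, fun n => (hiff n _ _).2 fun i => hL i n⟩

/-- The tensor product of a complete module with a finite free module is complete. -/
theorem isAdicComplete_tensor (M E : Type*) [AddCommGroup M] [Module K M] [IsAdicComplete I M]
    [AddCommGroup E] [Module K E] [Module.Free K E] [Module.Finite K E] :
    IsAdicComplete I (M ⊗[K] E) := by
  classical
  have := isAdicComplete_pi I (M := M) (Module.Free.ChooseBasisIndex K E)
  exact isAdicComplete_congr I
    ((LinearEquiv.lTensor M (Module.Free.chooseBasis K E).equivFun).trans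
      (TensorProduct.piScalarRight K K M (Module.Free.ChooseBasisIndex K E))).symm

end Completion

section TopologicalHopf

variable {K : Type*} [CommRing K] (I : Ideal K)

/-- A linear map `M → N^` into a completed module, given here modulo `I ^ n`, extended to the
reduction of `M` modulo `I ^ n`. -/
abbrev extend {n : ℕ} {M N : Type*} [AddCommGroup M] [Module K M] [AddCommGroup N] [Module K N]
    (g : M →ₗ[K] (K ⧸ I ^ n) ⊗[K] N) : (K ⧸ I ^ n) ⊗[K] M →ₗ[K ⧸ I ^ n] (K ⧸ I ^ n) ⊗[K] N :=
  g.liftBaseChange (K ⧸ I ^ n)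

/-- For `δ : A → A ⊗ A` modulo `I ^ n`, the map `δ ⊗ id : A ⊗ A → A ⊗ (A ⊗ A)` modulo `I ^ n`. -/
def comulLeft {n : ℕ} {A : Type*} [Ring A] [Algebra K A]
    (δ : A →ₗ[K] (K ⧸ I ^ n) ⊗[K] (A ⊗[K] A)) :
    A ⊗[K] A →ₗ[K] (K ⧸ I ^ n) ⊗[K] (A ⊗[K] (A ⊗[K] A)) :=
  (TensorProduct.assoc K A A A).toLinearMap.lTensor (K ⧸ I ^ n) ∘ₗ
    (TensorProduct.assoc K (K ⧸ I ^ n) (A ⊗[K] A) A).toLinearMap ∘ₗ δ.rTensor A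

/-- For `δ : A → A ⊗ A` modulo `I ^ n`, the map `id ⊗ δ : A ⊗ A → A ⊗ (A ⊗ A)` modulo `I ^ n`. -/
def comulRight {n : ℕ} {A : Type*} [Ring A] [Algebra K A]
    (δ : A →ₗ[K] (K ⧸ I ^ n) ⊗[K] (A ⊗[K] A)) :
    A ⊗[K] A →ₗ[K] (K ⧸ I ^ n) ⊗[K] (A ⊗[K] (A ⊗[K] A)) :=
  (TensorProduct.leftComm K A (K ⧸ I ^ n) (A ⊗[K] A)).toLinearMap ∘ₗ δ.lTensor A

/-- A topological Hopf algebra over `K` for the `I`-adic topology: an `I`-adically complete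
`K`-algebra with a coproduct with values in the completed tensor product, a counit and an
invertible antipode (an antipode always reverses products, so its type is `A ≃ₐ[K] Aᵐᵒᵖ`). Since the completed tensor products are limits of the reductions modulo the
powers of `I`, the axioms are stated modulo each `I ^ n`. -/
class TopHopfAlgebra (A : Type*) [Ring A] [Algebra K A] where
  isAdicComplete : IsAdicComplete I A
  comul : A →ₐ[K] Completion I (A ⊗[K] A)
  counit : A →ₐ[K] K
  antipode : A ≃ₐ[K] Aᵐᵒᵖ
  coassoc (n : ℕ) (a : A) :
    extend I (comulLeft I ((Completion.eval I (A ⊗[K] A) n).comp comul).toLinearMap)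
        (Completion.eval I _ n (comul a)) =
      extend I (comulRight I ((Completion.eval I (A ⊗[K] A) n).comp comul).toLinearMap)
        (Completion.eval I _ n (comul a))
  counit_left (n : ℕ) (a : A) :
    ((TensorProduct.lid K A).toLinearMap ∘ₗ counit.toLinearMap.rTensor A).lTensor (K ⧸ I ^ n)
      (Completion.eval I _ n (comul a)) = 1 ⊗ₜ[K] a
  counit_right (n : ℕ) (a : A) :
    ((TensorProduct.rid K A).toLinearMap ∘ₗ counit.toLinearMap.lTensor A).lTensor (K ⧸ I ^ n)
      (Completion.eval I _ n (comul a)) = 1 ⊗ₜ[K] a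
  antipode_left (n : ℕ) (a : A) :
    (LinearMap.mul' K A ∘ₗ LinearMap.rTensor A
        ((MulOpposite.opLinearEquiv K).symm.toLinearMap ∘ₗ antipode.toLinearMap)).lTensor
          (K ⧸ I ^ n) (Completion.eval I _ n (comul a)) = 1 ⊗ₜ[K] algebraMap K A (counit a)
  antipode_right (n : ℕ) (a : A) :
    (LinearMap.mul' K A ∘ₗ LinearMap.lTensor A
        ((MulOpposite.opLinearEquiv K).symm.toLinearMap ∘ₗ antipode.toLinearMap)).lTensor
          (K ⧸ I ^ n) (Completion.eval I _ n (comul a)) = 1 ⊗ₜ[K] algebraMap K A (counit a)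

namespace TopHopfAlgebra

variable (A : Type*) [Ring A] [Algebra K A] [TopHopfAlgebra I A]

/-- The square of the antipode. -/
def antipodeSq : A →ₐ[K] A :=
  (AlgHom.opComm (antipode I (A := A)).toAlgHom).comp (antipode I (A := A)).toAlgHom

end TopHopfAlgebra

/-- Morphisms of topological Hopf algebras. -/
structure TopHopfHom (B A : Type*) [Ring B] [Algebra K B] [TopHopfAlgebra I B]
    [Ring A] [Algebra K A] [TopHopfAlgebra I A] extends B →ₐ[K] A where
  map_counit (b : B) :
    TopHopfAlgebra.counit I (toAlgHom b) = TopHopfAlgebra.counit I b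
  map_comul (b : B) :
    TopHopfAlgebra.comul (toAlgHom b) =
      Completion.map I (Algebra.TensorProduct.map toAlgHom toAlgHom)
        (TopHopfAlgebra.comul (I := I) b)
  map_antipode (b : B) :
    TopHopfAlgebra.antipode I (toAlgHom b) =
      MulOpposite.op (toAlgHom (TopHopfAlgebra.antipode I b).unop)

end TopologicalHopf

section Deformation

/-- The ideal `(h)` of `k[[h]]`. -/
abbrev hIdeal (k : Type*) [Field k] : Ideal k⟦X⟧ := Ideal.span {(PowerSeries.X : k⟦X⟧)}

/-- `A` is a Hopf deformation of the Hopf algebra `A₀` over `k`: a topological Hopf algebra over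
`k[[h]]`, isomorphic to `A₀[[h]]` as a `k[[h]]`-module, together with an isomorphism of Hopf
algebras of `A / hA` with `A₀`, given here as a surjective map `A → A₀` with kernel `hA`. -/
structure HopfDeformation (k : Type*) [Field k] (A : Type*) [Ring A] [Algebra k⟦X⟧ A]
    [TopHopfAlgebra (hIdeal k) A] (A₀ : Type*) [Ring A₀] [HopfAlgebra k A₀] where
  /-- `A` is isomorphic to `A₀[[h]]` as a `k[[h]]`-module; an element of `A₀[[h]]` is given by the
  sequence of its coefficients. -/
  exists_equiv : ∃ e : A ≃+ (ℕ → A₀), ∀ (f : k⟦X⟧) (a : A) (n : ℕ),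
    e (f • a) n = ∑ p ∈ Finset.HasAntidiagonal.antidiagonal n, PowerSeries.coeff p.1 f • e a p.2
  /-- the reduction modulo `h` -/
  toRingHom : A →+* A₀
  map_smul (f : k⟦X⟧) (a : A) : toRingHom (f • a) = PowerSeries.constantCoeff f • toRingHom a
  surjective : Function.Surjective toRingHom
  map_eq_zero_iff (a : A) : toRingHom a = 0 ↔ ∃ b : A, a = (PowerSeries.X : k⟦X⟧) • b
  map_counit (a : A) : Coalgebra.counit (R := k) (toRingHom a) =
    PowerSeries.constantCoeff (TopHopfAlgebra.counit (hIdeal k) a)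
  map_comul (a : A) (t : A ⊗[k⟦X⟧] A)
    (ht : Completion.eval (hIdeal k) _ 1 (TopHopfAlgebra.comul a) = 1 ⊗ₜ[k⟦X⟧] t) :
    Coalgebra.comul (R := k) (toRingHom a) =
      TensorProduct.map (σ₁₂ := PowerSeries.constantCoeff (R := k))
        (⟨⟨toRingHom, toRingHom.map_add⟩, map_smul⟩ :
          A →ₛₗ[PowerSeries.constantCoeff (R := k)] A₀)
        (⟨⟨toRingHom, toRingHom.map_add⟩, map_smul⟩ :
          A →ₛₗ[PowerSeries.constantCoeff (R := k)] A₀) t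
  map_antipode (a : A) : HopfAlgebra.antipode k (toRingHom a) =
    toRingHom (TopHopfAlgebra.antipode (hIdeal k) a).unop

end Deformation

section ExtGroups

open Abelian

/-- Modules over an `R`-algebra form an `R`-linear category. -/
@[reducible]
def linearModuleCat (R : Type*) [CommRing R] (A : Type u) [Ring A] [Algebra R A] :
    Linear R (ModuleCat.{u} A) where
  homModule M N :=
    letI := Module.restrictScalars R A N
    letI := IsScalarTower.restrictScalars R A N
    inferInstance
  smul_comp M N P r f g := by
    ext x
    exact map_smul g.hom (algebraMap R A r) (f.hom x)

attribute [local instance] linearModuleCat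

/-- `Ext^n_A (M, N)` for an integer `n`, as an `R`-module for an `R`-algebra `A`;
it is zero for negative `n`. -/
def extZ (R : Type u) [CommRing R] {A : Type u} [Ring A] [Algebra R A] (M N : ModuleCat.{u} A) :
    ℤ → ModuleCat.{u} R
  | Int.ofNat n => ModuleCat.of R (Ext.{u} M N n)
  | Int.negSucc _ => ModuleCat.of R PUnit

/-- The `R`-module `R` as a module over an `R`-algebra `A` through `ε : A → R`. -/
abbrev trivialModule {R : Type u} [CommRing R] {A : Type u} [Ring A] [Algebra R A]
    (ε : A →ₐ[R] R) : ModuleCat.{u} A :=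
  (ModuleCat.restrictScalars ε.toRingHom).obj (ModuleCat.of R R)

/-- The `R`-module `Ext^n_A (M, A)`. -/
def ExtReg (R : Type u) [CommRing R] {A : Type u} [Ring A] [Algebra R A]
    (M : ModuleCat.{u} A) (n : ℕ) : ModuleCat.{u} R :=
  ModuleCat.of R (Ext.{u} M (ModuleCat.of A A) n)

/-- Right multiplication by `a`, as an endomorphism of the left `A`-module `A`. -/
def rightMul {A : Type u} [Ring A] (a : A) : ModuleCat.of A A ⟶ ModuleCat.of A A :=
  ModuleCat.ofHom (LinearMap.toSpanSingleton A A a)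

theorem rightMul_add {A : Type u} [Ring A] (a b : A) :
    rightMul (a + b) = rightMul a + rightMul b := by
  ext
  simp [rightMul]

theorem mk₀_rightMul_smul (R : Type u) [CommRing R] {A : Type u} [Ring A] [Algebra R A] (r : R)
    (a : A) : Ext.mk₀ (rightMul (r • a)) = r • Ext.mk₀ (rightMul a) := by
  rw [← Ext.mk₀_smul]
  congr 1
  apply ModuleCat.hom_ext
  apply LinearMap.ext
  intro x
  have h : x * (r • a) = algebraMap R A r * (x * a) := by
    rw [mul_smul_comm, Algebra.smul_def]
  exact h

theorem rightMul_one {A : Type u} [Ring A] : rightMul (1 : A) = 𝟙 (ModuleCat.of A A) := by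
  ext
  simp [rightMul]

theorem rightMul_mul {A : Type u} [Ring A] (a b : A) :
    rightMul (a * b) = rightMul a ≫ rightMul b := by
  ext
  simp [rightMul]

/-- The right action of `A` on `Ext^n_A (M, A)` induced by right multiplication. -/
def extRightAction (R : Type u) [CommRing R] {A : Type u} [Ring A] [Algebra R A]
    (M : ModuleCat.{u} A) (n : ℕ) : Aᵐᵒᵖ →ₐ[R] Module.End R (ExtReg R M n) :=
  AlgHom.ofLinearMap (B := Module.End R (Ext.{u} M (ModuleCat.of A A) n))
    { toFun a := Ext.postcompOfLinear (Ext.mk₀ (rightMul a.unop)) R M (add_zero n)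
      map_add' a b := by
        ext x
        simp only [MulOpposite.unop_add, rightMul_add, Ext.mk₀_add]
        simp
      map_smul' r a := by
        ext x
        simp only [MulOpposite.unop_smul, mk₀_rightMul_smul R]
        simp
        rfl }
    (by
      ext x
      simp only [LinearMap.coe_mk, AddHom.coe_mk, MulOpposite.unop_one, rightMul_one]
      exact Ext.comp_mk₀_id x)
    (by
      intro a b
      ext x
      simp only [LinearMap.coe_mk, AddHom.coe_mk, MulOpposite.unop_mul, rightMul_mul,
        ← Ext.mk₀_comp_mk₀]
      exact (Ext.comp_assoc _ _ _ (add_zero n) (add_zero 0) (by simp)).symm)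

/-- The hypothesis on the Hopf algebra `A₀` over the field `k`: it is noetherian,
`Ext^i (k, A₀) = 0` for `i ≠ d`, and `Ext^d (k, A₀)` is one-dimensional. -/
structure HasExtDim (k : Type u) [Field k] (A₀ : Type u) [Ring A₀] [HopfAlgebra k A₀]
    (d : ℕ) : Prop where
  isNoetherianRing : IsNoetherianRing A₀
  ext_eq_zero (i : ℕ) (hi : i ≠ d) :
    Subsingleton (ExtReg k (trivialModule (Bialgebra.counitAlgHom k A₀)) i)
  ext_equiv : Nonempty (ExtReg k (trivialModule (Bialgebra.counitAlgHom k A₀)) d ≃ₗ[k] k)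

end ExtGroups

section Twist

variable {K : Type*} [CommRing K] (I : Ideal K)

/-- The left action of an algebra on a module, as an algebra homomorphism. -/
abbrev leftAction (K : Type*) [CommRing K] (B : Type*) [Ring B] [Algebra K B] (V : Type*)
    [AddCommGroup V] [Module K V] [Module B V] [IsScalarTower K B V] : B →ₐ[K] Module.End K V :=
  Algebra.lsmul K K V

/-- Transposition of endomorphisms, `e ↦ (f ↦ f ∘ e)`. -/
def transpose (K V : Type*) [CommRing K] [AddCommGroup V] [Module K V] :
    Module.End K V →ₐ[K] (Module.End K (Module.Dual K V))ᵐᵒᵖ :=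
  AlgHom.ofLinearMap
    ((MulOpposite.opLinearEquiv K).toLinearMap ∘ₗ Module.Dual.transpose (R := K)) rfl
    (fun _ _ => rfl)

/-- For a right `B`-module `M`, given by its action `ρ`, the right action of `B ⊗ End V` on
`M ⊗ V*`, given by `(m ⊗ f) · (b ⊗ e) = m · b ⊗ f ∘ e`. -/
def tensorDualAction {B : Type*} [Ring B] [Algebra K B] {M : Type*} [AddCommGroup M]
    [Module K M] (ρ : Bᵐᵒᵖ →ₐ[K] Module.End K M) (V : Type*) [AddCommGroup V] [Module K V] :
    B ⊗[K] Module.End K V →ₐ[K] (Module.End K (M ⊗[K] Module.Dual K V))ᵐᵒᵖ :=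
  Algebra.TensorProduct.lift
    (AlgHom.opComm.symm ((Module.End.rTensorAlgHom K M (Module.Dual K V)).comp ρ))
    ((AlgHom.op (Module.End.lTensorAlgHom K (Module.Dual K V) M)).comp (transpose K V))
    (by
      intro b e
      refine MulOpposite.unop_injective ?_
      change ((Module.Dual.transpose (R := K) e).lTensor M) ∘ₗ
          ((ρ (MulOpposite.op b)).rTensor (Module.Dual K V)) =
        ((ρ (MulOpposite.op b)).rTensor (Module.Dual K V)) ∘ₗ
          ((Module.Dual.transpose (R := K) e).lTensor M)
      rw [LinearMap.lTensor_comp_rTensor, LinearMap.rTensor_comp_lTensor])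

variable (B : Type*) [Ring B] [Algebra K B] [TopHopfAlgebra I B]
  (V : Type*) [AddCommGroup V] [Module K V] [Module B V] [IsScalarTower K B V]
  [Module.Free K V] [Module.Finite K V]

/-- The homomorphism `B → B ⊗ End V` sending `u` to `∑ u' ⊗ S²(u'')`, where `∑ u' ⊗ u''` is the
coproduct of `u`, a limit of finite sums. It takes values in the completion of `B ⊗ End V`,
which is `B ⊗ End V` since `B` is complete and `End V` is finite free. -/
def twistedComul : B →ₐ[K] B ⊗[K] Module.End K V :=
  letI : IsAdicComplete I B := TopHopfAlgebra.isAdicComplete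
  letI : IsAdicComplete I (B ⊗[K] Module.End K V) := isAdicComplete_tensor I B (Module.End K V)
  (Completion.equiv I (B ⊗[K] Module.End K V)).symm.toAlgHom.comp
    ((Completion.map I (Algebra.TensorProduct.map (AlgHom.id K B)
      ((leftAction K B V).comp (TopHopfAlgebra.antipodeSq I B)))).comp TopHopfAlgebra.comul)

/-- For a right `B`-module `M`, given by its action `ρ`, the right action of `B` on `M ⊗ V*` given
by `(m ⊗ f) · u = ∑ m · u' ⊗ f · S²(u'')`. -/
def twistAction {M : Type*} [AddCommGroup M] [Module K M] (ρ : Bᵐᵒᵖ →ₐ[K] Module.End K M) :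
    Bᵐᵒᵖ →ₐ[K] Module.End K (M ⊗[K] Module.Dual K V) :=
  AlgHom.opComm ((tensorDualAction ρ V).comp (twistedComul I B V))

end Twist

section OmegaTensorDual

variable {K : Type u} [CommRing K] (I : Ideal K) (B : Type u) [Ring B] [Algebra K B]
  [TopHopfAlgebra I B]

/-- The module `Ω = Ext^d_B (K, B)`, where `B` acts on `K` through the counit. -/
def Omega (d : ℕ) : ModuleCat.{u} K :=
  ExtReg K (trivialModule (TopHopfAlgebra.counit I (A := B))) d

/-- The right `B`-module `Ω ⊗ V*`, with action `(ω ⊗ f) · u = ∑ ω · u' ⊗ f · S²(u'')`. -/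
def omegaTensorDual (d : ℕ) (V : Type u) [AddCommGroup V] [Module K V] [Module B V]
    [IsScalarTower K B V] [Module.Free K V] [Module.Finite K V] : ModuleCat.{u} Bᵐᵒᵖ :=
  (ModuleCat.restrictScalars
    (twistAction I B V (extRightAction K (trivialModule (TopHopfAlgebra.counit I (A := B)))
      d)).toRingHom).obj
    (ModuleCat.of (Module.End K (Omega I B d ⊗[K] Module.Dual K V))
      (Omega I B d ⊗[K] Module.Dual K V))

end OmegaTensorDual

section Induction

variable {R S : Type u} [Ring R] [Ring S] (φ : R →+* S)

/-- The relations `s φ(r) ⊗ m = s ⊗ r m` defining `S ⊗_R M` as a quotient of `S ⊗_ℤ M`. -/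
def balanced (M : Type u) [AddCommGroup M] [Module R M] : Submodule S (S ⊗[ℤ] M) :=
  Submodule.span S {x | ∃ (s : S) (r : R) (m : M), x = (s * φ r) ⊗ₜ[ℤ] m - s ⊗ₜ[ℤ] (r • m)}

/-- The map `S ⊗_R M → S ⊗_R N` induced by a homomorphism `M → N` of left `R`-modules. -/
def inducedMap {M N : Type u} [AddCommGroup M] [Module R M] [AddCommGroup N] [Module R N]
    (f : M →ₗ[R] N) : (S ⊗[ℤ] M ⧸ balanced φ M) →ₗ[S] (S ⊗[ℤ] N ⧸ balanced φ N) :=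
  Submodule.mapQ _ _
    (TensorProduct.AlgebraTensorModule.map (LinearMap.id : S →ₗ[S] S)
      f.toAddMonoidHom.toIntLinearMap) (by
    rw [balanced, Submodule.span_le]
    rintro _ ⟨s, r, m, rfl⟩
    refine Submodule.subset_span ⟨s, r, f m, ?_⟩
    simp)

/-- The induced module `S ⊗_R M`, for a homomorphism `R → S` of not necessarily commutative
rings. -/
def induced (M : ModuleCat.{u} R) : ModuleCat.{u} S :=
  ModuleCat.of S (S ⊗[ℤ] M ⧸ balanced φ M)

/-- `S` is flat as a right `R`-module: the functor `S ⊗_R -` on left `R`-modules preserves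
injections. -/
def IsRightFlat : Prop :=
  ∀ (M N : Type u) [AddCommGroup M] [AddCommGroup N] [Module R M] [Module R N] (f : M →ₗ[R] N),
    Function.Injective f → Function.Injective (inducedMap φ f)

end Induction

end HopfDuality

end

/-! Both sides are read off from one double complex. Suppose that a left `A`-module M has a
resolution P by finite free modules whose `A`-dual has cohomology only in degree d, equal to a right
module T. Suppose likewise that a right module U has a resolution Q whose dual has cohomology only
in degree e, equal to a left module N. Consider the matrices over `A` with rows indexed by a basis
of P_p and columns by a basis of Q_q; the matrices of P multiply on the left and those of Q on the
right. For fixed p this is a power of the dual of Q: only q = e survives, and leaves Hom(P, N),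
which computes Ext(M, N). For fixed q it is a power of the dual of P: only p = d survives, and
leaves the complex computing Ext(U, T). Hence Ext^a(M, N) ≃ Ext^b(U, T) whenever a + e = b + d. This
is `ext_duality`; the collapse is done by hand in `nonempty_totalCohomology_equiv`.

It remains to produce such resolutions for the induced modules. By flatness it suffices to do so
over `B` and `C` (`IsMatRes.induced`, `Concentrated.induced`); flatness for the opposite rings comes
from the antipodes.

For the trivial module, noetherianity of B₀ and h-adic successive approximation
(`IsFormal.exists_apply_eq`) give a finite free resolution. It reduces modulo h to a resolution of k
over B₀, and the hypothesis on Ext over B₀ lifts: the dual is exact outside degree d, and Ω is free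
of rank one (`IsFormalComplex.exact`, `IsFormalComplex.nonempty_cohomology_equiv`).

For a representation ρ on V, the resolution is tensored with V. The result is again free, and in
coordinates each matrix entry u is replaced by the block ∑ ρ(S(u'')) u' (`TwistData`). Undoing this
twist on the resolution uses ρ; undoing it on the dual uses ρ∘S², which is where the S² in Ω ⊗ V*
comes from (`exists_resolution`). For the right module Ω ⊗ W*, the resolution of the trivial module
is carried to the opposite ring by the inverse antipode and twisted with ρ and ρ∘S² exchanged,
corrected by the winding automorphism of the character through which the algebra acts on Ω
(`exists_resolution_omegaTensorDual`). -/

noncomputable section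

namespace HopfDuality

open scoped Matrix

/-! ### Cohomology of complexes indexed by the natural numbers. -/

section Cohomology

variable {R : Type*} [Ring R] {X : ℕ → Type*} [∀ n, AddCommGroup (X n)] [∀ n, Module R (X n)]

/-- The submodule of boundaries of a sequence of modules indexed by `ℕ`. -/
def boundaries (d : ∀ n, X n →ₗ[R] X (n + 1)) : ∀ n, Submodule R (X n)
  | 0 => ⊥
  | n + 1 => LinearMap.range (d n)

/-- The module `H` is the `n`-th cohomology through the map `π`. -/
structure IsCohomology (d : ∀ n, X n →ₗ[R] X (n + 1)) (n : ℕ) {H : Type*} [AddCommGroup H]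
    [Module R H] (π : LinearMap.ker (d n) →ₗ[R] H) : Prop where
  surjective : Function.Surjective π
  eq_zero_iff (x : LinearMap.ker (d n)) : π x = 0 ↔ (x : X n) ∈ boundaries d n

/-- The `n`-th cohomology of a sequence of modules. -/
abbrev Cohomology (d : ∀ n, X n →ₗ[R] X (n + 1)) (n : ℕ) : Type _ :=
  LinearMap.ker (d n) ⧸ (boundaries d n).submoduleOf (LinearMap.ker (d n))

/-- The identification of the cohomology. -/
def IsCohomology.equiv {d : ∀ n, X n →ₗ[R] X (n + 1)} {n : ℕ} {H : Type*} [AddCommGroup H]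
    [Module R H] {π : LinearMap.ker (d n) →ₗ[R] H} (h : IsCohomology d n π) :
    Cohomology d n ≃ₗ[R] H :=
  (Submodule.quotEquivOfEq _ _ (by
    ext x
    rw [LinearMap.mem_ker, h.eq_zero_iff]
    rfl)).trans
    (LinearMap.quotKerEquivOfSurjective π h.surjective)

/-- A complex whose cohomology vanishes outside degree `e`, and is `H` in degree `e`. -/
structure Concentrated (d : ∀ n, X n →ₗ[R] X (n + 1)) (e : ℕ) (H : Type*) [AddCommGroup H]
    [Module R H] : Prop where
  comp_eq_zero (n : ℕ) (x : X n) : d (n + 1) (d n x) = 0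
  exact (n : ℕ) (hn : n ≠ e) (x : X n) (hx : d n x = 0) : x ∈ boundaries d n
  exists_cohomology : ∃ π : LinearMap.ker (d e) →ₗ[R] H, IsCohomology d e π

end Cohomology

/-! ### Double complexes whose columns have cohomology in a single row. -/

section TotalComplex

variable {K : Type*} [Ring K] {X : ℕ → ℕ → Type*} [∀ p q, AddCommGroup (X p q)]
  [∀ p q, Module K (X p q)]

/-- The shift of a family indexed by `ℕ × ℕ` along horizontal differentials. -/
def horizontalShift (dh : ∀ p q, X p q →ₗ[K] X (p + 1) q) (x : ∀ p q, X p q) : ∀ p q, X p q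
  | 0, _ => 0
  | p + 1, q => dh p q (x p q)

/-- The shift of a family indexed by `ℕ × ℕ` along vertical differentials. -/
def verticalShift (dv : ∀ p q, X p q →ₗ[K] X p (q + 1)) (x : ∀ p q, X p q) : ∀ p q, X p q
  | _, 0 => 0
  | p, q + 1 => dv p q (x p q)

variable (dh : ∀ p q, X p q →ₗ[K] X (p + 1) q) (dv : ∀ p q, X p q →ₗ[K] X p (q + 1))

/-- The total differential. -/
def totalD : (∀ p q, X p q) →ₗ[K] (∀ p q, X p q) where
  toFun x p q := horizontalShift dh x p q + verticalShift dv x p q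
  map_add' x y := by
    funext p q
    rcases p with _ | p <;> rcases q with _ | q <;>
      (simp [horizontalShift, verticalShift]; try abel)
  map_smul' r x := by
    funext p q
    rcases p with _ | p <;> rcases q with _ | q <;> simp [horizontalShift, verticalShift]

theorem totalD_apply (x : ∀ p q, X p q) (p q : ℕ) :
    totalD dh dv x p q = horizontalShift dh x p q + verticalShift dv x p q := rfl

/-- The families supported in total degree `m`. -/
def totalDegree (K : Type*) [Ring K] (X : ℕ → ℕ → Type*) [∀ p q, AddCommGroup (X p q)]
    [∀ p q, Module K (X p q)] (m : ℕ) : Submodule K (∀ p q, X p q) where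
  carrier := {x | ∀ p q, p + q ≠ m → x p q = 0}
  zero_mem' _ _ _ := rfl
  add_mem' hx hy p q h := by simp [hx p q h, hy p q h]
  smul_mem' r x hx p q h := by simp [hx p q h]

/-- The families supported in total degree `m - 1`. -/
def totalDegreePred (K : Type*) [Ring K] (X : ℕ → ℕ → Type*) [∀ p q, AddCommGroup (X p q)]
    [∀ p q, Module K (X p q)] (m : ℕ) : Submodule K (∀ p q, X p q) where
  carrier := {x | ∀ p q, p + q + 1 ≠ m → x p q = 0}
  zero_mem' _ _ _ := rfl
  add_mem' hx hy p q h := by simp [hx p q h, hy p q h]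
  smul_mem' r x hx p q h := by simp [hx p q h]

theorem totalD_mem {m : ℕ} {w : ∀ p q, X p q} (hw : w ∈ totalDegreePred K X m) :
    totalD dh dv w ∈ totalDegree K X m := by
  intro p q h
  rw [totalD_apply]
  rcases p with _ | p <;> rcases q with _ | q <;> simp only [horizontalShift, verticalShift] <;>
    (try rw [hw p _ (by omega)]) <;> (try rw [hw _ q (by omega)]) <;> simp

theorem totalD_totalD (hhh : ∀ p q x, dh (p + 1) q (dh p q x) = 0)
    (hvv : ∀ p q x, dv p (q + 1) (dv p q x) = 0)
    (hhv : ∀ p q x, dv (p + 1) q (dh p q x) + dh p (q + 1) (dv p q x) = 0) (x : ∀ p q, X p q) :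
    totalD dh dv (totalD dh dv x) = 0 := by
  funext p q
  rw [totalD_apply]
  rcases p with _ | _ | p <;> rcases q with _ | _ | q <;>
    simp [horizontalShift, verticalShift, totalD_apply, hhh, hvv, hhv, add_comm] <;>
    exact (add_comm _ _).trans (hhv _ _ _)

/-- The cocycles of total degree `m`. -/
def totalCocycles (m : ℕ) : Submodule K (∀ p q, X p q) :=
  totalDegree K X m ⊓ LinearMap.ker (totalD dh dv)

/-- The cohomology of the total complex. -/
abbrev TotalCohomology (m : ℕ) : Type _ :=
  totalCocycles dh dv m ⧸
    ((totalDegreePred K X m).map (totalD dh dv)).submoduleOf (totalCocycles dh dv m)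

variable {dh dv}

/-- The columns are cleared in increasing order of p. Once the earlier columns vanish in the rows
selected by `Q`, `hQ` makes the entries of column p there vertical boundaries; subtracting the total
differential of their primitives alters only the columns p and p + 1. The predicate `P` is the
invariant kept by these corrections. It is applied with `Q` the rows above e, and with `Q` the rows
up to e. -/
theorem exists_sub_totalD_eq_zero {m : ℕ} (Q : ℕ → Prop) (P : (∀ p q, X p q) → Prop)
    (hP : ∀ x w, P x → w ∈ totalDegreePred K X m → (∀ p q, ¬ Q (q + 1) → w p q = 0) →
      P (x - totalD dh dv w))
    (hQ : ∀ x p, P x → (∀ p' < p, ∀ q, Q q → x p' q = 0) → ∀ q, Q q →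
      x p q ∈ boundaries (dv p) q)
    (x : ∀ p q, X p q) (hx : x ∈ totalDegree K X m) (hPx : P x) :
    ∃ w ∈ totalDegreePred K X m, (∀ p q, ¬ Q (q + 1) → w p q = 0) ∧
      ∀ p q, Q q → (x - totalD dh dv w) p q = 0 := by
  classical
  have key : ∀ N : ℕ, ∃ w ∈ totalDegreePred K X m, (∀ p q, ¬ Q (q + 1) → w p q = 0) ∧
      ∀ p < N, ∀ q, Q q → (x - totalD dh dv w) p q = 0 := by
    intro N
    induction N with
    | zero => exact ⟨0, Submodule.zero_mem _, fun _ _ _ => rfl, fun p hp => by omega⟩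
    | succ N ih =>
      obtain ⟨w, hw, hwQ, hwN⟩ := ih
      have hx' : x - totalD dh dv w ∈ totalDegree K X m :=
        Submodule.sub_mem _ hx (totalD_mem dh dv hw)
      have hb := hQ _ N (hP x w hPx hw hwQ) hwN
      -- The primitive is taken to be 0 unless it has total degree m - 1 and its differential lands
      -- in a row of `Q`; in any other total degree the entry to be killed is already 0.
      have hy : ∀ q, ∃ y : X N q, (Q (q + 1) → dv N q y = (x - totalD dh dv w) N (q + 1)) ∧
          (¬ (Q (q + 1) ∧ N + q + 1 = m) → y = 0) := by
        intro q
        by_cases h : Q (q + 1) ∧ N + q + 1 = m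
        · obtain ⟨y, hy⟩ := hb (q + 1) h.1
          exact ⟨y, fun _ => hy, fun h' => (h' h).elim⟩
        · refine ⟨0, fun h' => ?_, fun _ => rfl⟩
          rw [map_zero, hx' N (q + 1) (by tauto)]
      choose y hy hy0 using hy
      let v : ∀ p q, X p q := Pi.single N y
      have hvN : v N = y := Pi.single_eq_same ..
      have hv0 : ∀ p, p ≠ N → v p = 0 := fun p hp => Pi.single_eq_of_ne hp _
      have hv : v ∈ totalDegreePred K X m := by
        intro p q h
        by_cases hp : p = N
        · subst hp
          rw [hvN]
          exact hy0 q fun h' => h h'.2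
        · rw [hv0 p hp]; rfl
      refine ⟨w + v, Submodule.add_mem _ hw hv, fun p q h => ?_, fun p hp q hq => ?_⟩
      · rw [Pi.add_apply, Pi.add_apply, hwQ p q h, zero_add]
        by_cases hp : p = N
        · subst hp
          rw [hvN]
          exact hy0 q fun h' => h h'.1
        · rw [hv0 p hp]; rfl
      · have hsplit : (x - totalD dh dv (w + v)) p q =
            (x - totalD dh dv w) p q - totalD dh dv v p q := by
          rw [map_add, ← sub_sub]; rfl
        have hh : horizontalShift dh v p q = 0 := by
          rcases p with _ | p
          · rfl
          · simp only [horizontalShift]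
            rw [hv0 p (by omega)]
            simp
        rw [hsplit, totalD_apply, hh, zero_add]
        by_cases hpN : p = N
        · subst hpN
          rcases q with _ | q
          · have := hb 0 hq
            simp only [boundaries, Submodule.mem_bot] at this
            simp [verticalShift, this]
          · simp only [verticalShift]
            rw [hvN, hy q hq, sub_self]
        · rw [hwN p (by omega) q hq]
          rcases q with _ | q
          · simp [verticalShift]
          · simp only [verticalShift]
            rw [hv0 p hpN]
            simp
  -- A nonzero entry of total degree m lies in a column p ≤ m, so m + 1 steps suffice.
  obtain ⟨w, hw, hwQ, h⟩ := key (m + 1)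
  refine ⟨w, hw, hwQ, fun p q hq => ?_⟩
  by_cases hp : p < m + 1
  · exact h p hp q hq
  · exact Submodule.sub_mem _ hx (totalD_mem dh dv hw) p q (by omega)

section Columns

variable (hhh : ∀ p q x, dh (p + 1) q (dh p q x) = 0)
    (hvv : ∀ p q x, dv p (q + 1) (dv p q x) = 0)
    (hhv : ∀ p q x, dv (p + 1) q (dh p q x) + dh p (q + 1) (dv p q x) = 0)
    {e : ℕ} (hexact : ∀ p q, q ≠ e → ∀ x, dv p q x = 0 → x ∈ boundaries (dv p) q)

include hhh hvv hhv hexact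

/-- Above row e the columns are exact, and once the earlier columns are cleared the vanishing of the
total differential makes the next entries vertical cocycles. Only the part of the differential above
row e has to vanish: the lemma is also applied to primitives, which are not cocycles. -/
theorem exists_sub_totalD_upper {m : ℕ} (x : ∀ p q, X p q) (hx : x ∈ totalDegree K X m)
    (hDx : ∀ p q, e < q → totalD dh dv x p q = 0) :
    ∃ w ∈ totalDegreePred K X m, ∀ p q, e < q → (x - totalD dh dv w) p q = 0 := by
  have hQ : ∀ (x : ∀ p q, X p q) (p : ℕ), (∀ p q, e < q → totalD dh dv x p q = 0) →
      (∀ p' < p, ∀ q, e < q → x p' q = 0) → ∀ q, e < q → x p q ∈ boundaries (dv p) q := by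
    intro x p hx h0 q hq
    refine hexact p q (by omega) _ ?_
    have := hx p (q + 1) (by omega)
    rw [totalD_apply] at this
    rcases p with _ | p
    · simpa [horizontalShift, verticalShift] using this
    · simpa [horizontalShift, verticalShift, h0 p (by omega) (q + 1) (by omega)] using this
  obtain ⟨w, hw, -, h⟩ := exists_sub_totalD_eq_zero (m := m) (fun q => e < q)
    (fun x => ∀ p q, e < q → totalD dh dv x p q = 0) (fun x w hx _ _ p q hq => by
      rw [map_sub, totalD_totalD dh dv hhh hvv hhv, sub_zero]
      exact hx p q hq) hQ x hx hDx
  exact ⟨w, hw, h⟩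

/-- Below row e the columns are exact, and in row e the hypothesis `hxb` replaces exactness. The
primitive lies strictly below row e, so subtracting it from another family leaves the entries in row
e untouched. -/
theorem exists_totalD_eq_lower {m : ℕ} (x : ∀ p q, X p q) (hx : x ∈ totalDegree K X m)
    (hDx : totalD dh dv x = 0) (hxe : ∀ p q, e < q → x p q = 0)
    (hxb : ∀ p, x p e ∈ boundaries (dv p) e) :
    ∃ w ∈ totalDegreePred K X m, (∀ p q, e ≤ q → w p q = 0) ∧ totalD dh dv w = x := by
  have hvert : ∀ w : (∀ p q, X p q), (∀ p q, ¬ q + 1 ≤ e → w p q = 0) →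
      ∀ p q, e < q → totalD dh dv w p q = 0 := by
    intro w hw p q hq
    rw [totalD_apply]
    rcases q with _ | q
    · omega
    · rcases p with _ | p <;> simp [horizontalShift, verticalShift, hw _ q (by omega),
        hw _ (q + 1) (by omega)]
  let P : (∀ p q, X p q) → Prop := fun x => totalD dh dv x = 0 ∧ (∀ p q, e < q → x p q = 0) ∧
    ∀ p, x p e ∈ boundaries (dv p) e
  have hP : ∀ x w, P x → w ∈ totalDegreePred K X m → (∀ p q, ¬ q + 1 ≤ e → w p q = 0) →
      P (x - totalD dh dv w) := by
    rintro x w ⟨h1, h2, h3⟩ _ hw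
    refine ⟨?_, fun p q hq => ?_, fun p => ?_⟩
    · rw [map_sub, totalD_totalD dh dv hhh hvv hhv, h1, sub_zero]
    · rw [Pi.sub_apply, Pi.sub_apply, h2 p q hq, hvert w hw p q hq, sub_zero]
    · refine Submodule.sub_mem _ (h3 p) ?_
      rw [totalD_apply]
      have hh : horizontalShift dh w p e = 0 := by
        rcases p with _ | p
        · rfl
        · simp [horizontalShift, hw p e (by omega)]
      rw [hh, zero_add]
      rcases e with _ | e
      · exact Submodule.zero_mem _
      · exact ⟨_, rfl⟩
  have hQ : ∀ x p, P x → (∀ p' < p, ∀ q, q ≤ e → x p' q = 0) → ∀ q, q ≤ e →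
      x p q ∈ boundaries (dv p) q := by
    rintro x p ⟨h1, h2, h3⟩ h0 q hq
    rcases hq.lt_or_eq with hq | rfl
    · refine hexact p q (by omega) _ ?_
      have := congrFun (congrFun h1 p) (q + 1)
      rw [totalD_apply] at this
      rcases p with _ | p
      · simpa [horizontalShift, verticalShift] using this
      · simpa [horizontalShift, verticalShift, h0 p (by omega) (q + 1) (by omega)] using this
    · exact h3 p
  obtain ⟨w, hw, hw0, h⟩ := exists_sub_totalD_eq_zero (dh := dh) (dv := dv) (m := m)
    (fun q => q ≤ e) P hP hQ x hx ⟨hDx, hxe, hxb⟩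
  refine ⟨w, hw, fun p q hq => hw0 p q (by omega), ?_⟩
  funext p q
  by_cases hq : q ≤ e
  · exact (sub_eq_zero.1 (h p q hq)).symm
  · rw [hxe p q (by omega), hvert w hw0 p q (by omega)]

/-- In total degree less than e every nonzero entry lies below row e, so there is no obstruction in
row e. -/
theorem subsingleton_totalCohomology {m : ℕ} (hm : m < e) :
    Subsingleton (TotalCohomology dh dv m) := by
  rw [Submodule.Quotient.subsingleton_iff, eq_top_iff]
  rintro ⟨x, hx, hDx⟩ -
  obtain ⟨w, hw, -, h⟩ := exists_totalD_eq_lower hhh hvv hhv hexact x hx hDx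
    (fun p q hq => hx p q (by omega)) (fun p => by
      rw [hx p e (by omega)]; exact Submodule.zero_mem _)
  exact ⟨w, hw, h⟩

variable {Y : ℕ → Type*} [∀ p, AddCommGroup (Y p)] [∀ p, Module K (Y p)]
  {dY : ∀ p, Y p →ₗ[K] Y (p + 1)} (π : ∀ p, LinearMap.ker (dv p e) →ₗ[K] Y p)
  (hπ : ∀ p, IsCohomology (dv p) e (π p))
  (hdY : ∀ p (x : LinearMap.ker (dv p e)) (x' : LinearMap.ker (dv (p + 1) e)),
    (x' : X (p + 1) e) = dh p e x → π (p + 1) x' = dY p (π p x))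

include hπ hdY

/-- Both sides are quotients of the module `L` of total cocycles vanishing above row e: `f` takes
the class of the cocycle, and `g` takes the class of its entry in bidegree (a, e). Both maps are
onto and have the same kernel. -/
theorem nonempty_totalCohomology_equiv {m a : ℕ} (hm : a + e = m) :
    Nonempty (TotalCohomology dh dv m ≃ₗ[K] Cohomology dY a) := by
  classical
  let L : Submodule K (∀ p q, X p q) :=
    { carrier := {x | x ∈ totalCocycles dh dv m ∧ ∀ p q, e < q → x p q = 0}
      zero_mem' := ⟨Submodule.zero_mem _, fun _ _ _ => rfl⟩
      add_mem' := fun hx hy => ⟨Submodule.add_mem _ hx.1 hy.1, fun p q h => by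
        simp [hx.2 p q h, hy.2 p q h]⟩
      smul_mem' := fun r x hx => ⟨Submodule.smul_mem _ _ hx.1, fun p q h => by
        simp [hx.2 p q h]⟩ }
  have hdv : ∀ x : (∀ p q, X p q), (∀ p q, e < q → totalD dh dv x p q = 0) →
      (∀ p q, e < q → x p q = 0) → ∀ p, dv p e (x p e) = 0 := by
    intro x hx h0 p
    have := hx p (e + 1) (by omega)
    rw [totalD_apply] at this
    rcases p with _ | p
    · simpa [horizontalShift, verticalShift] using this
    · simpa [horizontalShift, verticalShift, h0 p (e + 1) (by omega)] using this
  have hdvh : ∀ p (x : X p e), dv p e x = 0 → dv (p + 1) e (dh p e x) = 0 := by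
    intro p x hx
    have := hhv p e x
    rwa [hx, map_zero, add_zero] at this
  have hL : ∀ x : L, dv a e (x.1 a e) = 0 := fun x =>
    hdv x.1 (fun p q _ => by rw [LinearMap.mem_ker.1 x.2.1.2]; rfl) x.2.2 a
  have hπb : ∀ p (x : LinearMap.ker (dv p e)), (x : X p e) ∈ boundaries (dv p) e → π p x = 0 :=
    fun p x hx => ((hπ p).eq_zero_iff x).2 hx
  let toY : L →ₗ[K] Y a := (π a).comp
    ({ toFun := fun x => ⟨x.1 a e, hL x⟩
       map_add' := fun _ _ => rfl
       map_smul' := fun _ _ => rfl } : L →ₗ[K] LinearMap.ker (dv a e))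
  have toY_apply : ∀ x : L, toY x = π a ⟨x.1 a e, hL x⟩ := fun _ => rfl
  have toY_ker : ∀ x : L, toY x ∈ LinearMap.ker (dY a) := by
    intro x
    rw [LinearMap.mem_ker, toY_apply, ← hdY a ⟨x.1 a e, hL x⟩ ⟨dh a e (x.1 a e),
      hdvh a _ (hL x)⟩ rfl]
    refine hπb _ _ ?_
    have h := congrFun (congrFun (LinearMap.mem_ker.1 x.2.1.2) (a + 1)) e
    rw [totalD_apply] at h
    change dh a e (x.1 a e) + _ = 0 at h
    change dh a e (x.1 a e) ∈ _
    rw [eq_neg_of_add_eq_zero_left h]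
    refine Submodule.neg_mem _ ?_
    rcases e with _ | e
    · exact Submodule.zero_mem _
    · exact ⟨_, rfl⟩
  let f : L →ₗ[K] TotalCohomology dh dv m :=
    (Submodule.mkQ _).comp (Submodule.inclusion (fun x hx => hx.1))
  let g : L →ₗ[K] Cohomology dY a :=
    (Submodule.mkQ _).comp (toY.codRestrict (LinearMap.ker (dY a)) toY_ker)
  have hf0 : ∀ x : L, f x = 0 ↔ ∃ w ∈ totalDegreePred K X m, totalD dh dv w = x.1 := fun x => by
    change Submodule.Quotient.mk _ = 0 ↔ _
    rw [Submodule.Quotient.mk_eq_zero]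
    rfl
  have hg0 : ∀ x : L, g x = 0 ↔ toY x ∈ boundaries dY a := fun x => by
    change Submodule.Quotient.mk _ = 0 ↔ _
    rw [Submodule.Quotient.mk_eq_zero]
    rfl
  have hfs : Function.Surjective f := by
    intro z
    obtain ⟨⟨x, hx, hDx⟩, rfl⟩ := Submodule.mkQ_surjective _ z
    replace hDx : totalD dh dv x = 0 := hDx
    obtain ⟨w, hw, h⟩ := exists_sub_totalD_upper hhh hvv hhv hexact x hx
      (fun p q _ => by rw [hDx]; rfl)
    refine ⟨⟨x - totalD dh dv w, ⟨⟨Submodule.sub_mem _ hx (totalD_mem dh dv hw), ?_⟩, h⟩⟩, ?_⟩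
    · change totalD dh dv (x - totalD dh dv w) = 0
      rw [map_sub, totalD_totalD dh dv hhh hvv hhv, hDx, sub_zero]
    · refine (Submodule.Quotient.eq _).2 ?_
      refine ⟨-w, Submodule.neg_mem _ hw, ?_⟩
      rw [map_neg]
      change _ = (x - totalD dh dv w) - x
      abel
  -- a vertical cocycle, as a family concentrated in one bidegree
  let s (b : ℕ) (y : X b e) : ∀ p q, X p q := Pi.single b (Pi.single e y)
  have hs : ∀ b y, s b y b e = y := fun b y => by simp [s]
  have hs0 : ∀ b y p q, (p ≠ b ∨ q ≠ e) → s b y p q = 0 := by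
    intro b y p q h
    by_cases hp : p = b
    · subst hp
      simp only [s, Pi.single_eq_same]
      exact Pi.single_eq_of_ne (by tauto) _
    · simp only [s]
      rw [Pi.single_eq_of_ne hp]
      rfl
  have hDs : ∀ b y, dv b e y = 0 → totalD dh dv (s b y) = s (b + 1) (dh b e y) := by
    intro b y hy
    funext p q
    rw [totalD_apply]
    have h1 : verticalShift dv (s b y) p q = 0 := by
      rcases q with _ | q
      · rfl
      · simp only [verticalShift]
        by_cases h : p ≠ b ∨ q ≠ e
        · rw [hs0 b y p q h, map_zero]
        · push Not at h
          obtain ⟨rfl, rfl⟩ := h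
          rw [hs, hy]
    rw [h1, add_zero]
    rcases p with _ | p
    · rw [hs0 _ _ _ _ (Or.inl (by omega))]; rfl
    · simp only [horizontalShift]
      by_cases h : p ≠ b ∨ q ≠ e
      · rw [hs0 b y p q h, map_zero, hs0 _ _ _ _ (by omega)]
      · push Not at h
        obtain ⟨rfl, rfl⟩ := h
        rw [hs, hs]
  -- A vertical cocycle y whose class is a cocycle of `dY` has a horizontal differential that is a
  -- vertical boundary. A family strictly below row e then corrects `s a y` to a total cocycle with
  -- the same entry in bidegree (a, e).
  have hgs : Function.Surjective g := by
    intro z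
    obtain ⟨⟨c, hc⟩, rfl⟩ := Submodule.mkQ_surjective _ z
    obtain ⟨⟨y, hy⟩, rfl⟩ := (hπ a).surjective c
    have hDy := hDs a y hy
    rw [LinearMap.mem_ker] at hc
    rw [← hdY a ⟨y, hy⟩ ⟨dh a e y, hdvh a y hy⟩ rfl, (hπ _).eq_zero_iff] at hc
    obtain ⟨w, hw, hw0, h⟩ := exists_totalD_eq_lower hhh hvv hhv hexact (m := m + 1)
      (s (a + 1) (dh a e y)) (fun p q h => hs0 _ _ _ _ (by omega)) (by
        rw [← hDy, totalD_totalD dh dv hhh hvv hhv])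
      (fun p q hq => hs0 _ _ _ _ (by omega)) (fun p => by
        by_cases hp : p = a + 1
        · subst hp
          rw [hs]; exact hc
        · rw [hs0 _ _ _ _ (Or.inl hp)]; exact Submodule.zero_mem _)
    have hmem : s a y - w ∈ L := by
      refine ⟨⟨fun p q h => ?_, ?_⟩, fun p q hq => ?_⟩
      · rw [Pi.sub_apply, Pi.sub_apply, hs0 _ _ _ _ (by omega), hw p q (by omega), sub_zero]
      · change totalD dh dv (s a y - w) = 0
        rw [map_sub, h, hDy, sub_self]
      · rw [Pi.sub_apply, Pi.sub_apply, hs0 _ _ _ _ (by omega), hw0 p q (by omega), sub_zero]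
    refine ⟨⟨s a y - w, hmem⟩, ?_⟩
    refine congrArg (Submodule.mkQ _) (Subtype.ext ?_)
    change toY _ = π a _
    rw [toY_apply]
    congr 2
    change s a y a e - w a e = y
    rw [hs, hw0 a e le_rfl, sub_zero]
  have hfg : LinearMap.ker f = LinearMap.ker g := by
    ext x
    rw [LinearMap.mem_ker, LinearMap.mem_ker, hf0, hg0]
    constructor
    · rintro ⟨w, hw, hwx⟩
      rcases m with _ | m
      · have hw' : w = 0 := funext fun p => funext fun q => hw p q (by omega)
        have hx : x = 0 := Subtype.ext (by rw [← hwx, hw', map_zero]; rfl)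
        rw [hx, map_zero]
        exact Submodule.zero_mem _
      · have hwm : w ∈ totalDegree K X m := fun p q h => hw p q (by omega)
        -- The primitive is first cleared above row e, so that its entries in row e become vertical
        -- cocycles and have classes in `Y`.
        obtain ⟨v, hv, h⟩ := exists_sub_totalD_upper hhh hvv hhv hexact w hwm (by
          intro p q hq
          rw [hwx]; exact x.2.2 p q hq)
        set w' := w - totalD dh dv v with hw'
        have hDw' : totalD dh dv w' = x.1 := by
          rw [hw', map_sub, totalD_totalD dh dv hhh hvv hhv, sub_zero, hwx]
        have hker := hdv w' (fun p q hq => by rw [hDw']; exact x.2.2 p q hq) h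
        have hxae : x.1 a e = horizontalShift dh w' a e + verticalShift dv w' a e := by
          rw [← totalD_apply, hDw']
        have hvb : verticalShift dv w' a e ∈ boundaries (dv a) e := by
          rcases e with _ | e
          · exact Submodule.zero_mem _
          · exact ⟨_, rfl⟩
        rcases a with _ | a
        · have : toY x = 0 := by
            rw [toY_apply]
            refine hπb _ _ ?_
            change x.1 0 e ∈ _
            rw [hxae]
            simpa [horizontalShift] using hvb
          rw [this]; exact Submodule.zero_mem _
        · refine ⟨π a ⟨w' a e, hker a⟩, ?_⟩
          rw [← hdY a ⟨w' a e, hker a⟩ ⟨dh a e (w' a e), hdvh a _ (hker a)⟩ rfl, toY_apply,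
            ← sub_eq_zero, ← map_sub]
          refine hπb _ _ ?_
          change dh a e (w' a e) - x.1 (a + 1) e ∈ _
          rw [hxae]
          change _ - (dh a e (w' a e) + _) ∈ _
          rw [sub_add_cancel_left]
          exact Submodule.neg_mem _ hvb
    · intro hx
      have hxD := LinearMap.mem_ker.1 x.2.1.2
      -- It is enough to match x in bidegree (a, e) up to a vertical boundary: the difference is
      -- then a total boundary by the statement on lower rows.
      have fin : ∀ v ∈ totalDegreePred K X m, (∀ p q, e < q → totalD dh dv v p q = 0) →
          x.1 a e - totalD dh dv v a e ∈ boundaries (dv a) e →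
          ∃ w ∈ totalDegreePred K X m, totalD dh dv w = x.1 := by
        intro v hv hv0 hb
        obtain ⟨w, hw, -, h⟩ := exists_totalD_eq_lower hhh hvv hhv hexact (m := m)
          (x.1 - totalD dh dv v) (Submodule.sub_mem _ x.2.1.1 (totalD_mem dh dv hv))
          (by rw [map_sub, totalD_totalD dh dv hhh hvv hhv, hxD, sub_zero])
          (fun p q hq => by rw [Pi.sub_apply, Pi.sub_apply, x.2.2 p q hq, hv0 p q hq, sub_zero])
          (fun p => by
            by_cases hp : p = a
            · subst hp; exact hb
            · rw [Submodule.sub_mem _ x.2.1.1 (totalD_mem dh dv hv) p e (by omega)]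
              exact Submodule.zero_mem _)
        exact ⟨w + v, Submodule.add_mem _ hw hv, by rw [map_add, h, sub_add_cancel]⟩
      rcases a with _ | a
      · refine fin 0 (Submodule.zero_mem _) (fun p q _ => by rw [map_zero]; rfl) ?_
        rw [map_zero]
        change x.1 0 e - 0 ∈ _
        rw [sub_zero]
        exact ((hπ 0).eq_zero_iff _).1 ((Submodule.mem_bot K).1 hx)
      · obtain ⟨c, hc⟩ := hx
        obtain ⟨⟨y, hy⟩, rfl⟩ := (hπ a).surjective c
        refine fin (s a y) (fun p q h => hs0 _ _ _ _ (by omega)) (fun p q hq => ?_) ?_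
        · rw [hDs a y hy, hs0 _ _ _ _ (by omega)]
        · rw [hDs a y hy, hs]
          rw [← hdY a ⟨y, hy⟩ ⟨dh a e y, hdvh a y hy⟩ rfl, toY_apply, ← sub_eq_zero,
            ← map_sub, (hπ _).eq_zero_iff] at hc
          have := Submodule.neg_mem _ hc
          change -(dh a e y - x.1 (a + 1) e) ∈ _ at this
          rwa [neg_sub] at this
  exact ⟨((LinearMap.quotKerEquivOfSurjective f hfs).symm.trans
    (Submodule.quotEquivOfEq _ _ hfg)).trans (LinearMap.quotKerEquivOfSurjective g hgs)⟩

end Columns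

/-- Exchanging the two directions does not change the total cohomology. -/
theorem nonempty_totalCohomology_flip (m : ℕ) :
    Nonempty (TotalCohomology (X := fun q p => X p q) (fun q p => dv p q) (fun q p => dh p q) m
      ≃ₗ[K] TotalCohomology dh dv m) := by
  let F : (∀ q p, X p q) ≃ₗ[K] (∀ p q, X p q) :=
    { toFun := fun x p q => x q p
      invFun := fun x q p => x p q
      map_add' := fun _ _ => rfl
      map_smul' := fun _ _ => rfl }
  have hF : ∀ x, totalD dh dv (F x) =
      F (totalD (X := fun q p => X p q) (fun q p => dv p q) (fun q p => dh p q) x) := by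
    intro x
    funext p q
    change _ = totalD (X := fun q p => X p q) (fun q p => dv p q) (fun q p => dh p q) x q p
    rw [totalD_apply, totalD_apply, add_comm]
    rcases p with _ | p <;> rcases q with _ | q <;> rfl
  have h1 : ∀ x, x ∈ totalCocycles (X := fun q p => X p q) (fun q p => dv p q)
      (fun q p => dh p q) m ↔ F x ∈ totalCocycles dh dv m := by
    intro x
    refine and_congr ⟨fun h p q hpq => h q p (by omega), fun h q p hpq => h p q (by omega)⟩ ?_
    change _ = 0 ↔ totalD dh dv (F x) = 0
    rw [hF, F.map_eq_zero_iff]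
  have hmap : (totalCocycles (X := fun q p => X p q) (fun q p => dv p q)
      (fun q p => dh p q) m).map F.toLinearMap = totalCocycles dh dv m := by
    ext y
    constructor
    · rintro ⟨x, hx, rfl⟩
      exact (h1 x).1 hx
    · intro hy
      exact ⟨F.symm y, (h1 _).2 (by simpa using hy), by simp⟩
  let G := F.submoduleMap (totalCocycles (X := fun q p => X p q) (fun q p => dv p q)
      (fun q p => dh p q) m) |>.trans (LinearEquiv.ofEq _ _ hmap)
  refine ⟨Submodule.Quotient.equiv _ _ G ?_⟩
  ext ⟨y, hy⟩
  constructor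
  · rintro ⟨⟨x, hx⟩, ⟨w, hw, hwx⟩, hxy⟩
    refine ⟨F w, fun p q hpq => hw q p (by omega), ?_⟩
    rw [hF, hwx]
    exact congrArg Subtype.val hxy
  · rintro ⟨w, hw, hwy⟩
    have hw' : totalD dh dv w = y := hwy
    refine ⟨⟨F.symm y, (h1 _).2 (by simpa using hy)⟩, ⟨F.symm w, fun q p hpq =>
      hw p q (by omega), ?_⟩, Subtype.ext (F.apply_symm_apply y)⟩
    refine F.injective ?_
    rw [← hF, F.apply_symm_apply, hw']
    exact (F.apply_symm_apply y).symm

end TotalComplex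

/-! ### Finite free resolutions given by matrices. -/

section MatrixResolutions

/-- The action of a matrix with entries in `R` on vectors with entries in an `R`-module. -/
def matAct (L : Type*) [Semiring L] {R : Type*} [Ring R] {ι κ : Type*} [Fintype ι]
    (D : Matrix κ ι R) (N : Type*) [AddCommGroup N] [Module R N] [Module L N]
    [SMulCommClass R L N] : (ι → N) →ₗ[L] (κ → N) where
  toFun y a := ∑ b, D a b • y b
  map_add' x y := by
    funext a
    simp [smul_add, Finset.sum_add_distrib]
  map_smul' r x := by
    funext a
    simp only [Pi.smul_apply, RingHom.id_apply, Finset.smul_sum]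
    exact Finset.sum_congr rfl fun b _ => smul_comm _ _ _

theorem matAct_apply (L : Type*) [Semiring L] {R : Type*} [Ring R] {ι κ : Type*} [Fintype ι]
    (D : Matrix κ ι R) (N : Type*) [AddCommGroup N] [Module R N] [Module L N]
    [SMulCommClass R L N] (y : ι → N) (a : κ) : matAct L D N y a = ∑ b, D a b • y b := rfl

/-- A tuple in N is a homomorphism from a free module to N, and letting a matrix act on the tuple is
composing this homomorphism with the row-vector map of the matrix. So the maps `matAct` form the
complex Hom(P, N). -/
theorem linearCombination_vecMul {R : Type*} [Ring R] {ι κ : Type*} [Fintype ι] [Fintype κ]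
    (D : Matrix κ ι R) {N : Type*} [AddCommGroup N] [Module R N] (x : ι → N) (y : κ → R) :
    Fintype.linearCombination R x (y ᵥ* D) =
      Fintype.linearCombination R (matAct ℤ D N x) y := by
  simp only [Fintype.linearCombination_apply, Matrix.vecMul, dotProduct, matAct_apply,
    Finset.smul_sum, Finset.sum_smul, mul_smul]
  exact Finset.sum_comm

/-- A resolution of a module by finite free modules, with differentials given by matrices. -/
structure IsMatRes {R : Type*} [Ring R] {ι : ℕ → Type} [∀ n, Fintype (ι n)]
    (D : ∀ n, Matrix (ι (n + 1)) (ι n) R) {M : Type*} [AddCommGroup M] [Module R M]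
    (aug : (ι 0 → R) →ₗ[R] M) : Prop where
  surjective : Function.Surjective aug
  exact_zero (x : ι 0 → R) : aug x = 0 ↔ ∃ y, y ᵥ* D 0 = x
  exact_succ (n : ℕ) (x : ι (n + 1) → R) : x ᵥ* D n = 0 ↔ ∃ y, y ᵥ* D (n + 1) = x

/-- The first syzygy of a resolution is resolved by the shifted resolution. -/
theorem IsMatRes.syzygy {R : Type*} [Ring R] {ι : ℕ → Type} [∀ n, Fintype (ι n)]
    {D : ∀ n, Matrix (ι (n + 1)) (ι n) R} {M : Type*} [AddCommGroup M] [Module R M]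
    {aug : (ι 0 → R) →ₗ[R] M} (h : IsMatRes D aug) :
    IsMatRes (ι := fun n => ι (n + 1)) (fun n => D (n + 1))
      ((D 0).vecMulLinear.codRestrict (LinearMap.ker aug)
        fun y => (h.exact_zero _).2 ⟨y, rfl⟩) where
  surjective := by
    rintro ⟨x, hx⟩
    obtain ⟨y, rfl⟩ := (h.exact_zero x).1 hx
    exact ⟨y, rfl⟩
  exact_zero x := by
    rw [← h.exact_succ 0, Subtype.ext_iff]
    rfl
  exact_succ n x := h.exact_succ (n + 1) x

end MatrixResolutions

/-! ### Ext groups computed from a matrix resolution, naturally in the second argument. -/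

section ExtPresentation

open Abelian

variable {R : Type u} [Ring R] {ι : ℕ → Type} [∀ n, Fintype (ι n)]

/-- A presentation of the groups `Ext^n (M, N)`, natural in `N`, as the cohomology of the complex
obtained by letting the matrices `D` act on `N`. -/
structure ExtPresentation (D : ∀ n, Matrix (ι (n + 1)) (ι n) R) (M : ModuleCat.{u} R)
    (n : ℕ) where
  toFun (N : ModuleCat.{u} R) : LinearMap.ker (matAct ℤ (D n) N) →+ Ext.{u} M N n
  surjective (N : ModuleCat.{u} R) : Function.Surjective (toFun N)
  eq_zero_iff (N : ModuleCat.{u} R) (x : LinearMap.ker (matAct ℤ (D n) N)) :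
    toFun N x = 0 ↔ (x : ι n → N) ∈ boundaries (fun n => matAct ℤ (D n) N) n
  natural {N N' : ModuleCat.{u} R} (f : N ⟶ N') (x : LinearMap.ker (matAct ℤ (D n) N))
    (x' : LinearMap.ker (matAct ℤ (D n) N')) (h : ∀ i, x'.1 i = f.hom (x.1 i)) :
    toFun N' x' = (toFun N x).comp (Ext.mk₀ f) (add_zero n)

variable {D : ∀ n, Matrix (ι (n + 1)) (ι n) R} {M : ModuleCat.{u} R} {aug : (ι 0 → R) →ₗ[R] M}

theorem IsMatRes.exists_desc (h : IsMatRes D aug) {N : Type*} [AddCommGroup N] [Module R N]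
    (x : LinearMap.ker (matAct ℤ (D 0) N)) :
    ∃ g : M →ₗ[R] N, ∀ z, g (aug z) = Fintype.linearCombination R x.1 z := by
  have hle : LinearMap.ker aug ≤ LinearMap.ker (Fintype.linearCombination R x.1) := by
    intro z hz
    obtain ⟨y, rfl⟩ := (h.exact_zero z).1 hz
    rw [LinearMap.mem_ker, linearCombination_vecMul, LinearMap.mem_ker.1 x.2]
    simp [Fintype.linearCombination_apply]
  refine ⟨((LinearMap.ker aug).liftQ _ hle).comp
    (LinearMap.quotKerEquivOfSurjective aug h.surjective).symm.toLinearMap, fun z => ?_⟩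
  have : (LinearMap.quotKerEquivOfSurjective aug h.surjective).symm (aug z) =
      Submodule.Quotient.mk z := by
    rw [LinearEquiv.symm_apply_eq]
    rfl
  simp [this]

/-- The homomorphism defined by a cocycle of degree `0`. -/
def IsMatRes.desc (h : IsMatRes D aug) (N : Type*) [AddCommGroup N] [Module R N] :
    LinearMap.ker (matAct ℤ (D 0) N) →+ (M →ₗ[R] N) where
  toFun x := (h.exists_desc x).choose
  map_zero' := by
    ext z
    obtain ⟨z, rfl⟩ := h.surjective z
    rw [(h.exists_desc _).choose_spec]
    simp [Fintype.linearCombination_apply]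
  map_add' x y := by
    ext z
    obtain ⟨z, rfl⟩ := h.surjective z
    rw [LinearMap.add_apply, (h.exists_desc _).choose_spec, (h.exists_desc _).choose_spec,
      (h.exists_desc _).choose_spec]
    simp [Fintype.linearCombination_apply, Finset.sum_add_distrib]

theorem IsMatRes.desc_aug (h : IsMatRes D aug) {N : Type*} [AddCommGroup N] [Module R N]
    (x : LinearMap.ker (matAct ℤ (D 0) N)) (z : ι 0 → R) :
    h.desc N x (aug z) = Fintype.linearCombination R x.1 z :=
  (h.exists_desc x).choose_spec z

theorem linearCombination_eq_of_apply_single {ι : Type*} [Fintype ι] [DecidableEq ι] {N : Type*}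
    [AddCommGroup N] [Module R N] (g : (ι → R) →ₗ[R] N) :
    Fintype.linearCombination R (fun i => g (Pi.single i 1)) = g := by
  refine LinearMap.pi_ext' fun i => LinearMap.ext_ring ?_
  simp

/-- The presentation of homomorphisms. -/
def IsMatRes.extPresentationZero (h : IsMatRes D aug) : ExtPresentation D M 0 where
  toFun N := AddMonoidHom.mk' (fun x => Ext.mk₀ (ModuleCat.ofHom (h.desc N x) : M ⟶ N))
    fun x y => by rw [map_add, ModuleCat.ofHom_add, Ext.mk₀_add]
  surjective N := by
    classical
    intro z
    obtain ⟨g, rfl⟩ := (Ext.mk₀_bijective M N).2 z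
    let x : ι 0 → N := fun i => g.hom (aug (Pi.single i 1))
    have hlc : Fintype.linearCombination R x = g.hom.comp aug :=
      linearCombination_eq_of_apply_single (g.hom.comp aug)
    have hx : matAct ℤ (D 0) N x = 0 := by
      funext a
      have h1 := linearCombination_vecMul (D 0) x (Pi.single a 1)
      rw [hlc, LinearMap.comp_apply, (h.exact_zero _).2 ⟨_, rfl⟩, map_zero] at h1
      simpa using h1.symm
    refine ⟨⟨x, hx⟩, ?_⟩
    refine congrArg Ext.mk₀ (ModuleCat.hom_ext (LinearMap.ext fun z => ?_))
    obtain ⟨z, rfl⟩ := h.surjective z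
    exact (h.desc_aug _ z).trans (DFunLike.congr_fun hlc z)
  eq_zero_iff N x := by
    classical
    change Ext.mk₀ _ = 0 ↔ _
    rw [Ext.mk₀_eq_zero_iff]
    simp only [boundaries, Submodule.mem_bot]
    constructor
    · intro h0
      funext i
      have := h.desc_aug x (Pi.single i 1)
      rw [show h.desc N x = 0 from congrArg ModuleCat.Hom.hom h0] at this
      simpa using this.symm
    · intro h0
      have : x = 0 := Subtype.ext h0
      rw [this, map_zero]
      rfl
  natural {N N'} f x x' hxx := by
    change Ext.mk₀ _ = (Ext.mk₀ _).comp (Ext.mk₀ f) _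
    rw [Ext.mk₀_comp_mk₀]
    refine congrArg _ (ModuleCat.hom_ext (LinearMap.ext fun z => ?_))
    obtain ⟨z, rfl⟩ := h.surjective z
    refine (h.desc_aug x' z).trans ((?_ : _ = f.hom (Fintype.linearCombination R x.1 z)).trans
      (congrArg f.hom (h.desc_aug x z).symm))
    simp [Fintype.linearCombination_apply, hxx]

/-- The short exact sequence defining the first syzygy. -/
theorem IsMatRes.shortExact (h : IsMatRes D aug) :
    (ShortComplex.mk (X₁ := ModuleCat.of R (LinearMap.ker aug)) (X₂ := ModuleCat.of R (ι 0 → R))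
      (X₃ := M) (ModuleCat.ofHom (LinearMap.ker aug).subtype) (ModuleCat.ofHom aug)
      (by ext x; exact x.2)).ShortExact := by
  refine ShortComplex.ShortExact.mk' ?_ ?_ ?_
  · rw [ShortComplex.moduleCat_exact_iff]
    intro x hx
    exact ⟨⟨x, hx⟩, rfl⟩
  · rw [ModuleCat.mono_iff_injective]
    exact Subtype.val_injective
  · rw [ModuleCat.epi_iff_surjective]
    exact h.surjective

/-- The presentation of `Ext^(n + 1)` obtained from that of `Ext^n` for the first syzygy. -/
def IsMatRes.extPresentationSucc (h : IsMatRes D aug) {n : ℕ}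
    (P : ExtPresentation (ι := fun n => ι (n + 1)) (fun n => D (n + 1))
      (ModuleCat.of R (LinearMap.ker aug)) n)
    (hP : ∀ (N : ModuleCat.{u} R) (x : LinearMap.ker (matAct ℤ (D (n + 1)) N)),
      (∃ y : Ext.{u} (ModuleCat.of R (ι 0 → R)) N n,
        (Ext.mk₀ (ModuleCat.ofHom (LinearMap.ker aug).subtype)).comp y (zero_add n) =
          P.toFun N x) ↔
        (x : ι (n + 1) → N) ∈ LinearMap.range (matAct ℤ (D n) N)) :
    ExtPresentation D M (n + 1) where
  toFun N := (AddMonoidHom.mk' (fun y : Ext.{u} (ModuleCat.of R (LinearMap.ker aug)) N n =>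
      h.shortExact.extClass.comp y (add_comm 1 n)) (fun _ _ => by simp)).comp (P.toFun N)
  surjective N := by
    intro z
    obtain ⟨y, hy⟩ := Ext.contravariant_sequence_exact₃ h.shortExact N z
      (Ext.eq_zero_of_projective _) (add_comm 1 n)
    obtain ⟨x, rfl⟩ := P.surjective N y
    exact ⟨x, hy⟩
  eq_zero_iff N x := by
    refine Iff.trans ?_ (hP N x)
    constructor
    · intro hx
      exact Ext.contravariant_sequence_exact₁ h.shortExact N _ (add_comm 1 n) hx
    · rintro ⟨y, hy⟩
      change h.shortExact.extClass.comp (P.toFun N x) (add_comm 1 n) = 0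
      rw [← hy]
      exact h.shortExact.extClass_comp_assoc y
  natural {N N'} f x x' hxx := by
    change h.shortExact.extClass.comp (P.toFun N' x') (add_comm 1 n) =
      (h.shortExact.extClass.comp (P.toFun N x) (add_comm 1 n)).comp (Ext.mk₀ f) _
    rw [P.natural f x x' hxx]
    exact (Ext.comp_assoc_of_third_deg_zero _ _ _ _).symm

/-- Dimension shifting along the first syzygy; the resolution is quantified after n because the
induction passes to the shifted resolution. The step from 0 to 1 is separate: there one divides by
the maps that extend to the free module, whereas Ext of positive degree from a free module vanishes.
-/
theorem IsMatRes.nonempty_extPresentation (n : ℕ) : ∀ {ι : ℕ → Type} [∀ n, Fintype (ι n)]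
    {D : ∀ n, Matrix (ι (n + 1)) (ι n) R} {M : ModuleCat.{u} R} {aug : (ι 0 → R) →ₗ[R] M}
    (_ : IsMatRes D aug), Nonempty (ExtPresentation D M n) := by
  induction n with
  | zero => exact fun h => ⟨h.extPresentationZero⟩
  | succ n ih =>
    intro ι _ D M aug h
    have hs := h.syzygy
    rcases n with _ | n
    · refine ⟨h.extPresentationSucc
        (IsMatRes.extPresentationZero (M := ModuleCat.of R (LinearMap.ker aug)) hs) ?_⟩
      classical
      intro N x
      have hinj : ∀ y : ModuleCat.of R (ι 0 → R) ⟶ N,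
          (Ext.mk₀ (ModuleCat.ofHom (LinearMap.ker aug).subtype)).comp (Ext.mk₀ y) (zero_add 0) =
            (IsMatRes.extPresentationZero (M := ModuleCat.of R (LinearMap.ker aug)) hs).toFun N x
            ↔ ∀ z, y.hom (z ᵥ* D 0) = Fintype.linearCombination R x.1 z := by
        intro y
        rw [Ext.mk₀_comp_mk₀]
        change Ext.mk₀ _ = Ext.mk₀ _ ↔ _
        rw [(Ext.mk₀_bijective _ _).1.eq_iff]
        constructor
        · intro he z
          have := congrArg (fun g => g.hom (⟨z ᵥ* D 0, (h.exact_zero _).2 ⟨z, rfl⟩⟩ :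
            LinearMap.ker aug)) he
          exact this.trans (IsMatRes.desc_aug (M := ModuleCat.of R (LinearMap.ker aug)) hs x z)
        · intro he
          refine ModuleCat.hom_ext (LinearMap.ext fun z => ?_)
          obtain ⟨z, rfl⟩ := hs.surjective z
          exact (he z).trans
            (IsMatRes.desc_aug (M := ModuleCat.of R (LinearMap.ker aug)) hs x z).symm
      constructor
      · rintro ⟨y, hy⟩
        obtain ⟨y, rfl⟩ := (Ext.mk₀_bijective _ _).2 y
        rw [hinj] at hy
        refine ⟨fun i => y.hom (Pi.single i 1), funext fun a => ?_⟩
        have h1 := linearCombination_vecMul (D 0) (fun i => y.hom (Pi.single i 1))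
          (Pi.single a 1)
        rw [linearCombination_eq_of_apply_single, hy] at h1
        simpa using h1.symm
      · rintro ⟨y, hy⟩
        refine ⟨Ext.mk₀ (ModuleCat.ofHom (Fintype.linearCombination R y)), ?_⟩
        rw [hinj]
        intro z
        rw [← hy]
        exact linearCombination_vecMul _ _ _
    · obtain ⟨P⟩ := ih (M := ModuleCat.of R (LinearMap.ker aug)) hs
      refine ⟨h.extPresentationSucc P fun N x => ?_⟩
      have := P.eq_zero_iff N x
      refine Iff.trans ?_ this
      constructor
      · rintro ⟨y, hy⟩
        rw [← hy, Ext.eq_zero_of_projective y, Ext.comp_zero]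
      · intro hx
        exact ⟨0, by rw [hx, Ext.comp_zero]⟩

attribute [local instance] linearModuleCat

namespace ExtPresentation

variable {n : ℕ} (P : ExtPresentation D M n) (K : Type*) [CommRing K] [Algebra K R]
  (N : ModuleCat.{u} R) [Module K N] [IsScalarTower K R N]

/-- Scalars act on `Ext` by composition with an endomorphism of N, so naturality in N already
contains linearity. -/
theorem toFun_smul (r : K) (x y : LinearMap.ker (matAct ℤ (D n) N))
    (h : ∀ i, y.1 i = r • x.1 i) : P.toFun N y = r • P.toFun N x := by
  rw [Ext.smul_eq_comp_mk₀]
  refine P.natural _ x y fun i => (h i).trans ?_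
  exact algebra_compatible_smul R r (x.1 i)

/-- The presentation of `Ext^n (M, N)` as a linear map. -/
def linearMap : LinearMap.ker (matAct K (D n) N) →ₗ[K] Ext.{u} M N n where
  toFun x := P.toFun N ⟨x.1, x.2⟩
  map_add' x y := P.toFun N |>.map_add ⟨x.1, x.2⟩ ⟨y.1, y.2⟩
  map_smul' r _ := P.toFun_smul K N r _ _ fun _ => rfl

theorem isCohomology : IsCohomology (fun n => matAct K (D n) N) n (P.linearMap K N) where
  surjective z := by
    obtain ⟨x, rfl⟩ := P.surjective N z
    exact ⟨⟨x.1, x.2⟩, rfl⟩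
  eq_zero_iff x := by
    refine (P.eq_zero_iff N ⟨x.1, x.2⟩).trans ?_
    rcases n with _ | n
    · exact Iff.rfl
    · exact Iff.rfl

end ExtPresentation

end ExtPresentation

/-! ### Complexes whose differentials are changed by a sign. -/

section Signs

variable {R : Type*} [CommRing R] {X : ℕ → Type*} [∀ n, AddCommGroup (X n)] [∀ n, Module R (X n)]

theorem smul_eq_zero_iff_of_mul_self {M : Type*} [AddCommGroup M] [Module R M] {c : R}
    (hc : c * c = 1) (x : M) : c • x = 0 ↔ x = 0 := by
  refine ⟨fun h => ?_, fun h => by rw [h, smul_zero]⟩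
  rw [← one_smul R x, ← hc, mul_smul, h, smul_zero]

theorem boundaries_smul (d : ∀ n, X n →ₗ[R] X (n + 1)) {c : R} (hc : c * c = 1) (n : ℕ) :
    boundaries (fun n => c • d n) n = boundaries d n := by
  rcases n with _ | n
  · rfl
  · ext x
    constructor
    · rintro ⟨y, rfl⟩
      exact ⟨c • y, by simp⟩
    · rintro ⟨y, rfl⟩
      exact ⟨c • y, by simp [smul_smul, hc]⟩

theorem nonempty_cohomology_smul (d : ∀ n, X n →ₗ[R] X (n + 1)) {c : R} (hc : c * c = 1)
    (n : ℕ) : Nonempty (Cohomology (fun n => c • d n) n ≃ₗ[R] Cohomology d n) := by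
  have hk : LinearMap.ker (c • d n) = LinearMap.ker (d n) := by
    ext x
    simp only [LinearMap.mem_ker, LinearMap.smul_apply]
    exact smul_eq_zero_iff_of_mul_self hc _
  refine ⟨Submodule.Quotient.equiv _ _ (LinearEquiv.ofEq _ _ hk) ?_⟩
  ext x
  rw [Submodule.mem_map]
  constructor
  · rintro ⟨y, hy, rfl⟩
    have hy' : (y : X n) ∈ boundaries (fun n => c • d n) n := hy
    rw [boundaries_smul d hc] at hy'
    exact hy'
  · intro hx
    refine ⟨(LinearEquiv.ofEq _ _ hk).symm x, ?_, (LinearEquiv.ofEq _ _ hk).apply_symm_apply x⟩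
    change (x : X n) ∈ boundaries (fun n => c • d n) n
    rw [boundaries_smul d hc]
    exact hx

end Signs

/-! ### The duality theorem for Ext, from the double complex of matrices. -/

section Swap

/-- The complex of row vectors defined by a sequence of matrices. -/
abbrev rowComplex {R : Type*} [Ring R] {ι : ℕ → Type} [∀ n, Fintype (ι n)]
    (F : ∀ n, Matrix (ι n) (ι (n + 1)) R) (n : ℕ) : (ι n → R) →ₗ[R] (ι (n + 1) → R) :=
  (F n).vecMulLinear

/-- The transpose of a matrix, with entries in the opposite ring. -/
def opMat {R ι κ : Type*} (D : Matrix κ ι R) : Matrix ι κ Rᵐᵒᵖ :=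
  Dᵀ.map MulOpposite.op

/-- The transpose of a matrix with entries in the opposite ring. -/
def unopMat {R ι κ : Type*} (D : Matrix κ ι Rᵐᵒᵖ) : Matrix ι κ R :=
  Dᵀ.map MulOpposite.unop

/-- A column of a matrix over R is a row vector over the opposite ring, on which left multiplication
becomes the row-vector map of the transpose. This identifies one direction of the double complex
with copies of a dual complex. -/
theorem op_vecMul_opMat {R ι κ l : Type*} [Ring R] [Fintype ι] (D : Matrix κ ι R)
    (x : Matrix ι l R) (b : l) :
    (fun i => MulOpposite.op (x i b)) ᵥ* opMat D = fun a => MulOpposite.op ((D * x) a b) := by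
  funext a
  simp [Matrix.vecMul, dotProduct, opMat, Matrix.mul_apply, Finset.op_sum]

section Pi

variable {K : Type*} [CommRing K] {R : Type*} [Ring R] [Algebra K R]
  {C : ℕ → Type*} [∀ n, AddCommGroup (C n)] [∀ n, Module R (C n)] [∀ n, Module K (C n)]
  [∀ n, IsScalarTower K R (C n)] {dC : ∀ n, C n →ₗ[R] C (n + 1)} {l : Type*}
  {Z : ℕ → Type*} [∀ n, AddCommGroup (Z n)] [∀ n, Module K (Z n)] {δ : ∀ n, Z n →ₗ[K] Z (n + 1)}
  (e : ∀ n, Z n ≃ₗ[K] (l → C n)) {c : K} (hc : c * c = 1)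
  (he : ∀ n x i, e (n + 1) (δ n x) i = c • dC n (e n x i))

include hc he

-- Through `e`, the complex `Z` is a product of copies of `C` up to the sign c, so kernels,
-- boundaries and cohomology can be computed coordinate by coordinate. The signs are those of the
-- double complex.
omit [Algebra K R] [∀ n, IsScalarTower K R (C n)] in
theorem apply_eq_zero_iff_of_equiv_pi (n : ℕ) (x : Z n) :
    δ n x = 0 ↔ ∀ i, dC n (e n x i) = 0 := by
  rw [← (e (n + 1)).map_eq_zero_iff, funext_iff]
  refine forall_congr' fun i => ?_
  rw [he]
  exact smul_eq_zero_iff_of_mul_self hc _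

theorem mem_boundaries_iff_of_equiv_pi (n : ℕ) (x : Z n) :
    x ∈ boundaries δ n ↔ ∀ i, e n x i ∈ boundaries dC n := by
  rcases n with _ | n
  · simp only [boundaries, Submodule.mem_bot]
    rw [← (e 0).map_eq_zero_iff, funext_iff]
    rfl
  · constructor
    · rintro ⟨y, rfl⟩ i
      refine ⟨c • e n y i, ?_⟩
      rw [he, LinearMap.map_smul_of_tower]
    · intro h
      choose y hy using h
      refine ⟨(e n).symm (fun i => c • y i), (e (n + 1)).injective (funext fun i => ?_)⟩
      rw [he, LinearEquiv.apply_symm_apply, LinearMap.map_smul_of_tower, smul_smul, hc, one_smul, hy]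

/-- The cohomology of a complex which is a product of copies of another complex. -/
def piCohomologyMap {d : ℕ} {H : Type*} [AddCommGroup H] [Module R H] [Module K H]
    [IsScalarTower K R H] (π : LinearMap.ker (dC d) →ₗ[R] H) :
    LinearMap.ker (δ d) →ₗ[K] (l → H) where
  toFun x i := π ⟨e d x i, (apply_eq_zero_iff_of_equiv_pi e hc he d x).1 x.2 i⟩
  map_add' x y := by
    funext i
    rw [Pi.add_apply, ← map_add]
    congr 2
    simp
  map_smul' r x := by
    funext i
    simp only [Pi.smul_apply, RingHom.id_apply]
    rw [algebra_compatible_smul R r (π _), ← map_smul]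
    congr 2
    simp

theorem isCohomology_piCohomologyMap {d : ℕ} {H : Type*} [AddCommGroup H] [Module R H]
    [Module K H] [IsScalarTower K R H] {π : LinearMap.ker (dC d) →ₗ[R] H}
    (hπ : IsCohomology dC d π) : IsCohomology δ d (piCohomologyMap e hc he π) where
  surjective z := by
    choose y hy using fun i => hπ.surjective (z i)
    refine ⟨⟨(e d).symm (fun i => (y i).1), ?_⟩, funext fun i => ?_⟩
    · rw [LinearMap.mem_ker, apply_eq_zero_iff_of_equiv_pi e hc he]
      intro i
      rw [LinearEquiv.apply_symm_apply]
      exact (y i).2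
    · rw [← hy]
      change π _ = _
      congr 2
      exact congrFun ((e d).apply_symm_apply _) i
  eq_zero_iff x := by
    rw [mem_boundaries_iff_of_equiv_pi e hc he, funext_iff]
    exact forall_congr' fun i => hπ.eq_zero_iff _

end Pi

open Abelian

attribute [local instance] linearModuleCat

variable {K : Type*} [CommRing K] {A : Type u} [Ring A] [Algebra K A]
  {ι κ : ℕ → Type} [∀ n, Fintype (ι n)] [∀ n, Fintype (κ n)]
  {D : ∀ n, Matrix (ι (n + 1)) (ι n) A} {E : ∀ n, Matrix (κ (n + 1)) (κ n) Aᵐᵒᵖ}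

/-- If `D` and `E` are resolutions of a left module `M` and of a right module `U`, whose duals are
concentrated in one degree, with cohomology `T` and `N`, then `Ext (M, N)` and `Ext (U, T)` agree
up to a shift: both are the cohomology of a double complex of matrices. -/
theorem ext_duality {M N : ModuleCat.{u} A} {U T : ModuleCat.{u} Aᵐᵒᵖ}
    {augM : (ι 0 → A) →ₗ[A] M} {augU : (κ 0 → Aᵐᵒᵖ) →ₗ[Aᵐᵒᵖ] U}
    (hM : IsMatRes D augM) (hU : IsMatRes E augU) {d e : ℕ}
    (hT : Concentrated (rowComplex fun n => opMat (D n)) d T)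
    (hN : Concentrated (rowComplex fun n => unopMat (E n)) e N) :
    (∀ a b, a + e = b + d → Nonempty (Ext.{u} M N a ≃ₗ[K] Ext.{u} U T b)) ∧
      (∀ b, b + d < e → Subsingleton (Ext.{u} U T b)) ∧
      (∀ a, a + e < d → Subsingleton (Ext.{u} M N a)) := by
  let := Module.restrictScalars K A N
  have := IsScalarTower.restrictScalars K A N
  let := Module.restrictScalars K Aᵐᵒᵖ T
  have := IsScalarTower.restrictScalars K Aᵐᵒᵖ T
  obtain ⟨πN, hπN⟩ := hN.exists_cohomology
  obtain ⟨πT, hπT⟩ := hT.exists_cohomology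
  let dh (p q : ℕ) : Matrix (ι p) (κ q) A →ₗ[K] Matrix (ι (p + 1)) (κ q) A :=
    { toFun := fun x => D p * x
      map_add' := fun x y => Matrix.mul_add _ _ _
      map_smul' := fun r x => Matrix.mul_smul _ _ _ }
  -- Left and right multiplication commute; the sign makes the two differentials anticommute.
  let dv (p q : ℕ) : Matrix (ι p) (κ q) A →ₗ[K] Matrix (ι p) (κ (q + 1)) A :=
    (-1 : K) ^ p •
      { toFun := fun x => x * unopMat (E q)
        map_add' := fun x y => Matrix.add_mul _ _ _
        map_smul' := fun r x => Matrix.smul_mul _ _ _ }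
  have dh_apply : ∀ p q x, dh p q x = D p * x := fun _ _ _ => rfl
  have dv_apply : ∀ p q x, dv p q x = (-1 : K) ^ p • (x * unopMat (E q)) := fun _ _ _ => rfl
  have hsign : ∀ p : ℕ, (-1 : K) ^ p * (-1 : K) ^ p = 1 := fun p => by
    rw [← mul_pow]; simp
  -- rows and columns as products
  let er (p q : ℕ) : Matrix (ι p) (κ q) A ≃ₗ[K] (ι p → κ q → A) := LinearEquiv.refl K _
  have her : ∀ p q x i, er p (q + 1) (dv p q x) i =
      (-1 : K) ^ p • rowComplex (fun n => unopMat (E n)) q (er p q x i) := fun _ _ _ _ => rfl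
  let ec (q p : ℕ) : Matrix (ι p) (κ q) A ≃ₗ[K] (κ q → ι p → Aᵐᵒᵖ) :=
    { toFun := fun x b i => MulOpposite.op (x i b)
      invFun := fun y => Matrix.of fun i b => MulOpposite.unop (y b i)
      map_add' := fun _ _ => rfl
      map_smul' := fun _ _ => rfl }
  have hec : ∀ q p x b, ec q (p + 1) (dh p q x) b =
      (1 : K) • rowComplex (fun n => opMat (D n)) p (ec q p x b) := by
    intro q p x b
    rw [one_smul]
    exact (op_vecMul_opMat (D p) x b).symm
  have hDD : ∀ p q (x : Matrix (ι p) (κ q) A), D (p + 1) * (D p * x) = 0 := by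
    intro p q x
    have hz : ∀ z : Matrix (ι p) (κ q) A, dh (p + 1) q (dh p q z) = 0 := fun z => by
      refine (apply_eq_zero_iff_of_equiv_pi (ec q) (mul_one (1 : K)) (hec q) (p + 1) _).2
        fun b => ?_
      rw [hec, one_smul]
      exact hT.comp_eq_zero p _
    exact hz x
  have hEE : ∀ p q (x : Matrix (ι p) (κ q) A), x * unopMat (E q) * unopMat (E (q + 1)) = 0 := by
    intro p q x
    funext i
    exact hN.comp_eq_zero q (x i)
  have hhh : ∀ p q x, dh (p + 1) q (dh p q x) = 0 := hDD
  have hvv : ∀ p q x, dv p (q + 1) (dv p q x) = 0 := by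
    intro p q x
    simp only [dv_apply, Matrix.smul_mul, hEE, smul_zero]
  have hhv : ∀ p q x, dv (p + 1) q (dh p q x) + dh p (q + 1) (dv p q x) = 0 := by
    intro p q x
    simp only [dv_apply, dh_apply, Matrix.mul_smul, Matrix.mul_assoc, pow_succ, mul_neg_one,
      neg_smul, neg_add_cancel]
  have hexv : ∀ p q, q ≠ e → ∀ x, dv p q x = 0 → x ∈ boundaries (dv p) q := by
    intro p q hq x hx
    rw [mem_boundaries_iff_of_equiv_pi (er p) (hsign p) (her p)]
    rw [apply_eq_zero_iff_of_equiv_pi (er p) (hsign p) (her p)] at hx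
    exact fun i => hN.exact q hq _ (hx i)
  have hexh : ∀ q p, p ≠ d → ∀ x, dh p q x = 0 → x ∈ boundaries (fun p => dh p q) p := by
    intro q p hp x hx
    rw [mem_boundaries_iff_of_equiv_pi (ec q) (mul_one (1 : K)) (hec q)]
    rw [apply_eq_zero_iff_of_equiv_pi (δ := fun p => dh p q) (ec q) (mul_one (1 : K))
      (hec q)] at hx
    exact fun i => hT.exact p hp _ (hx i)
  -- For fixed p the vertical complex consists of copies of the dual of the resolution of U, one for
  -- each row of the matrix; its cohomology is a power of N in degree e.
  have key1 : ∀ m a, a + e = m → Nonempty (TotalCohomology dh dv m ≃ₗ[K]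
      Cohomology (fun n => matAct K (D n) N) a) := by
    intro m a hm
    refine nonempty_totalCohomology_equiv hhh hvv hhv hexv
      (fun p => piCohomologyMap (er p) (hsign p) (her p) πN)
      (fun p => isCohomology_piCohomologyMap (er p) (hsign p) (her p) hπN) ?_ hm
    intro p x x' hx
    funext i
    have h1 : ∀ j, rowComplex (fun n => unopMat (E n)) e (x.1 j) = 0 :=
      (apply_eq_zero_iff_of_equiv_pi (er p) (hsign p) (her p) e _).1 x.2
    change πN ⟨x'.1 i, _⟩ = ∑ j, D p i j • πN ⟨x.1 j, h1 j⟩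
    simp only [← map_smul, ← map_sum]
    congr 1
    refine Subtype.ext ?_
    change x'.1 i = _
    rw [hx, dh_apply]
    funext b
    simp [Matrix.mul_apply]
  -- For fixed q the horizontal complex consists of copies of the dual of the resolution of M, one
  -- for each column; its cohomology is a power of T in degree d.
  have key2 : ∀ m b, b + d = m → Nonempty (TotalCohomology dh dv m ≃ₗ[K]
      Cohomology (fun n => matAct K (E n) T) b) := by
    intro m b hm
    obtain ⟨f⟩ := nonempty_totalCohomology_flip (dh := dh) (dv := dv) m
    obtain ⟨g⟩ := nonempty_totalCohomology_equiv (X := fun q p => Matrix (ι p) (κ q) A)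
      (dh := fun q p => dv p q) (dv := fun q p => dh p q) (fun q p x => hvv p q x)
      (fun q p x => hhh p q x) (fun q p x => (add_comm _ _).trans (hhv p q x)) hexh
      -- The surviving entries all have p = d, so the induced differential carries the fixed sign of
      -- that index; it is removed at the end.
      (dY := fun n => (-1 : K) ^ d • matAct K (E n) T)
      (fun q => piCohomologyMap (ec q) (mul_one (1 : K)) (hec q) πT)
      (fun q => isCohomology_piCohomologyMap (ec q) (mul_one (1 : K)) (hec q) hπT) (by
        intro q x x' hx
        funext a
        have h1 : ∀ b, rowComplex (fun n => opMat (D n)) d (ec q d x.1 b) = 0 :=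
          (apply_eq_zero_iff_of_equiv_pi (δ := fun p => dh p q) (ec q) (mul_one (1 : K))
            (hec q) d _).1 x.2
        change πT ⟨ec (q + 1) d x'.1 a, _⟩ =
          (-1 : K) ^ d • ∑ b, E q a b • πT ⟨ec q d x.1 b, h1 b⟩
        rw [algebra_compatible_smul Aᵐᵒᵖ ((-1 : K) ^ d)]
        simp only [← map_smul, ← map_sum]
        congr 1
        refine Subtype.ext ?_
        change ec (q + 1) d x'.1 a = _
        rw [hx, dv_apply, Submodule.coe_smul, Submodule.coe_sum]
        funext i
        change MulOpposite.op ((-1 : K) ^ d • (x.1 * unopMat (E q)) i a) =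
          (algebraMap K Aᵐᵒᵖ ((-1 : K) ^ d) • ∑ b, E q a b • ec q d x.1 b :
            ι d → Aᵐᵒᵖ) i
        rw [algebraMap_smul, MulOpposite.op_smul]
        refine congrArg (fun z => (-1 : K) ^ d • z) ?_
        rw [Finset.sum_apply, Matrix.mul_apply, Finset.op_sum]
        rfl) hm
    obtain ⟨h⟩ := nonempty_cohomology_smul (fun n => matAct K (E n) T) (hsign d) b
    exact ⟨(f.symm.trans g).trans h⟩
  -- These vanishing statements cover the degrees in which the shift makes the other Ext degree
  -- negative.
  have key1' : ∀ m, m < e → Subsingleton (TotalCohomology dh dv m) := fun m hm =>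
    subsingleton_totalCohomology hhh hvv hhv hexv hm
  have key2' : ∀ m, m < d → Subsingleton (TotalCohomology dh dv m) := by
    intro m hm
    obtain ⟨f⟩ := nonempty_totalCohomology_flip (dh := dh) (dv := dv) m
    have := subsingleton_totalCohomology (X := fun q p => Matrix (ι p) (κ q) A)
      (dh := fun q p => dv p q) (dv := fun q p => dh p q) (fun q p x => hvv p q x)
      (fun q p x => hhh p q x) (fun q p x => (add_comm _ _).trans (hhv p q x)) hexh hm
    exact f.symm.toEquiv.subsingleton
  have ext1 : ∀ a, Nonempty (Cohomology (fun n => matAct K (D n) N) a ≃ₗ[K] Ext.{u} M N a) := by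
    intro a
    obtain ⟨P⟩ := hM.nonempty_extPresentation a
    exact ⟨(P.isCohomology K N).equiv⟩
  have ext2 : ∀ b, Nonempty (Cohomology (fun n => matAct K (E n) T) b ≃ₗ[K] Ext.{u} U T b) := by
    intro b
    obtain ⟨P⟩ := hU.nonempty_extPresentation b
    exact ⟨(P.isCohomology K T).equiv⟩
  refine ⟨fun a b hab => ?_, fun b hb => ?_, fun a ha => ?_⟩
  · obtain ⟨f1⟩ := key1 _ a rfl
    obtain ⟨f2⟩ := key2 _ b hab.symm
    obtain ⟨g1⟩ := ext1 a
    obtain ⟨g2⟩ := ext2 b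
    exact ⟨((g1.symm.trans f1.symm).trans f2).trans g2⟩
  · obtain ⟨f2⟩ := key2 _ b rfl
    obtain ⟨g2⟩ := ext2 b
    have := key1' _ hb
    exact (f2.trans g2).symm.toEquiv.subsingleton
  · obtain ⟨f1⟩ := key1 _ a rfl
    obtain ⟨g1⟩ := ext1 a
    have := key2' _ ha
    exact (f1.trans g1).symm.toEquiv.subsingleton

end Swap

/-! ### Induction along a flat homomorphism. -/

section Flat

variable {R S : Type u} [Ring R] [Ring S] (φ : R →+* S)

section Semilinear

variable {R' S' : Type u} [Ring R'] [Ring S'] (φ' : R' →+* S') (a : R →+* R') (b : S →+* S')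
  (hab : ∀ r, b (φ r) = φ' (a r)) {M M' : Type u} [AddCommGroup M] [Module R M] [AddCommGroup M']
  [Module R' M'] (f : M →+ M') (hf : ∀ r m, f (r • m) = a r • f m)

/-- Functoriality of induced modules in the rings and the module. -/
def inducedSemilinearMap : (S ⊗[ℤ] M ⧸ balanced φ M) →ₛₗ[b] (S' ⊗[ℤ] M' ⧸ balanced φ' M') :=
  Submodule.mapQ _ _
    { toFun := TensorProduct.map b.toAddMonoidHom.toIntLinearMap f.toIntLinearMap
      map_add' := map_add _
      map_smul' := by
        intro s x
        induction x using TensorProduct.induction_on with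
        | zero => simp
        | tmul t m =>
          rw [TensorProduct.smul_tmul', TensorProduct.map_tmul, TensorProduct.map_tmul,
            TensorProduct.smul_tmul']
          simp
        | add x y hx hy => rw [smul_add, map_add, hx, hy, map_add, smul_add] } (by
    rw [balanced, Submodule.span_le]
    rintro _ ⟨s, r, m, rfl⟩
    refine Submodule.subset_span ⟨b s, a r, f m, ?_⟩
    change TensorProduct.map _ _ _ = _
    rw [map_sub, TensorProduct.map_tmul, TensorProduct.map_tmul]
    simp [hab, hf])

end Semilinear

@[elab_as_elim]
theorem induced_induction {M : Type u} [AddCommGroup M] [Module R M]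
    {P : (S ⊗[ℤ] M ⧸ balanced φ M) → Prop} (z : S ⊗[ℤ] M ⧸ balanced φ M) (h0 : P 0)
    (ht : ∀ s m, P (Submodule.Quotient.mk (s ⊗ₜ[ℤ] m)))
    (ha : ∀ x y, P x → P y → P (x + y)) : P z := by
  obtain ⟨x, rfl⟩ := Submodule.Quotient.mk_surjective _ z
  induction x using TensorProduct.induction_on with
  | zero => exact h0
  | tmul s m => exact ht s m
  | add x y hx hy => exact ha _ _ hx hy

/-- Modules over `R'` are restricted along `a`; the semilinear map `T` then embeds the module
induced along `φ'` into the one induced along `φ`, compatibly with induced maps, so injectivity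
passes over. -/
theorem IsRightFlat.of_ringEquiv {R' S' : Type u} [Ring R'] [Ring S'] {φ : R →+* S}
    (h : IsRightFlat φ) (φ' : R' →+* S') (a : R ≃+* R') (b : S ≃+* S')
    (hab : ∀ r, b (φ r) = φ' (a r)) : IsRightFlat φ' := by
  intro M N _ _ _ _ f hf
  let := Module.compHom M (a : R →+* R')
  let := Module.compHom N (a : R →+* R')
  have hab' : ∀ r, (b.symm : S' →+* S) (φ' r) = φ ((a.symm : R' →+* R) r) := fun r => by
    simp only [RingEquiv.coe_toRingHom]
    rw [RingEquiv.symm_apply_eq, hab, RingEquiv.apply_symm_apply]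
  let fR : M →ₗ[R] N :=
    { toFun := f
      map_add' := map_add f
      map_smul' := fun r m => map_smul f (a r) m }
  have hs : ∀ (L : Type u) [AddCommGroup L] [Module R' L], ∀ (r : R') (m : L),
      letI := Module.compHom L (a : R →+* R')
      AddMonoidHom.id L (r • m) = (a.symm : R' →+* R) r • AddMonoidHom.id L m := by
    intro L _ _ r m
    change r • m = a (a.symm r) • m
    rw [RingEquiv.apply_symm_apply]
  let T := inducedSemilinearMap φ' φ (a.symm : R' →+* R) (b.symm : S' →+* S) hab'
    (AddMonoidHom.id M) (hs M)
  let T' := inducedSemilinearMap φ φ' (a : R →+* R') (b : S →+* S') hab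
    (AddMonoidHom.id M) (fun _ _ => rfl)
  let U := inducedSemilinearMap φ' φ (a.symm : R' →+* R) (b.symm : S' →+* S) hab'
    (AddMonoidHom.id N) (hs N)
  have hT : ∀ z, T' (T z) = z := by
    intro z
    induction z using induced_induction with
    | h0 => rw [map_zero, map_zero]
    | ht s m =>
      change Submodule.Quotient.mk (b (b.symm s) ⊗ₜ[ℤ] m) = _
      rw [RingEquiv.apply_symm_apply]
    | ha x y hx hy => rw [map_add, map_add, hx, hy]
  have hU : ∀ z, U (inducedMap φ' f z) = inducedMap φ fR (T z) := by
    intro z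
    induction z using induced_induction with
    | h0 => simp only [map_zero]
    | ht s m => rfl
    | ha x y hx hy => simp only [map_add, hx, hy]
  rw [injective_iff_map_eq_zero]
  intro z hz
  have h1 := hU z
  rw [hz, map_zero] at h1
  have h2 := h M N fR hf (h1.symm.trans (map_zero _).symm)
  rw [← hT z, h2, map_zero]

section Exact

variable {M₁ M₂ M₃ : Type u} [AddCommGroup M₁] [Module R M₁] [AddCommGroup M₂] [Module R M₂]
  [AddCommGroup M₃] [Module R M₃]

theorem inducedMap_mk_tmul (f : M₁ →ₗ[R] M₂) (s : S) (m : M₁) :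
    inducedMap φ f (Submodule.Quotient.mk (s ⊗ₜ[ℤ] m)) =
      Submodule.Quotient.mk (s ⊗ₜ[ℤ] f m) := rfl

theorem inducedMap_comp (f : M₁ →ₗ[R] M₂) (g : M₂ →ₗ[R] M₃)
    (z : S ⊗[ℤ] M₁ ⧸ balanced φ M₁) :
    inducedMap φ (g.comp f) z = inducedMap φ g (inducedMap φ f z) := by
  induction z using induced_induction with
  | h0 => simp only [map_zero]
  | ht s m => rfl
  | ha x y hx hy => simp only [map_add, hx, hy]

theorem inducedMap_surjective {f : M₁ →ₗ[R] M₂} (hf : Function.Surjective f) :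
    Function.Surjective (inducedMap φ f) := by
  intro z
  induction z using induced_induction with
  | h0 => exact ⟨0, map_zero _⟩
  | ht s m =>
    obtain ⟨m, rfl⟩ := hf m
    exact ⟨_, inducedMap_mk_tmul φ f s m⟩
  | ha x y hx hy =>
    obtain ⟨x, rfl⟩ := hx
    obtain ⟨y, rfl⟩ := hy
    exact ⟨x + y, map_add _ _ _⟩

/-- Induction is right exact. -/
theorem inducedMap_eq_zero_iff_of_surjective {f : M₁ →ₗ[R] M₂} {g : M₂ →ₗ[R] M₃}
    (hfg : ∀ x, g x = 0 ↔ ∃ y, f y = x) (hg : Function.Surjective g)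
    (z : S ⊗[ℤ] M₂ ⧸ balanced φ M₂) : inducedMap φ g z = 0 ↔ ∃ y, inducedMap φ f y = z := by
  constructor
  · intro hz
    obtain ⟨z, rfl⟩ := Submodule.Quotient.mk_surjective _ z
    have hz' : TensorProduct.AlgebraTensorModule.map (LinearMap.id : S →ₗ[S] S)
        g.toAddMonoidHom.toIntLinearMap z ∈ balanced φ M₃ :=
      (Submodule.Quotient.mk_eq_zero _).1 hz
    -- Since g is onto, every balancing relation over M₃ lifts to one over M₂. This reduces right
    -- exactness to that of the tensor product over ℤ.
    have hle : balanced φ M₃ ≤ (balanced φ M₂).map (TensorProduct.AlgebraTensorModule.map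
        (LinearMap.id : S →ₗ[S] S) g.toAddMonoidHom.toIntLinearMap) := by
      rw [balanced, Submodule.span_le]
      rintro _ ⟨s, r, m, rfl⟩
      obtain ⟨m, rfl⟩ := hg m
      refine ⟨_, Submodule.subset_span ⟨s, r, m, rfl⟩, ?_⟩
      simp
    obtain ⟨w, hw, hwz⟩ := hle hz'
    have hex : Function.Exact f.toAddMonoidHom.toIntLinearMap g.toAddMonoidHom.toIntLinearMap :=
      fun x => hfg x
    obtain ⟨y, hy⟩ := (lTensor_exact S hex hg (z - w)).1 (by
      rw [map_sub, sub_eq_zero]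
      exact hwz.symm)
    refine ⟨Submodule.Quotient.mk y, ?_⟩
    refine (Submodule.Quotient.eq _).2 ?_
    have hy' : TensorProduct.AlgebraTensorModule.map (LinearMap.id : S →ₗ[S] S)
        f.toAddMonoidHom.toIntLinearMap y = z - w := hy
    rw [hy']
    simpa using hw
  · rintro ⟨y, rfl⟩
    rw [← inducedMap_comp]
    have h0 : g.comp f = 0 := LinearMap.ext fun x => (hfg _).2 ⟨x, rfl⟩
    rw [h0]
    induction y using induced_induction with
    | h0 => simp only [map_zero]
    | ht s m =>
      rw [inducedMap_mk_tmul, LinearMap.zero_apply, TensorProduct.tmul_zero]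
      rfl
    | ha x y hx hy => rw [map_add, hx, hy, add_zero]

variable {φ} (hφ : IsRightFlat φ)

include hφ

/-- Flat induction preserves kernels. -/
theorem inducedMap_eq_zero_iff (g : M₂ →ₗ[R] M₃) (z : S ⊗[ℤ] M₂ ⧸ balanced φ M₂) :
    inducedMap φ g z = 0 ↔ ∃ y, inducedMap φ (LinearMap.ker g).subtype y = z := by
  rw [← inducedMap_eq_zero_iff_of_surjective φ (g := g.rangeRestrict)
    (fun x => by
      rw [Subtype.ext_iff]
      exact ⟨fun hx => ⟨⟨x, hx⟩, rfl⟩, fun ⟨y, hy⟩ => hy ▸ y.2⟩) g.surjective_rangeRestrict]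
  have hg : g = (LinearMap.range g).subtype.comp g.rangeRestrict := rfl
  conv_lhs => rw [hg, inducedMap_comp]
  exact map_eq_zero_iff _ (hφ _ _ _ Subtype.val_injective)

/-- Flat induction preserves cohomology. -/
theorem exists_induced_cohomology {N : Type u} [AddCommGroup N] [Module R N] (f : M₁ →ₗ[R] M₂)
    (g : M₂ →ₗ[R] M₃) (hfg : ∀ x, g (f x) = 0) (π : LinearMap.ker g →ₗ[R] N)
    (hπ : Function.Surjective π) (hπf : ∀ x, π x = 0 ↔ ∃ y, f y = x) :
    ∃ π' : LinearMap.ker (inducedMap φ g) →ₗ[S] (S ⊗[ℤ] N ⧸ balanced φ N),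
      Function.Surjective π' ∧ ∀ x, π' x = 0 ↔ ∃ y, inducedMap φ f y = x := by
  have hinj := hφ _ _ (LinearMap.ker g).subtype Subtype.val_injective
  let e : (S ⊗[ℤ] LinearMap.ker g ⧸ balanced φ (LinearMap.ker g)) ≃ₗ[S]
      LinearMap.ker (inducedMap φ g) := (LinearEquiv.ofInjective _ hinj).trans
    (LinearEquiv.ofEq _ _ (by
      ext z
      rw [LinearMap.mem_ker, inducedMap_eq_zero_iff hφ]
      rfl))
  have he : ∀ w, (e w : S ⊗[ℤ] M₂ ⧸ balanced φ M₂) = inducedMap φ (LinearMap.ker g).subtype w :=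
    fun w => rfl
  refine ⟨(inducedMap φ π).comp e.symm.toLinearMap,
    (inducedMap_surjective φ hπ).comp e.symm.surjective, fun x => ?_⟩
  obtain ⟨w, rfl⟩ := e.surjective x
  let f' : M₁ →ₗ[R] LinearMap.ker g := f.codRestrict _ hfg
  have hf' : f = (LinearMap.ker g).subtype.comp f' := rfl
  have h1 : ((inducedMap φ π).comp e.symm.toLinearMap) (e w) = inducedMap φ π w := by
    simp
  rw [h1, inducedMap_eq_zero_iff_of_surjective φ (f := f')
    (fun x => by rw [hπf]; simp only [f', Subtype.ext_iff]; rfl) hπ, he]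
  refine exists_congr fun y => ?_
  conv_rhs => rw [hf', inducedMap_comp]
  exact hinj.eq_iff.symm

theorem inducedMap_exact {f : M₁ →ₗ[R] M₂} {g : M₂ →ₗ[R] M₃}
    (hfg : ∀ x, g x = 0 ↔ ∃ y, f y = x) (z : S ⊗[ℤ] M₂ ⧸ balanced φ M₂) :
    inducedMap φ g z = 0 ↔ ∃ y, inducedMap φ f y = z := by
  let f' : M₁ →ₗ[R] LinearMap.ker g := f.codRestrict _ fun x => (hfg _).2 ⟨x, rfl⟩
  have hf' : f = (LinearMap.ker g).subtype.comp f' := rfl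
  have hs : Function.Surjective f' := by
    rintro ⟨x, hx⟩
    obtain ⟨y, rfl⟩ := (hfg x).1 hx
    exact ⟨y, rfl⟩
  rw [inducedMap_eq_zero_iff hφ, hf']
  simp only [inducedMap_comp]
  constructor
  · rintro ⟨y, rfl⟩
    obtain ⟨y, rfl⟩ := inducedMap_surjective φ hs y
    exact ⟨y, rfl⟩
  · rintro ⟨y, rfl⟩
    exact ⟨_, rfl⟩

end Exact

section Free

/-- The module induced from a finite free module is free. -/
def inducedPi (ι : Type) [Fintype ι] [DecidableEq ι] :
    (S ⊗[ℤ] (ι → R) ⧸ balanced φ (ι → R)) ≃ₗ[S] (ι → S) :=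
  LinearEquiv.ofLinearMap
    (Submodule.liftQ _ (TensorProduct.AlgebraTensorModule.lift
      { toFun := fun s =>
          { toFun := fun x i => s * φ (x i)
            map_add' := fun x y => by
              funext i
              simp [mul_add]
            map_smul' := fun n x => by
              funext i
              simp only [Pi.smul_apply, map_zsmul, mul_smul_comm, eq_intCast, Int.cast_id] }
        map_add' := fun s t => by
          ext x i
          simp [add_mul]
        map_smul' := fun s t => by
          ext x i
          simp [mul_assoc] }) (by
      rw [balanced, Submodule.span_le]
      rintro _ ⟨s, r, m, rfl⟩
      rw [SetLike.mem_coe, LinearMap.mem_ker, map_sub, sub_eq_zero]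
      funext i
      simp [mul_assoc]))
    { toFun := fun y => ∑ i, Submodule.Quotient.mk (y i ⊗ₜ[ℤ] (Pi.single i 1 : ι → R))
      map_add' := fun x y => by
        simp [TensorProduct.add_tmul, Finset.sum_add_distrib]
      map_smul' := fun s y => by
        simp only [Finset.smul_sum, RingHom.id_apply]
        rfl }
    (by
      refine LinearMap.pi_ext fun j s => ?_
      funext i
      simp only [LinearMap.comp_apply, LinearMap.coe_mk, AddHom.coe_mk, map_sum,
        LinearMap.id_apply, Finset.sum_apply]
      change ∑ k, (Pi.single j s : ι → S) k * φ ((Pi.single k 1 : ι → R) i) = _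
      simp only [Pi.single_apply, apply_ite φ, map_one, map_zero]
      simp)
    (by
      refine LinearMap.ext fun z => ?_
      induction z using induced_induction with
      | h0 => simp only [map_zero]
      | ht s m =>
        change ∑ i, Submodule.Quotient.mk ((s * φ (m i)) ⊗ₜ[ℤ] (Pi.single i 1 : ι → R)) =
          Submodule.Quotient.mk (s ⊗ₜ[ℤ] m)
        have h1 : ∀ i, (Submodule.Quotient.mk ((s * φ (m i)) ⊗ₜ[ℤ] (Pi.single i 1 : ι → R)) :
            S ⊗[ℤ] (ι → R) ⧸ balanced φ (ι → R)) =
            Submodule.Quotient.mk (s ⊗ₜ[ℤ] (Pi.single i (m i) : ι → R)) := by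
          intro i
          refine (Submodule.Quotient.eq _).2 (Submodule.subset_span
            ⟨s, m i, Pi.single i 1, ?_⟩)
          congr 2
          rw [← Pi.single_smul]
          simp
        simp only [h1]
        rw [← Submodule.mkQ_apply, ← Finset.univ_sum_single m, TensorProduct.tmul_sum, map_sum]
        simp
      | ha x y hx hy => simp only [map_add, hx, hy])

theorem inducedPi_mk_tmul (ι : Type) [Fintype ι] [DecidableEq ι] (s : S) (x : ι → R) :
    inducedPi φ ι (Submodule.Quotient.mk (s ⊗ₜ[ℤ] x)) = fun i => s * φ (x i) := rfl

theorem inducedPi_inducedMap {ι κ : Type} [Fintype ι] [DecidableEq ι] [Fintype κ]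
    [DecidableEq κ] (D : Matrix κ ι R) (z : S ⊗[ℤ] (κ → R) ⧸ balanced φ (κ → R)) :
    inducedPi φ ι (inducedMap φ D.vecMulLinear z) = inducedPi φ κ z ᵥ* D.map φ := by
  induction z using induced_induction with
  | h0 => simp only [map_zero, Matrix.zero_vecMul]
  | ht s m =>
    rw [inducedMap_mk_tmul, inducedPi_mk_tmul, inducedPi_mk_tmul]
    funext i
    simp [Matrix.vecMul, dotProduct, Finset.mul_sum, mul_assoc]
  | ha x y hx hy => simp only [map_add, hx, hy, Matrix.add_vecMul]

variable {φ} (hφ : IsRightFlat φ) {ι : ℕ → Type} [∀ n, Fintype (ι n)]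

include hφ

/-- Induction takes finite free modules to finite free modules of the same rank and acts on matrices
by applying `φ` to the entries; flatness preserves exactness. -/
theorem IsMatRes.induced {D : ∀ n, Matrix (ι (n + 1)) (ι n) R} {M : ModuleCat.{u} R}
    {aug : (ι 0 → R) →ₗ[R] M} (h : IsMatRes D aug) :
    ∃ aug' : (ι 0 → S) →ₗ[S] HopfDuality.induced φ M, IsMatRes (fun n => (D n).map φ) aug' := by
  classical
  refine ⟨(inducedMap φ aug).comp (inducedPi φ (ι 0)).symm.toLinearMap, ?_, ?_, ?_⟩
  · exact (inducedMap_surjective φ h.surjective).comp (inducedPi φ (ι 0)).symm.surjective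
  · intro x
    obtain ⟨z, rfl⟩ := (inducedPi φ (ι 0)).surjective x
    have h1 : (inducedMap φ aug).comp (inducedPi φ (ι 0)).symm.toLinearMap
        (inducedPi φ (ι 0) z) = inducedMap φ aug z := by simp
    refine (Eq.congr_left h1).trans ((inducedMap_eq_zero_iff_of_surjective φ
      (f := (D 0).vecMulLinear) h.exact_zero h.surjective z).trans ?_)
    rw [(inducedPi φ (ι 1)).surjective.exists]
    refine exists_congr fun y => ?_
    rw [← inducedPi_inducedMap, (inducedPi φ (ι 0)).injective.eq_iff]
  · intro n x
    obtain ⟨z, rfl⟩ := (inducedPi φ (ι (n + 1))).surjective x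
    rw [← inducedPi_inducedMap, LinearEquiv.map_eq_zero_iff,
      inducedMap_exact hφ (f := (D (n + 1)).vecMulLinear) (h.exact_succ n),
      (inducedPi φ (ι (n + 2))).surjective.exists]
    refine exists_congr fun y => ?_
    rw [← inducedPi_inducedMap, (inducedPi φ (ι (n + 1))).injective.eq_iff]

/-- Flat induction commutes with cohomology. Applied to the dual complexes, it identifies the
cohomology of the dual of an induced resolution. -/
theorem Concentrated.induced {F : ∀ n, Matrix (ι n) (ι (n + 1)) R} {N : ModuleCat.{u} R}
    {e : ℕ} (h : Concentrated (rowComplex F) e N) :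
    Concentrated (rowComplex fun n => (F n).map φ) e (HopfDuality.induced φ N) := by
  classical
  have hcomp : ∀ n x, rowComplex F (n + 1) (rowComplex F n x) = 0 := h.comp_eq_zero
  -- the boundaries are the range of a map which is compatible with induction
  have hb : ∀ n, ∃ (M₁ : Type u) (_ : AddCommGroup M₁) (_ : Module R M₁)
      (f : M₁ →ₗ[R] (ι n → R)), (∀ x, x ∈ boundaries (rowComplex F) n ↔ ∃ y, f y = x) ∧
      (∀ y, rowComplex F n (f y) = 0) ∧ ∀ z, inducedPi φ (ι n) z ∈
        boundaries (rowComplex fun n => (F n).map φ) n ↔ ∃ y, inducedMap φ f y = z := by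
    intro n
    rcases n with _ | n
    · refine ⟨PUnit, inferInstance, inferInstance, 0, fun x => ?_, fun y => map_zero _,
        fun z => ?_⟩
      · simp [boundaries, eq_comm]
      · simp only [boundaries, Submodule.mem_bot, LinearEquiv.map_eq_zero_iff]
        have h0 : ∀ y, inducedMap φ (0 : PUnit.{u + 1} →ₗ[R] (ι 0 → R)) y = 0 := by
          intro y
          induction y using induced_induction with
          | h0 => simp only [map_zero]
          | ht s m =>
            rw [inducedMap_mk_tmul, LinearMap.zero_apply, TensorProduct.tmul_zero]
            rfl
          | ha x y hx hy => rw [map_add, hx, hy, add_zero]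
        exact ⟨fun hz => ⟨0, (h0 0).trans hz.symm⟩, fun ⟨y, hy⟩ => hy ▸ h0 y⟩
    · refine ⟨ι n → R, inferInstance, inferInstance, rowComplex F n, fun x => Iff.rfl,
        hcomp n, fun z => ?_⟩
      change (∃ y, _ = _) ↔ _
      rw [(inducedPi φ (ι n)).surjective.exists]
      refine exists_congr fun y => ?_
      rw [← (inducedPi φ (ι (n + 1))).injective.eq_iff]
      exact Eq.congr_left (inducedPi_inducedMap φ (F n) y).symm
  refine ⟨fun n x => ?_, fun n hn x hx => ?_, ?_⟩
  · obtain ⟨z, rfl⟩ := (inducedPi φ (ι n)).surjective x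
    change (_ ᵥ* _) ᵥ* _ = 0
    rw [← inducedPi_inducedMap, ← inducedPi_inducedMap, LinearEquiv.map_eq_zero_iff,
      ← inducedMap_comp]
    have h0 : (F (n + 1)).vecMulLinear.comp (F n).vecMulLinear = 0 :=
      LinearMap.ext fun x => hcomp n x
    rw [h0]
    induction z using induced_induction with
    | h0 => simp only [map_zero]
    | ht s m =>
      rw [inducedMap_mk_tmul, LinearMap.zero_apply, TensorProduct.tmul_zero]
      rfl
    | ha x y hx hy => rw [map_add, hx, hy, add_zero]
  · obtain ⟨z, rfl⟩ := (inducedPi φ (ι n)).surjective x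
    obtain ⟨M₁, _, _, f, hf, hf0, hfz⟩ := hb n
    rw [hfz]
    change _ ᵥ* _ = 0 at hx
    rw [← inducedPi_inducedMap, LinearEquiv.map_eq_zero_iff] at hx
    refine (inducedMap_exact hφ (f := f) (g := (F n).vecMulLinear) (fun x => ?_) z).1 hx
    rw [← hf]
    refine ⟨h.exact n hn x, fun hx => ?_⟩
    obtain ⟨y, rfl⟩ := (hf x).1 hx
    exact hf0 y
  · obtain ⟨π, hπ⟩ := h.exists_cohomology
    obtain ⟨M₁, _, _, f, hf, hf0, hfz⟩ := hb e
    obtain ⟨π', hs, hk⟩ := exists_induced_cohomology hφ f (rowComplex F e) hf0 π hπ.surjective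
      (fun x => by rw [hπ.eq_zero_iff, hf])
    have hker : ∀ x : LinearMap.ker (rowComplex (fun n => (F n).map φ) e),
        inducedMap φ (rowComplex F e) ((inducedPi φ (ι e)).symm x.1) = 0 := by
      intro x
      rw [← (inducedPi φ (ι (e + 1))).map_eq_zero_iff, inducedPi_inducedMap,
        LinearEquiv.apply_symm_apply]
      exact x.2
    refine ⟨π'.comp (((inducedPi φ (ι e)).symm.toLinearMap.comp
      (LinearMap.ker _).subtype).codRestrict _ hker), ?_, ?_⟩
    · intro n
      obtain ⟨⟨z, hz⟩, rfl⟩ := hs n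
      refine ⟨⟨inducedPi φ (ι e) z, ?_⟩, ?_⟩
      · change _ ᵥ* _ = 0
        rw [← inducedPi_inducedMap, LinearEquiv.map_eq_zero_iff]
        exact hz
      · refine congrArg π' (Subtype.ext ?_)
        exact (inducedPi φ (ι e)).symm_apply_apply z
    · intro x
      refine (hk _).trans ?_
      rw [← (inducedPi φ (ι e)).apply_symm_apply x.1, hfz]
      rfl

end Free

end Flat

/-! ### Tensoring a resolution with a representation, in coordinates. -/

section Twist

/-- Matrices of additive endomorphisms of a ring `R`, modelled on `u ↦ ∑ u' ρ(u'')` for a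
representation `ρ` of a Hopf algebra, together with the matrices obtained from it by composing
`ρ` with the antipode and with the square of the antipode. -/
structure TwistData (R : Type*) [Ring R] (l : Type*) [Fintype l] [DecidableEq l] where
  α : l → l → R →+ R
  β : l → l → R →+ R
  γ : l → l → R →+ R
  α_mul (i j : l) (u v : R) : α i j (u * v) = ∑ k, α i k u * α k j v
  β_mul (i j : l) (u v : R) : β i j (u * v) = ∑ k, β k j u * β i k v
  γ_mul (i j : l) (u v : R) : γ i j (u * v) = ∑ k, γ i k u * γ k j v
  α_β (i j : l) (u : R) : ∑ k, α i k (β k j u) = if i = j then u else 0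
  β_α (i j : l) (u : R) : ∑ k, β i k (α k j u) = if i = j then u else 0
  β_γ (i j : l) (u : R) : ∑ k, β k j (γ i k u) = if i = j then u else 0
  γ_β (i j : l) (u : R) : ∑ k, γ k j (β i k u) = if i = j then u else 0

namespace TwistData

variable {R : Type*} [Ring R] {l : Type} [Fintype l] [DecidableEq l] (t : TwistData R l)

/-- The twist data on the opposite ring obtained by exchanging `α` and `γ`, up to an
automorphism. -/
def opposite (τ : R ≃+* R) : TwistData Rᵐᵒᵖ l where
  α i j := (MulOpposite.opAddEquiv.toAddMonoidHom.comp ((τ : R →+* R).toAddMonoidHom.comp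
    (t.γ j i))).comp MulOpposite.opAddEquiv.symm.toAddMonoidHom
  -- Applying the inverse of τ before `β` cancels the τ applied after `γ` and `α`, so the inversion
  -- identities hold for every automorphism τ.
  β i j := (MulOpposite.opAddEquiv.toAddMonoidHom.comp ((t.β j i).comp
    (τ.symm : R →+* R).toAddMonoidHom)).comp MulOpposite.opAddEquiv.symm.toAddMonoidHom
  γ i j := (MulOpposite.opAddEquiv.toAddMonoidHom.comp ((τ : R →+* R).toAddMonoidHom.comp
    (t.α j i))).comp MulOpposite.opAddEquiv.symm.toAddMonoidHom
  α_mul i j u v := by simp [t.γ_mul, Finset.op_sum]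
  β_mul i j u v := by simp [t.β_mul, Finset.op_sum]
  γ_mul i j u v := by simp [t.α_mul, Finset.op_sum]
  α_β i j u := by
    have := congrArg τ (t.γ_β j i (τ.symm u.unop))
    rw [map_sum] at this
    refine MulOpposite.unop_injective ?_
    simp only [Finset.unop_sum]
    refine Eq.trans this ?_
    rw [apply_ite τ, apply_ite MulOpposite.unop]
    simp [eq_comm]
  β_α i j u := by
    have := t.β_γ j i u.unop
    refine MulOpposite.unop_injective ?_
    simp only [Finset.unop_sum]
    refine Eq.trans (Finset.sum_congr rfl fun k _ => ?_) (this.trans ?_)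
    · simp
    · rw [apply_ite MulOpposite.unop]
      simp [eq_comm]
  β_γ i j u := by
    have := t.β_α j i u.unop
    refine MulOpposite.unop_injective ?_
    simp only [Finset.unop_sum]
    refine Eq.trans (Finset.sum_congr rfl fun k _ => ?_) (this.trans ?_)
    · simp
    · rw [apply_ite MulOpposite.unop]
      simp [eq_comm]
  γ_β i j u := by
    have := congrArg τ (t.α_β j i (τ.symm u.unop))
    rw [map_sum] at this
    refine MulOpposite.unop_injective ?_
    simp only [Finset.unop_sum]
    refine Eq.trans this ?_
    rw [apply_ite τ, apply_ite MulOpposite.unop]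
    simp [eq_comm]

/-- The twist of a matrix by the entries of `β`. -/
def twist {ι κ : Type} (D : Matrix κ ι R) : Matrix (κ × l) (ι × l) R :=
  Matrix.of fun a b => t.β b.2 a.2 (D a.1 b.1)

/-- The additive equivalence which untwists row vectors. -/
def untwist (ι : Type) : (ι × l → R) ≃+ (l → ι → R) where
  toFun x i a := ∑ j, t.α i j (x (a, j))
  invFun y a := ∑ i, t.β a.2 i (y i a.1)
  left_inv x := by
    funext ⟨a, j⟩
    simp only [map_sum]
    rw [Finset.sum_comm]
    simp [t.β_α]
  right_inv y := by
    funext i a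
    simp only [map_sum]
    rw [Finset.sum_comm]
    simp [t.α_β]
  map_add' x y := by
    funext i a
    simp [Finset.sum_add_distrib]

theorem untwist_apply {ι : Type} (x : ι × l → R) (i : l) (a : ι) :
    t.untwist ι x i a = ∑ j, t.α i j (x (a, j)) := rfl

/-- By multiplicativity of `α`, the regular action becomes, after untwisting, an action through the
matrix `α` of u: the diagonal action on P ⊗ V in coordinates. -/
theorem untwist_smul {ι : Type} (u : R) (x : ι × l → R) (i : l) :
    t.untwist ι (u • x) i = ∑ k, t.α i k u • t.untwist ι x k := by
  funext a
  simp only [untwist_apply, Finset.sum_apply, Pi.smul_apply, smul_eq_mul, t.α_mul,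
    Finset.mul_sum]
  exact Finset.sum_comm

/-- Since `α` is multiplicative and inverts `β`, the twisted matrix is additively conjugate to
copies of D. The twisted complex is therefore a power of the original one; only the action changes.
-/
theorem untwist_vecMul {ι κ : Type} [Fintype ι] [Fintype κ] (D : Matrix κ ι R)
    (x : κ × l → R) (i : l) : t.untwist ι (x ᵥ* t.twist D) i = t.untwist κ x i ᵥ* D := by
  funext b
  simp only [untwist_apply, Matrix.vecMul, dotProduct, twist, Matrix.of_apply, map_sum, t.α_mul,
    Fintype.sum_prod_type, Finset.sum_mul]
  calc ∑ j, ∑ a, ∑ m, ∑ k, t.α i k (x (a, m)) * t.α k j (t.β j m (D a b))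
      = ∑ a, ∑ m, ∑ k, t.α i k (x (a, m)) * ∑ j, t.α k j (t.β j m (D a b)) := by
        rw [Finset.sum_comm]
        refine Finset.sum_congr rfl fun a _ => ?_
        rw [Finset.sum_comm]
        refine Finset.sum_congr rfl fun m _ => ?_
        rw [Finset.sum_comm]
        simp only [Finset.mul_sum]
    _ = ∑ a, ∑ m, t.α i m (x (a, m)) * D a b := by
        simp [t.α_β]

/-- Exactness is checked on the untwisted copies. The hypothesis `hb` says that the action of R on V
is the one which `α` induces on l-tuples in L. -/
theorem _root_.HopfDuality.IsMatRes.twist {ι : ℕ → Type} [∀ n, Fintype (ι n)]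
    {D : ∀ n, Matrix (ι (n + 1)) (ι n) R} {L V : Type*} [AddCommGroup L] [Module R L]
    [AddCommGroup V] [Module R V] {aug : (ι 0 → R) →ₗ[R] L} (h : IsMatRes D aug)
    (t : TwistData R l) (b : (l → L) ≃+ V)
    (hb : ∀ (u : R) (y : l → L), u • b y = b fun i => ∑ k, t.α i k u • y k) :
    ∃ aug' : (ι 0 × l → R) →ₗ[R] V,
      IsMatRes (ι := fun n => ι n × l) (fun n => t.twist (D n)) aug' := by
  let aug' : (ι 0 × l → R) →ₗ[R] V :=
    { toFun := fun x => b fun i => aug (t.untwist (ι 0) x i)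
      map_add' := fun x y => by
        rw [← map_add]
        congr 1
        funext i
        simp
      map_smul' := fun u x => by
        rw [RingHom.id_apply, hb]
        congr 1
        funext i
        rw [untwist_smul, map_sum]
        simp }
  have haug : ∀ x, aug' x = b fun i => aug (t.untwist (ι 0) x i) := fun _ => rfl
  refine ⟨aug', fun v => ?_, fun x => ?_, fun n x => ?_⟩
  · choose y hy using fun i => h.surjective (b.symm v i)
    refine ⟨(t.untwist (ι 0)).symm y, ?_⟩
    rw [haug, AddEquiv.apply_symm_apply]
    simp [hy]
  · rw [haug, AddEquiv.map_eq_zero_iff, funext_iff]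
    simp only [Pi.zero_apply, h.exact_zero]
    constructor
    · intro hx
      choose y hy using hx
      refine ⟨(t.untwist (ι 1)).symm y, (t.untwist (ι 0)).injective (funext fun i => ?_)⟩
      rw [untwist_vecMul, AddEquiv.apply_symm_apply, hy]
    · rintro ⟨y, rfl⟩ i
      exact ⟨_, (t.untwist_vecMul _ _ _).symm⟩
  · rw [← (t.untwist (ι n)).map_eq_zero_iff, funext_iff]
    simp only [Pi.zero_apply, untwist_vecMul, h.exact_succ]
    constructor
    · intro hx
      choose y hy using hx
      refine ⟨(t.untwist (ι (n + 2))).symm y,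
        (t.untwist (ι (n + 1))).injective (funext fun i => ?_)⟩
      rw [untwist_vecMul, AddEquiv.apply_symm_apply, hy]
    · rintro ⟨y, rfl⟩ i
      exact ⟨_, (t.untwist_vecMul _ _ _).symm⟩

/-- The additive equivalence which untwists the dual complex. -/
def untwistOp (ι : Type) : (ι × l → Rᵐᵒᵖ) ≃+ (l → ι → Rᵐᵒᵖ) where
  toFun x i a := MulOpposite.op (∑ j, t.γ j i (x (a, j)).unop)
  invFun y a := MulOpposite.op (∑ i, t.β i a.2 (y i a.1).unop)
  left_inv x := by
    funext ⟨a, j⟩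
    simp only [map_sum, MulOpposite.unop_op]
    rw [Finset.sum_comm]
    simp [t.β_γ]
  right_inv y := by
    funext i a
    simp only [map_sum, MulOpposite.unop_op]
    rw [Finset.sum_comm]
    simp [t.γ_β]
  map_add' x y := by
    funext i a
    simp [Finset.sum_add_distrib]

theorem untwistOp_apply {ι : Type} (x : ι × l → Rᵐᵒᵖ) (i : l) (a : ι) :
    t.untwistOp ι x i a = MulOpposite.op (∑ j, t.γ j i (x (a, j)).unop) := rfl

theorem untwistOp_smul {ι : Type} (u : R) (x : ι × l → Rᵐᵒᵖ) (i : l) :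
    t.untwistOp ι (MulOpposite.op u • x) i =
      ∑ k, MulOpposite.op (t.γ k i u) • t.untwistOp ι x k := by
  funext a
  refine MulOpposite.unop_injective ?_
  simp only [untwistOp_apply, Finset.sum_apply, Pi.smul_apply, smul_eq_mul, Finset.unop_sum,
    MulOpposite.unop_mul, MulOpposite.unop_op, t.γ_mul, Finset.sum_mul]
  exact Finset.sum_comm

/-- Written for the inverse of the untwisting map, this needs only the multiplicativity of `β`,
whose reversed order of indices fits the opposite ring. The matrix that inverts `β` with this order
of indices is `γ`, not `α`. -/
theorem untwistOp_symm_vecMul {ι κ : Type} [Fintype ι] [Fintype κ] (D : Matrix κ ι R)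
    (y : l → ι → Rᵐᵒᵖ) : (t.untwistOp κ).symm (fun i => y i ᵥ* opMat D) =
      (t.untwistOp ι).symm y ᵥ* opMat (t.twist D) := by
  funext ⟨a, j⟩
  refine MulOpposite.unop_injective ?_
  change ∑ i, t.β i j (∑ b, y i b * opMat D b a).unop =
    (∑ b, (t.untwistOp ι).symm y b * opMat (t.twist D) b (a, j)).unop
  simp only [Finset.unop_sum, MulOpposite.unop_mul, map_sum, Fintype.sum_prod_type]
  change ∑ i, ∑ b, t.β i j (D a b * (y i b).unop) =
    ∑ b, ∑ k, t.β k j (D a b) * ∑ i, t.β i k (y i b).unop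
  simp only [t.β_mul, Finset.mul_sum]
  rw [Finset.sum_comm]
  exact Finset.sum_congr rfl fun b _ => Finset.sum_comm

theorem untwistOp_vecMul {ι κ : Type} [Fintype ι] [Fintype κ] (D : Matrix κ ι R)
    (x : ι × l → Rᵐᵒᵖ) (i : l) :
    t.untwistOp κ (x ᵥ* opMat (t.twist D)) i = t.untwistOp ι x i ᵥ* opMat D := by
  have := t.untwistOp_symm_vecMul D (t.untwistOp ι x)
  rw [AddEquiv.symm_apply_apply, AddEquiv.symm_apply_eq] at this
  exact (congrFun this i).symm

/-- Additively, the dual of the twisted complex is a power of the dual of the original complex, and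
the action on cohomology passes through `γ`. For a representation ρ this is the action involving S².
-/
theorem _root_.HopfDuality.Concentrated.twist {ι : ℕ → Type} [∀ n, Fintype (ι n)]
    {D : ∀ n, Matrix (ι (n + 1)) (ι n) R} {d : ℕ} {H H' : Type*} [AddCommGroup H]
    [Module Rᵐᵒᵖ H] [AddCommGroup H'] [Module Rᵐᵒᵖ H']
    (h : Concentrated (rowComplex fun n => opMat (D n)) d H)
    (t : TwistData R l) (b : (l → H) ≃+ H')
    (hb : ∀ (u : R) (y : l → H), MulOpposite.op u • b y =
      b fun i => ∑ k, MulOpposite.op (t.γ k i u) • y k) :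
    Concentrated (rowComplex (ι := fun n => ι n × l) fun n => opMat (t.twist (D n))) d H' := by
  let e (n : ℕ) : (ι n × l → Rᵐᵒᵖ) ≃ₗ[ℤ] (l → ι n → Rᵐᵒᵖ) := (t.untwistOp (ι n)).toIntLinearEquiv
  let δ (n : ℕ) := (rowComplex (ι := fun n => ι n × l)
    (fun n => opMat (t.twist (D n))) n).toAddMonoidHom.toIntLinearMap
  have he : ∀ n x i, e (n + 1) (δ n x) i =
      (1 : ℤ) • rowComplex (fun n => opMat (D n)) n (e n x i) := by
    intro n x i
    rw [one_smul]
    exact t.untwistOp_vecMul (D n) x i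
  have hδ : ∀ n x, δ n x = rowComplex (ι := fun n => ι n × l)
    (fun n => opMat (t.twist (D n))) n x := fun _ _ => rfl
  have hbd : ∀ n x, x ∈ boundaries (rowComplex (ι := fun n => ι n × l)
      fun n => opMat (t.twist (D n))) n ↔ x ∈ boundaries δ n := by
    intro n x
    rcases n with _ | n <;> exact Iff.rfl
  refine ⟨fun n x => ?_, fun n hn x hx => ?_, ?_⟩
  · rw [← hδ, ← hδ, apply_eq_zero_iff_of_equiv_pi e (one_mul _) he]
    intro i
    rw [he, one_smul]
    exact h.comp_eq_zero n _
  · rw [hbd, mem_boundaries_iff_of_equiv_pi e (one_mul _) he]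
    rw [← hδ, apply_eq_zero_iff_of_equiv_pi e (one_mul _) he] at hx
    exact fun i => h.exact n hn _ (hx i)
  · obtain ⟨π, hπ⟩ := h.exists_cohomology
    have hpi := isCohomology_piCohomologyMap e (one_mul _) he hπ
    let j : LinearMap.ker (rowComplex (ι := fun n => ι n × l)
        (fun n => opMat (t.twist (D n))) d) →+ LinearMap.ker (δ d) :=
      { toFun := fun x => ⟨x.1, x.2⟩
        map_zero' := rfl
        map_add' := fun _ _ => rfl }
    let p := piCohomologyMap e (one_mul _) he π
    let π' : LinearMap.ker (rowComplex (ι := fun n => ι n × l)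
        (fun n => opMat (t.twist (D n))) d) →ₗ[Rᵐᵒᵖ] H' :=
      { toFun := fun x => b (p (j x))
        map_add' := fun x y => by
          rw [map_add j, map_add p, map_add b]
        map_smul' := fun u x => by
          have hx : ∀ k, rowComplex (fun n => opMat (D n)) d (t.untwistOp (ι d) x.1 k) = 0 :=
            (apply_eq_zero_iff_of_equiv_pi e (one_mul _) he d x.1).1 x.2
          rw [RingHom.id_apply, ← MulOpposite.op_unop u, hb]
          congr 1
          funext i
          change π ⟨t.untwistOp (ι d) (MulOpposite.op u.unop • x.1) i, _⟩ =
            ∑ k, MulOpposite.op (t.γ k i u.unop) • π ⟨t.untwistOp (ι d) x.1 k, hx k⟩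
          simp only [← map_smul, ← map_sum]
          congr 1
          refine Subtype.ext ?_
          rw [Submodule.coe_sum]
          exact t.untwistOp_smul _ _ _ }
    refine ⟨π', fun y => ?_, fun x => ?_⟩
    · obtain ⟨x, hx⟩ := hpi.surjective (b.symm y)
      refine ⟨⟨x.1, x.2⟩, ?_⟩
      change b (p x) = y
      exact (congrArg b hx).trans (b.apply_symm_apply y)
    · rw [hbd]
      exact (AddEquiv.map_eq_zero_iff b).trans (hpi.eq_zero_iff ⟨x.1, x.2⟩)

end TwistData

end Twist

/-! ### Operators u ↦ ∑ θ(u'') u' on a topological Hopf algebra, controlled modulo powers of the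
ideal. -/

section Convolution

variable {K : Type*} [CommRing K] (I : Ideal K)

theorem one_tmul_map {J : Ideal K} {M N : Type*} [AddCommGroup M] [Module K M] [AddCommGroup N]
    [Module K N] (f : M →ₗ[K] N) {x y : M} (h : (1 : K ⧸ J) ⊗ₜ[K] x = (1 : K ⧸ J) ⊗ₜ[K] y) :
    (1 : K ⧸ J) ⊗ₜ[K] f x = (1 : K ⧸ J) ⊗ₜ[K] f y := by
  simpa using congrArg (f.lTensor (K ⧸ J)) h

theorem eq_of_one_tmul_eq {M : Type*} [AddCommGroup M] [Module K M] [IsHausdorff I M] {x y : M}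
    (h : ∀ n : ℕ, (1 : K ⧸ I ^ n) ⊗ₜ[K] x = (1 : K ⧸ I ^ n) ⊗ₜ[K] y) : x = y :=
  IsHausdorff.eq_iff_smodEq.2 fun n => (one_tmul_eq_iff M (I ^ n) x y).1 (h n)

variable {B : Type*} [Ring B] [Algebra K B] [TopHopfAlgebra I B]

/-- The contraction `b ⊗ e ↦ θ(e) b`. -/
def contract {E : Type*} [AddCommGroup E] [Module K E] (B : Type*) [Ring B] [Algebra K B]
    (θ : E →ₗ[K] K) : B ⊗[K] E →ₗ[K] B :=
  (TensorProduct.rid K B).toLinearMap ∘ₗ θ.lTensor B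

@[simp]
theorem contract_tmul {E : Type*} [AddCommGroup E] [Module K E] (θ : E →ₗ[K] K) (b : B) (e : E) :
    contract B θ (b ⊗ₜ[K] e) = θ e • b := by
  simp [contract]

/-- `t` represents the coproduct of `u` modulo `I ^ n`. -/
def IsComul (n : ℕ) (u : B) (t : B ⊗[K] B) : Prop :=
  Completion.eval I (B ⊗[K] B) n (TopHopfAlgebra.comul u) = 1 ⊗ₜ[K] t

theorem exists_isComul (n : ℕ) (u : B) : ∃ t, IsComul I n u t :=
  exists_one_tmul _ _ _

/-- The element `y` is `∑ θ(u'') u'`. -/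
def IsConv (θ : B →ₗ[K] K) (u y : B) : Prop :=
  ∀ n t, IsComul I n u t → (1 : K ⧸ I ^ n) ⊗ₜ[K] y = 1 ⊗ₜ[K] contract B θ t

theorem isComul_coassoc {n : ℕ} {u : B} {t : B ⊗[K] B} (h : IsComul I n u t) :
    comulLeft I ((Completion.eval I (B ⊗[K] B) n).comp TopHopfAlgebra.comul).toLinearMap t =
      comulRight I ((Completion.eval I (B ⊗[K] B) n).comp TopHopfAlgebra.comul).toLinearMap t := by
  have := TopHopfAlgebra.coassoc (I := I) n u
  rw [show Completion.eval I (B ⊗[K] B) n (TopHopfAlgebra.comul u) = 1 ⊗ₜ[K] t from h] at this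
  simpa [extend] using this

theorem isComul_counit_right {n : ℕ} {u : B} {t : B ⊗[K] B} (h : IsComul I n u t) :
    (1 : K ⧸ I ^ n) ⊗ₜ[K] contract B (TopHopfAlgebra.counit I).toLinearMap t = 1 ⊗ₜ[K] u := by
  have := TopHopfAlgebra.counit_right (I := I) n u
  rw [show Completion.eval I (B ⊗[K] B) n (TopHopfAlgebra.comul u) = 1 ⊗ₜ[K] t from h] at this
  exact this

theorem isComul_counit_left {n : ℕ} {u : B} {t : B ⊗[K] B} (h : IsComul I n u t) :
    (1 : K ⧸ I ^ n) ⊗ₜ[K] ((TensorProduct.lid K B).toLinearMap ∘ₗ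
      (TopHopfAlgebra.counit I).toLinearMap.rTensor B) t = 1 ⊗ₜ[K] u := by
  have := TopHopfAlgebra.counit_left (I := I) n u
  rw [show Completion.eval I (B ⊗[K] B) n (TopHopfAlgebra.comul u) = 1 ⊗ₜ[K] t from h] at this
  exact this

variable (B) in
/-- The antipode, as a linear endomorphism. -/
def antipodeLin : B →ₗ[K] B :=
  (MulOpposite.opLinearEquiv K).symm.toLinearMap ∘ₗ (TopHopfAlgebra.antipode I).toLinearMap

theorem antipodeLin_apply (u : B) : antipodeLin I B u = (TopHopfAlgebra.antipode I u).unop := rfl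

theorem antipodeLin_mul (u v : B) :
    antipodeLin I B (u * v) = antipodeLin I B v * antipodeLin I B u := by
  simp [antipodeLin_apply]

theorem antipodeLin_one : antipodeLin I B 1 = 1 := by
  simp [antipodeLin_apply]

theorem isComul_antipode_left {n : ℕ} {u : B} {t : B ⊗[K] B} (h : IsComul I n u t) :
    (1 : K ⧸ I ^ n) ⊗ₜ[K] (LinearMap.mul' K B ∘ₗ (antipodeLin I B).rTensor B) t =
      1 ⊗ₜ[K] (TopHopfAlgebra.counit I u • (1 : B)) := by
  have := TopHopfAlgebra.antipode_left (I := I) n u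
  rw [show Completion.eval I (B ⊗[K] B) n (TopHopfAlgebra.comul u) = 1 ⊗ₜ[K] t from h,
    Algebra.algebraMap_eq_smul_one] at this
  exact this

theorem isComul_antipode_right {n : ℕ} {u : B} {t : B ⊗[K] B} (h : IsComul I n u t) :
    (1 : K ⧸ I ^ n) ⊗ₜ[K] (LinearMap.mul' K B ∘ₗ (antipodeLin I B).lTensor B) t =
      1 ⊗ₜ[K] (TopHopfAlgebra.counit I u • (1 : B)) := by
  have := TopHopfAlgebra.antipode_right (I := I) n u
  rw [show Completion.eval I (B ⊗[K] B) n (TopHopfAlgebra.comul u) = 1 ⊗ₜ[K] t from h,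
    Algebra.algebraMap_eq_smul_one] at this
  exact this

/-- Apply the counit ε to ∑ S(u') u'' = ε(u): the left side becomes ε(S(∑ ε(u'') u')) = ε(S(u)). -/
theorem counit_antipode [IsHausdorff I K] (u : B) :
    TopHopfAlgebra.counit I (antipodeLin I B u) = TopHopfAlgebra.counit I u := by
  refine eq_of_one_tmul_eq I fun n => ?_
  obtain ⟨t, ht⟩ := exists_isComul I n u
  have h1 := one_tmul_map ((TopHopfAlgebra.counit I).toLinearMap ∘ₗ antipodeLin I B)
    (isComul_counit_right I ht)
  have h2 := one_tmul_map (TopHopfAlgebra.counit I).toLinearMap (isComul_antipode_left I ht)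
  simp only [LinearMap.comp_apply, AlgHom.toLinearMap_apply] at h1 h2
  rw [← h1, show TopHopfAlgebra.counit I u =
    TopHopfAlgebra.counit I (TopHopfAlgebra.counit I u • (1 : B)) by simp, ← h2]
  congr 1
  clear h1 h2 ht
  induction t using TensorProduct.induction_on with
  | zero => simp
  | tmul x y => simp [mul_comm]
  | add x y hx hy => simp only [map_add, hx, hy]

/-- ε(∑ θ(u'') u') = θ(∑ ε(u') u'') = θ(u). In this way the counit recovers matrix coefficients and
characters from their operators. -/
theorem counit_eq_of_isConv [IsHausdorff I K] {θ : B →ₗ[K] K} {u y : B} (h : IsConv I θ u y) :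
    TopHopfAlgebra.counit I y = θ u := by
  refine eq_of_one_tmul_eq I fun n => ?_
  obtain ⟨t, ht⟩ := exists_isComul I n u
  have h1 := one_tmul_map (TopHopfAlgebra.counit I).toLinearMap (h n t ht)
  have h2 := one_tmul_map θ (isComul_counit_left I ht)
  rw [AlgHom.toLinearMap_apply, AlgHom.toLinearMap_apply] at h1
  rw [h1, ← h2]
  congr 1
  clear h1 h2 ht
  induction t using TensorProduct.induction_on with
  | zero => simp
  | tmul x y => simp [mul_comm]
  | add x y hx hy => simp only [map_add, hx, hy]

/-- The composition of the operators `u ↦ ∑ θ(u'') u'` and `u ↦ ∑ η(u'') u'` is the operator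
defined by the convolution of `θ` and `η`; here for families whose convolution is a multiple of
the counit. -/
theorem sum_conv_conv {l : Type*} [Fintype l] (θ η : l → B →ₗ[K] K) (T T' : l → B →ₗ[K] B)
    (hT : ∀ k u, IsConv I (θ k) u (T k u)) (hT' : ∀ k u, IsConv I (η k) u (T' k u)) (c : K)
    (h : ∀ n (b : B) s, IsComul I n b s → (1 : K ⧸ I ^ n) ⊗ₜ[K]
      (∑ k, LinearMap.mul' K K (TensorProduct.map (θ k) (η k) s)) =
        1 ⊗ₜ[K] (TopHopfAlgebra.counit I b * c)) (u : B) :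
    ∑ k, T k (T' k u) = c • u := by
  have : IsAdicComplete I B := TopHopfAlgebra.isAdicComplete
  refine eq_of_one_tmul_eq I fun n => ?_
  obtain ⟨t, ht⟩ := exists_isComul I n u
  have h1 : ∀ k, (1 : K ⧸ I ^ n) ⊗ₜ[K] T k (T' k u) = 1 ⊗ₜ[K] T k (contract B (η k) t) :=
    fun k => one_tmul_map (T k) (hT' k u n t ht)
  -- `L` pairs the last two tensor factors with θ and η. On one side of coassociativity it gives the
  -- composite operator, on the other side the operator of the convolution.
  let L (k : l) : B ⊗[K] (B ⊗[K] B) →ₗ[K] B :=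
    contract B (LinearMap.mul' K K ∘ₗ TensorProduct.map (θ k) (η k))
  set δ := ((Completion.eval I (B ⊗[K] B) n).comp
    (TopHopfAlgebra.comul (I := I) (A := B))).toLinearMap with hδ
  have hδ' : ∀ b s, IsComul I n b s → δ b = 1 ⊗ₜ[K] s := fun b s hs => hs
  have hleft : ∀ k t, (1 : K ⧸ I ^ n) ⊗ₜ[K] T k (contract B (η k) t) =
      (L k).lTensor (K ⧸ I ^ n) (comulLeft I δ t) := by
    intro k t
    induction t using TensorProduct.induction_on with
    | zero => simp
    | tmul a b =>
      obtain ⟨s, hs⟩ := exists_isComul I n a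
      have h2 : comulLeft I δ (a ⊗ₜ[K] b) = 1 ⊗ₜ[K] TensorProduct.assoc K B B B (s ⊗ₜ[K] b) := by
        simp [comulLeft, hδ' a s hs]
      rw [h2, LinearMap.lTensor_tmul, contract_tmul, map_smul, TensorProduct.tmul_smul,
        hT k a n s hs, ← TensorProduct.tmul_smul]
      congr 1
      clear h2 hs
      induction s using TensorProduct.induction_on with
      | zero => simp
      | tmul x y => simp [L, smul_smul, mul_comm]
      | add x y hx hy => simp only [map_add, smul_add, TensorProduct.add_tmul, hx, hy]
    | add x y hx hy => simp only [map_add, TensorProduct.tmul_add, hx, hy]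
  have hright : ∀ t, ∑ k, (L k).lTensor (K ⧸ I ^ n) (comulRight I δ t) =
      (1 : K ⧸ I ^ n) ⊗ₜ[K] (c • contract B (TopHopfAlgebra.counit I).toLinearMap t) := by
    intro t
    induction t using TensorProduct.induction_on with
    | zero => simp
    | tmul a b =>
      obtain ⟨s, hs⟩ := exists_isComul I n b
      have h2 : comulRight I δ (a ⊗ₜ[K] b) = 1 ⊗ₜ[K] (a ⊗ₜ[K] s) := by
        simp [comulRight, hδ' b s hs]
      simp only [h2, LinearMap.lTensor_tmul, L, contract_tmul, ← TensorProduct.tmul_sum,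
        LinearMap.comp_apply, ← Finset.sum_smul]
      have h3 := one_tmul_map (LinearMap.toSpanSingleton K B a) (h n b s hs)
      simp only [LinearMap.toSpanSingleton_apply] at h3
      rw [h3, AlgHom.toLinearMap_apply, smul_smul, mul_comm]
    | add x y hx hy =>
      simp only [map_add, smul_add, TensorProduct.tmul_add, Finset.sum_add_distrib, hx, hy]
  rw [TensorProduct.tmul_sum]
  simp only [h1, hleft, hδ, isComul_coassoc I ht]
  rw [← hδ, hright, TensorProduct.tmul_smul, isComul_counit_right I ht, TensorProduct.tmul_smul]

/-- When the pairing factors through x S(y), the axiom ∑ u' S(u'') = ε(u) makes the convolution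
equal to G(1) ε. -/
theorem sum_conv_conv_of_mul_antipode {l : Type*} [Fintype l] (θ η : l → B →ₗ[K] K)
    (T T' : l → B →ₗ[K] B) (hT : ∀ k u, IsConv I (θ k) u (T k u))
    (hT' : ∀ k u, IsConv I (η k) u (T' k u)) (G : B →ₗ[K] K)
    (hG : ∀ x y, ∑ k, θ k x * η k y = G (x * antipodeLin I B y)) (u : B) :
    ∑ k, T k (T' k u) = G 1 • u := by
  refine sum_conv_conv I θ η T T' hT hT' _ (fun n b s hs => ?_) u
  have h1 := one_tmul_map G (isComul_antipode_right I hs)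
  rw [map_smul, smul_eq_mul] at h1
  rw [← h1]
  congr 1
  clear h1 hs
  induction s using TensorProduct.induction_on with
  | zero => simp
  | tmul x y => simp [hG]
  | add x y hx hy => simp only [map_add, Finset.sum_add_distrib, hx, hy]

theorem sum_conv_conv_of_antipode_mul {l : Type*} [Fintype l] (θ η : l → B →ₗ[K] K)
    (T T' : l → B →ₗ[K] B) (hT : ∀ k u, IsConv I (θ k) u (T k u))
    (hT' : ∀ k u, IsConv I (η k) u (T' k u)) (G : B →ₗ[K] K)
    (hG : ∀ x y, ∑ k, θ k x * η k y = G (antipodeLin I B x * y)) (u : B) :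
    ∑ k, T k (T' k u) = G 1 • u := by
  refine sum_conv_conv I θ η T T' hT hT' _ (fun n b s hs => ?_) u
  have h1 := one_tmul_map G (isComul_antipode_left I hs)
  rw [map_smul, smul_eq_mul] at h1
  rw [← h1]
  congr 1
  clear h1 hs
  induction s using TensorProduct.induction_on with
  | zero => simp
  | tmul x y => simp [hG]
  | add x y hx hy => simp only [map_add, Finset.sum_add_distrib, hx, hy]

section Coaction

variable {E : Type*} [Ring E] [Algebra K E] [Module.Free K E] [Module.Finite K E]

/-- The homomorphism `u ↦ ∑ u' ⊗ ρ(u'')`, for a homomorphism `ρ` to a finite free algebra. -/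
def coaction (ρ : B →ₐ[K] E) : B →ₐ[K] B ⊗[K] E :=
  letI : IsAdicComplete I B := TopHopfAlgebra.isAdicComplete
  letI : IsAdicComplete I (B ⊗[K] E) := isAdicComplete_tensor I B E
  (Completion.equiv I (B ⊗[K] E)).symm.toAlgHom.comp
    ((Completion.map I (Algebra.TensorProduct.map (AlgHom.id K B) ρ)).comp TopHopfAlgebra.comul)

theorem coaction_spec (ρ : B →ₐ[K] E) {n : ℕ} {u : B} {t : B ⊗[K] B} (h : IsComul I n u t) :
    (1 : K ⧸ I ^ n) ⊗ₜ[K] coaction I ρ u =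
      1 ⊗ₜ[K] Algebra.TensorProduct.map (AlgHom.id K B) ρ t := by
  have : IsAdicComplete I B := TopHopfAlgebra.isAdicComplete
  have : IsAdicComplete I (B ⊗[K] E) := isAdicComplete_tensor I B E
  have h1 : Completion.equiv I (B ⊗[K] E) (coaction I ρ u) =
      Completion.map I (Algebra.TensorProduct.map (AlgHom.id K B) ρ) (TopHopfAlgebra.comul u) :=
    (Completion.equiv I (B ⊗[K] E)).apply_symm_apply _
  have h2 : (1 : K ⧸ I ^ n) ⊗ₜ[K] coaction I ρ u =
      Algebra.TensorProduct.map (AlgHom.id K (K ⧸ I ^ n))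
        (Algebra.TensorProduct.map (AlgHom.id K B) ρ)
        (Completion.eval I (B ⊗[K] B) n (TopHopfAlgebra.comul u)) :=
    congrFun (congrArg Subtype.val h1) n
  rw [h2, show Completion.eval I (B ⊗[K] B) n (TopHopfAlgebra.comul u) = 1 ⊗ₜ[K] t from h]
  rfl

/-- The operator `u ↦ ∑ s(ρ(u'')) u'`. -/
def conv (ρ : B →ₐ[K] E) (s : E →ₗ[K] K) : B →ₗ[K] B :=
  contract B s ∘ₗ (coaction I ρ).toLinearMap

theorem isConv_conv (ρ : B →ₐ[K] E) (s : E →ₗ[K] K) (u : B) :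
    IsConv I (s ∘ₗ ρ.toLinearMap) u (conv I ρ s u) := by
  intro n t ht
  have h1 := one_tmul_map (contract B s) (coaction_spec I ρ ht)
  refine h1.trans ?_
  congr 1
  clear h1 ht
  induction t using TensorProduct.induction_on with
  | zero => simp
  | tmul x y => simp
  | add x y hx hy => simp only [map_add, hx, hy]

/-- The coaction is an algebra homomorphism, so the expansion of s on products in E passes to the
operators. For matrix coefficients this is matrix multiplication. -/
theorem conv_mul (ρ : B →ₐ[K] E) (s : E →ₗ[K] K) {l : Type*} [Fintype l] (p q : l → E →ₗ[K] K)
    (h : ∀ x y, s (x * y) = ∑ k, p k x * q k y) (u v : B) :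
    conv I ρ s (u * v) = ∑ k, conv I ρ (p k) u * conv I ρ (q k) v := by
  have key : ∀ x y : B ⊗[K] E, contract B s (x * y) =
      ∑ k, contract B (p k) x * contract B (q k) y := by
    intro x y
    induction x using TensorProduct.induction_on with
    | zero => simp
    | tmul a b =>
      induction y using TensorProduct.induction_on with
      | zero => simp
      | tmul c d =>
        simp only [Algebra.TensorProduct.tmul_mul_tmul, contract_tmul, h, Finset.sum_smul,
          smul_mul_assoc, mul_smul_comm, smul_smul]
        exact Finset.sum_congr rfl fun k _ => by rw [mul_comm]
      | add x y hx hy => simp only [mul_add, map_add, hx, hy, Finset.sum_add_distrib]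
    | add x z hx hz => simp only [add_mul, map_add, hx, hz, Finset.sum_add_distrib]
  change contract B s (coaction I ρ (u * v)) = _
  rw [map_mul, key]
  rfl

end Coaction

/-- The homomorphism to the opposite algebra obtained by composition with the antipode. -/
def compAntipode {E : Type*} [Ring E] [Algebra K E] (ρ : B →ₐ[K] E) : B →ₐ[K] Eᵐᵒᵖ :=
  (AlgHom.op ρ).comp (TopHopfAlgebra.antipode I).toAlgHom

theorem unop_compAntipode {E : Type*} [Ring E] [Algebra K E] (ρ : B →ₐ[K] E) (u : B) :
    (compAntipode I ρ u).unop = ρ (antipodeLin I B u) := rfl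

theorem antipodeSq_apply (u : B) :
    TopHopfAlgebra.antipodeSq I B u = antipodeLin I B (antipodeLin I B u) := rfl

section Representation

variable {l : Type} {V : Type*} [AddCommGroup V] [Module K V]

/-- The coefficient `(i, j)` of an endomorphism in a basis. -/
def matCoeff (b : Module.Basis l K V) (i j : l) : Module.End K V →ₗ[K] K :=
  b.coord i ∘ₗ LinearMap.applyₗ (b j)

theorem matCoeff_apply (b : Module.Basis l K V) (i j : l) (e : Module.End K V) :
    matCoeff b i j e = b.repr (e (b j)) i := rfl

theorem matCoeff_mul [Fintype l] (b : Module.Basis l K V) (i j : l) (e e' : Module.End K V) :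
    matCoeff b i j (e * e') = ∑ k, matCoeff b i k e * matCoeff b k j e' := by
  have := congrArg (fun v => b.repr (e v) i) (b.sum_repr (e' (b j)))
  simp only [map_sum, map_smul, Finsupp.coe_finsetSum, Finset.sum_apply, Finsupp.smul_apply,
    smul_eq_mul] at this
  refine this.symm.trans (Finset.sum_congr rfl fun k _ => ?_)
  rw [mul_comm]
  rfl

theorem matCoeff_one [DecidableEq l] (b : Module.Basis l K V) (i j : l) :
    matCoeff b i j 1 = if i = j then 1 else 0 := by
  simp [matCoeff_apply, Finsupp.single_apply, eq_comm]

/-- The coefficient of an element of the opposite of an endomorphism algebra. -/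
def matCoeffOp (b : Module.Basis l K V) (i j : l) : (Module.End K V)ᵐᵒᵖ →ₗ[K] K :=
  matCoeff b i j ∘ₗ (MulOpposite.opLinearEquiv K).symm.toLinearMap

theorem matCoeffOp_apply (b : Module.Basis l K V) (i j : l) (e : (Module.End K V)ᵐᵒᵖ) :
    matCoeffOp b i j e = matCoeff b i j e.unop := rfl

theorem ite_one_zero_smul {M : Type*} [AddCommGroup M] [Module K M] (p : Prop) [Decidable p]
    (u : M) : (if p then (1 : K) else 0) • u = if p then u else 0 := by
  split_ifs <;> simp

variable [Fintype l] [DecidableEq l] [Module.Free K V] [Module.Finite K V]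

/-- The twist data of a finite free representation of a topological Hopf algebra. -/
def twistData (ρ : B →ₐ[K] Module.End K V) (b : Module.Basis l K V) : TwistData B l where
  α i j := (conv I ρ (matCoeff b i j)).toAddMonoidHom
  β i j := (conv I (compAntipode I ρ) (matCoeffOp b i j)).toAddMonoidHom
  γ i j := (conv I (ρ.comp (TopHopfAlgebra.antipodeSq I B)) (matCoeff b i j)).toAddMonoidHom
  α_mul i j u v := conv_mul I ρ _ (fun k => matCoeff b i k) (fun k => matCoeff b k j)
    (matCoeff_mul b i j) u v
  β_mul i j u v := conv_mul I (compAntipode I ρ) _ (fun k => matCoeffOp b k j)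
    (fun k => matCoeffOp b i k) (fun x y => by
      simp only [matCoeffOp_apply, MulOpposite.unop_mul, matCoeff_mul]
      exact Finset.sum_congr rfl fun k _ => mul_comm _ _) u v
  γ_mul i j u v := conv_mul I _ _ (fun k => matCoeff b i k) (fun k => matCoeff b k j)
    (matCoeff_mul b i j) u v
  α_β i j u := by
    refine (sum_conv_conv_of_mul_antipode I _ _ _ _
      (fun k => isConv_conv I ρ (matCoeff b i k))
      (fun k => isConv_conv I (compAntipode I ρ) (matCoeffOp b k j))
      (matCoeff b i j ∘ₗ ρ.toLinearMap) (fun x y => ?_) u).trans ?_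
    · simp only [LinearMap.comp_apply, AlgHom.toLinearMap_apply, matCoeffOp_apply,
        unop_compAntipode, map_mul, matCoeff_mul]
    · simp only [LinearMap.comp_apply, AlgHom.toLinearMap_apply, map_one, matCoeff_one,
        ite_one_zero_smul]
  β_α i j u := by
    refine (sum_conv_conv_of_antipode_mul I _ _ _ _
      (fun k => isConv_conv I (compAntipode I ρ) (matCoeffOp b i k))
      (fun k => isConv_conv I ρ (matCoeff b k j))
      (matCoeff b i j ∘ₗ ρ.toLinearMap) (fun x y => ?_) u).trans ?_
    · simp only [LinearMap.comp_apply, AlgHom.toLinearMap_apply, matCoeffOp_apply,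
        unop_compAntipode, map_mul, matCoeff_mul]
    · simp only [LinearMap.comp_apply, AlgHom.toLinearMap_apply, map_one, matCoeff_one,
        ite_one_zero_smul]
  -- For the legs x, y of the coproduct, ρ(S²(y)) ρ(S(x)) = ρ(S(x S(y))). The antipode reverses the
  -- product, which accounts both for S² and for the order of the indices.
  β_γ i j u := by
    refine (sum_conv_conv_of_mul_antipode I _ _ _ _
      (fun k => isConv_conv I (compAntipode I ρ) (matCoeffOp b k j))
      (fun k => isConv_conv I (ρ.comp (TopHopfAlgebra.antipodeSq I B)) (matCoeff b i k))
      (matCoeff b i j ∘ₗ ρ.toLinearMap ∘ₗ antipodeLin I B) (fun x y => ?_) u).trans ?_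
    · simp only [LinearMap.comp_apply, AlgHom.toLinearMap_apply, matCoeffOp_apply,
        unop_compAntipode, map_mul, matCoeff_mul, antipodeLin_mul, AlgHom.comp_apply,
        antipodeSq_apply]
      exact Finset.sum_congr rfl fun k _ => mul_comm _ _
    · simp only [LinearMap.comp_apply, AlgHom.toLinearMap_apply, antipodeLin_one, map_one,
        matCoeff_one, ite_one_zero_smul]
  γ_β i j u := by
    refine (sum_conv_conv_of_antipode_mul I _ _ _ _
      (fun k => isConv_conv I (ρ.comp (TopHopfAlgebra.antipodeSq I B)) (matCoeff b k j))
      (fun k => isConv_conv I (compAntipode I ρ) (matCoeffOp b i k))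
      (matCoeff b i j ∘ₗ ρ.toLinearMap ∘ₗ antipodeLin I B) (fun x y => ?_) u).trans ?_
    · simp only [LinearMap.comp_apply, AlgHom.toLinearMap_apply, matCoeffOp_apply,
        unop_compAntipode, map_mul, matCoeff_mul, antipodeLin_mul, AlgHom.comp_apply,
        antipodeSq_apply]
      exact Finset.sum_congr rfl fun k _ => mul_comm _ _
    · simp only [LinearMap.comp_apply, AlgHom.toLinearMap_apply, antipodeLin_one, map_one,
        matCoeff_one, ite_one_zero_smul]

end Representation

/-- The automorphism `u ↦ ∑ χ(u'') u'` defined by a character. -/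
def windingEquiv (χ : B →ₐ[K] K) : B ≃+* B where
  toFun := conv I χ LinearMap.id
  invFun := conv I (compAntipode I χ) (MulOpposite.opLinearEquiv K).symm.toLinearMap
  left_inv u := by
    have := sum_conv_conv_of_antipode_mul I (l := Unit) _ _ _ _
      (fun _ => isConv_conv I (compAntipode I χ) (MulOpposite.opLinearEquiv K).symm.toLinearMap)
      (fun _ => isConv_conv I χ LinearMap.id) χ.toLinearMap (fun x y => by
        simp [unop_compAntipode]) u
    simpa using this
  right_inv u := by
    have := sum_conv_conv_of_mul_antipode I (l := Unit) _ _ _ _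
      (fun _ => isConv_conv I χ LinearMap.id)
      (fun _ => isConv_conv I (compAntipode I χ) (MulOpposite.opLinearEquiv K).symm.toLinearMap)
      χ.toLinearMap (fun x y => by
        simp [unop_compAntipode]) u
    simpa using this
  map_mul' u v := by
    simpa using conv_mul I χ LinearMap.id (l := Unit) (fun _ => LinearMap.id)
      (fun _ => LinearMap.id) (fun x y => by simp) u v
  map_add' u v := map_add _ u v

/-- Together with the value for the inverse, this lets the winding automorphism turn ε into χ on a
resolved module, and χ∘S back into ε on the cohomology of the dual. -/
theorem counit_windingEquiv [IsHausdorff I K] (χ : B →ₐ[K] K) (u : B) :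
    TopHopfAlgebra.counit I (windingEquiv I χ u) = χ u :=
  counit_eq_of_isConv I (isConv_conv I χ LinearMap.id u)

theorem counit_windingEquiv_symm [IsHausdorff I K] (χ : B →ₐ[K] K) (u : B) :
    TopHopfAlgebra.counit I ((windingEquiv I χ).symm u) = χ (antipodeLin I B u) :=
  counit_eq_of_isConv I (isConv_conv I (compAntipode I χ)
    (MulOpposite.opLinearEquiv K).symm.toLinearMap u)

end Convolution

/-! ### Torsion-free, separated and complete modules over power series, and successive
approximation. -/

section Formal

variable {k : Type*} [Field k]

/-- A module over `k⟦X⟧` which is `X`-torsion free, `X`-adically separated and `X`-adically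
complete. -/
structure IsFormal (k : Type*) [Field k] (M : Type*) [AddCommGroup M] [Module k⟦X⟧ M] :
    Prop where
  eq_zero_of_smul (m : M) : (PowerSeries.X : k⟦X⟧) • m = 0 → m = 0
  eq_zero_of_forall (m : M) : (∀ n : ℕ, ∃ r : M, m = (PowerSeries.X : k⟦X⟧) ^ n • r) → m = 0
  exists_sum (m : ℕ → M) : ∃ s : M, ∀ n, ∃ r : M,
    s = ∑ i ∈ Finset.range n, (PowerSeries.X : k⟦X⟧) ^ i • m i + (PowerSeries.X : k⟦X⟧) ^ n • r

/-- On coefficient sequences X acts as the shift, so an infinite sum ∑ X^i m_i has only finitely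
many contributions to each coefficient. -/
theorem IsFormal.of_equiv {M M₀ : Type*} [AddCommGroup M] [Module k⟦X⟧ M] [AddCommGroup M₀]
    (e : M ≃+ (ℕ → M₀)) (h0 : ∀ m, e ((PowerSeries.X : k⟦X⟧) • m) 0 = 0)
    (hs : ∀ m n, e ((PowerSeries.X : k⟦X⟧) • m) (n + 1) = e m n) : IsFormal k M := by
  have hpow : ∀ i m n, e ((PowerSeries.X : k⟦X⟧) ^ i • m) n =
      if i ≤ n then e m (n - i) else 0 := by
    intro i
    induction i with
    | zero => simp
    | succ i ih =>
      intro m n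
      rw [pow_succ', mul_smul]
      rcases n with _ | n
      · simp [h0]
      · rw [hs, ih]
        simp
  refine ⟨fun m hm => ?_, fun m hm => ?_, fun m => ?_⟩
  · refine e.map_eq_zero_iff.1 (funext fun n => ?_)
    rw [← hs, hm, map_zero]
    rfl
  · refine e.map_eq_zero_iff.1 (funext fun n => ?_)
    obtain ⟨r, hr⟩ := hm (n + 1)
    rw [hr, hpow, if_neg (by omega)]
    rfl
  · refine ⟨e.symm fun n => ∑ i ∈ Finset.range (n + 1), e (m i) (n - i), fun n => ?_⟩
    set s := e.symm fun n => ∑ i ∈ Finset.range (n + 1), e (m i) (n - i) with hsdef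
    set t := ∑ i ∈ Finset.range n, (PowerSeries.X : k⟦X⟧) ^ i • m i with ht
    have hlt : ∀ j < n, e (s - t) j = 0 := by
      intro j hj
      rw [map_sub, Pi.sub_apply, sub_eq_zero, hsdef, e.apply_symm_apply, ht, map_sum,
        Finset.sum_apply]
      simp only [hpow]
      rw [← Finset.sum_filter]
      refine Finset.sum_congr ?_ fun _ _ => rfl
      ext i
      simp
      omega
    refine ⟨e.symm fun j => e (s - t) (j + n), ?_⟩
    rw [← sub_eq_iff_eq_add']
    refine e.injective (funext fun j => ?_)
    rw [hpow, e.apply_symm_apply]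
    split_ifs with hj
    · rw [Nat.sub_add_cancel hj]
    · exact hlt j (by omega)

theorem isFormal_powerSeries : IsFormal k k⟦X⟧ := by
  refine IsFormal.of_equiv (M₀ := k)
    { toFun := fun f n => PowerSeries.coeff n f
      invFun := PowerSeries.mk
      left_inv := fun f => by ext; simp
      right_inv := fun f => by ext; simp
      map_add' := fun f g => by ext; simp } (fun m => ?_) (fun m n => ?_)
  · simp
  · exact PowerSeries.coeff_succ_X_mul n m

theorem IsFormal.pi {M : Type*} [AddCommGroup M] [Module k⟦X⟧ M] (h : IsFormal k M)
    (ι : Type*) : IsFormal k (ι → M) := by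
  refine ⟨fun m hm => funext fun i => h.eq_zero_of_smul _ (congrFun hm i),
    fun m hm => funext fun i => h.eq_zero_of_forall _ fun n => ?_, fun m => ?_⟩
  · obtain ⟨r, hr⟩ := hm n
    exact ⟨r i, congrFun hr i⟩
  · choose s r hr using fun i => h.exists_sum fun n => m n i
    refine ⟨s, fun n => ⟨fun i => r i n, funext fun i => ?_⟩⟩
    rw [hr i n]
    simp

theorem IsFormal.prod {M N : Type*} [AddCommGroup M] [Module k⟦X⟧ M] (hM : IsFormal k M)
    [AddCommGroup N] [Module k⟦X⟧ N] (hN : IsFormal k N) : IsFormal k (M × N) := by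
  refine ⟨fun m hm => Prod.ext (hM.eq_zero_of_smul _ (congrArg Prod.fst hm))
    (hN.eq_zero_of_smul _ (congrArg Prod.snd hm)),
    fun m hm => Prod.ext (hM.eq_zero_of_forall _ fun n => ?_)
      (hN.eq_zero_of_forall _ fun n => ?_), fun m => ?_⟩
  · obtain ⟨r, hr⟩ := hm n
    exact ⟨r.1, congrArg Prod.fst hr⟩
  · obtain ⟨r, hr⟩ := hm n
    exact ⟨r.2, congrArg Prod.snd hr⟩
  · obtain ⟨s, hs⟩ := hM.exists_sum fun n => (m n).1
    obtain ⟨t, ht⟩ := hN.exists_sum fun n => (m n).2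
    choose r hr using hs
    choose q hq using ht
    refine ⟨(s, t), fun n => ⟨(r n, q n), Prod.ext ?_ ?_⟩⟩
    · rw [hr n]
      simp [Prod.fst_sum]
    · rw [hq n]
      simp [Prod.snd_sum]

theorem IsFormal.isHausdorff {M : Type*} [AddCommGroup M] [Module k⟦X⟧ M] (h : IsFormal k M) :
    IsHausdorff (hIdeal k) M := by
  refine ⟨fun m hm => h.eq_zero_of_forall m fun n => ?_⟩
  have := hm n
  rw [SModEq.sub_mem, sub_zero, Ideal.span_singleton_pow,
    Submodule.ideal_span_singleton_smul] at this
  obtain ⟨r, -, hr⟩ := (Submodule.mem_smul_pointwise_iff_exists _ _ _).1 this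
  exact ⟨r, hr.symm⟩

/-- Successive approximation. -/
theorem IsFormal.exists_apply_eq {P Q : Type*} [AddCommGroup P] [Module k⟦X⟧ P] [AddCommGroup Q]
    [Module k⟦X⟧ Q] (hP : IsFormal k P) (hQ : IsFormal k Q) (f : P →ₗ[k⟦X⟧] Q) (N : Set Q)
    (h : ∀ x ∈ N, ∃ p, ∃ y ∈ N, x = f p + (PowerSeries.X : k⟦X⟧) • y) (x : Q) (hx : x ∈ N) :
    ∃ p, f p = x := by
  choose p y hy hpy using h
  let step : N → N := fun w => ⟨y w.1 w.2, hy w.1 w.2⟩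
  let z : ℕ → N := fun n => step^[n] ⟨x, hx⟩
  have hz : ∀ n, (z n).1 = f (p (z n).1 (z n).2) + (PowerSeries.X : k⟦X⟧) • (z (n + 1)).1 := by
    intro n
    simp only [z, Function.iterate_succ_apply']
    exact hpy _ _
  -- Iterating the correction writes x as the image of a partial sum plus X^n times a remainder. The
  -- series converges in P, and separatedness of Q removes the remainder.
  have key : ∀ n, x = f (∑ i ∈ Finset.range n, (PowerSeries.X : k⟦X⟧) ^ i • p (z i).1 (z i).2) +
      (PowerSeries.X : k⟦X⟧) ^ n • (z n).1 := by
    intro n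
    induction n with
    | zero => simp [z]
    | succ n ih =>
      rw [Finset.sum_range_succ, map_add, add_assoc, map_smul, pow_succ, mul_smul, ← smul_add,
        ← hz]
      exact ih
  obtain ⟨s, hs⟩ := hP.exists_sum fun n => p (z n).1 (z n).2
  refine ⟨s, (sub_eq_zero.1 (hQ.eq_zero_of_forall _ fun n => ?_)).symm⟩
  obtain ⟨r, hr⟩ := hs n
  refine ⟨(z n).1 - f r, ?_⟩
  conv_lhs => rw [key n]
  rw [hr, map_add, map_smul, smul_sub]
  abel

end Formal

/-! ### Finite free resolutions over a deformation of a noetherian Hopf algebra. -/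

section Deformation

variable {k : Type u} [Field k] {B B₀ : Type u} [Ring B] [Algebra k⟦X⟧ B]
  [TopHopfAlgebra (hIdeal k) B] [Ring B₀] [HopfAlgebra k B₀] (δ : HopfDeformation k B B₀)

namespace HopfDeformation

include δ

theorem isFormal : IsFormal k B := by
  obtain ⟨e, he⟩ := δ.exists_equiv
  refine IsFormal.of_equiv e (fun m => ?_) (fun m n => ?_)
  · simp [he]
  · rw [he, Finset.Nat.antidiagonal_succ]
    rw [Finset.sum_cons, Finset.sum_map]
    simp only [PowerSeries.coeff_zero_X, zero_smul, zero_add]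
    rw [Finset.sum_eq_single (0, n)]
    · simp
    · rintro ⟨i, j⟩ hij hne
      have : i ≠ 0 := by
        rintro rfl
        simp_all
      simp [PowerSeries.coeff_X, this]
    · simp

variable {ι κ : Type}

theorem exists_lift (x : ι → B₀) : ∃ y : ι → B, δ.toRingHom ∘ y = x := by
  choose y hy using fun i => δ.surjective (x i)
  exact ⟨y, funext hy⟩

theorem comp_eq_zero_iff (x : ι → B) :
    δ.toRingHom ∘ x = 0 ↔ ∃ y : ι → B, x = (PowerSeries.X : k⟦X⟧) • y := by
  constructor
  · intro h
    choose y hy using fun i => (δ.map_eq_zero_iff (x i)).1 (congrFun h i)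
    exact ⟨y, funext hy⟩
  · rintro ⟨y, rfl⟩
    exact funext fun i => (δ.map_eq_zero_iff _).2 ⟨y i, rfl⟩

theorem comp_eq_comp_iff (x x' : ι → B) :
    δ.toRingHom ∘ x = δ.toRingHom ∘ x' ↔
      ∃ y : ι → B, x = x' + (PowerSeries.X : k⟦X⟧) • y := by
  have : δ.toRingHom ∘ (x - x') = δ.toRingHom ∘ x - δ.toRingHom ∘ x' :=
    funext fun i => map_sub _ _ _
  rw [← sub_eq_zero, ← this, comp_eq_zero_iff]
  simp only [sub_eq_iff_eq_add']

theorem comp_vecMul [Fintype κ] (x : κ → B) (D : Matrix κ ι B) :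
    δ.toRingHom ∘ (x ᵥ* D) = (δ.toRingHom ∘ x) ᵥ* D.map δ.toRingHom := by
  funext i
  simp [Matrix.vecMul, dotProduct]

theorem comp_matAct [Fintype ι] (D : Matrix κ ι B) (x : ι → B) :
    δ.toRingHom ∘ (matAct k⟦X⟧ D B x) =
      matAct k (D.map δ.toRingHom) B₀ (δ.toRingHom ∘ x) := by
  funext i
  simp [matAct_apply]

/-- A finite presentation of the kernel of a homomorphism with saturated kernel. -/
theorem exists_matrix [IsNoetherianRing B₀] {m : ℕ} {M : Type*} [AddCommGroup M] [Module B M]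
    (g : (Fin m → B) →ₗ[B] M)
    (hg : ∀ y, g ((PowerSeries.X : k⟦X⟧) • y) = 0 → g y = 0) :
    ∃ (t : ℕ) (D : Matrix (Fin t) (Fin m) B), ∀ x, g x = 0 ↔ ∃ y, y ᵥ* D = x := by
  -- The reduction of the kernel of g. It is finitely generated over B₀, with generators that lift
  -- into the kernel by construction.
  let N₀ : Submodule B₀ (Fin m → B₀) :=
    { carrier := {x | ∃ y, g y = 0 ∧ δ.toRingHom ∘ y = x}
      zero_mem' := ⟨0, map_zero g, funext fun _ => map_zero _⟩
      add_mem' := by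
        rintro _ _ ⟨y, hy, rfl⟩ ⟨z, hz, rfl⟩
        exact ⟨y + z, by rw [map_add, hy, hz, add_zero], funext fun _ => map_add _ _ _⟩
      smul_mem' := by
        rintro c _ ⟨y, hy, rfl⟩
        obtain ⟨b, rfl⟩ := δ.surjective c
        exact ⟨b • y, by rw [g.map_smul, hy, smul_zero], funext fun _ => map_mul _ _ _⟩ }
  obtain ⟨t, s, hs⟩ := Submodule.fg_iff_exists_fin_generating_family.1
    (IsNoetherian.noetherian N₀)
  have hmem : ∀ i, ∃ y, g y = 0 ∧ δ.toRingHom ∘ y = s i := fun i => by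
    have : s i ∈ N₀ := hs ▸ Submodule.subset_span ⟨i, rfl⟩
    exact this
  choose D hD hDs using hmem
  have hgD : ∀ y : Fin t → B, g (y ᵥ* (Matrix.of D)) = 0 := by
    intro y
    have : y ᵥ* (Matrix.of D) = ∑ i, y i • D i := by
      funext j
      simp [Matrix.vecMul, dotProduct]
    rw [this, map_sum]
    simp [hD]
  refine ⟨t, Matrix.of D, fun x => ⟨fun hx => ?_, ?_⟩⟩
  · refine (δ.isFormal.pi (Fin t)).exists_apply_eq (δ.isFormal.pi (Fin m))
      { toFun := fun y => y ᵥ* (Matrix.of D)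
        map_add' := fun y z => Matrix.add_vecMul _ _ _
        map_smul' := fun c y => Matrix.smul_vecMul _ _ _ } {x | g x = 0} (fun x hx => ?_) x hx
    have hx₀ : δ.toRingHom ∘ x ∈ N₀ := ⟨x, hx, rfl⟩
    rw [← hs, Submodule.mem_span_range_iff_exists_fun] at hx₀
    obtain ⟨c, hc⟩ := hx₀
    obtain ⟨p, rfl⟩ := δ.exists_lift c
    have : δ.toRingHom ∘ x = δ.toRingHom ∘ (p ᵥ* (Matrix.of D)) := by
      rw [← hc, comp_vecMul]
      funext j
      simp [Matrix.vecMul, dotProduct, ← hDs]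
    obtain ⟨y, hy⟩ := (δ.comp_eq_comp_iff _ _).1 this
    -- Saturation keeps the remainder in the kernel, so the approximation can continue.
    refine ⟨p, y, hg y ?_, hy⟩
    have hx' : g x = 0 := hx
    rwa [hy, map_add, hgD, zero_add] at hx'
  · rintro ⟨y, rfl⟩
    exact hgD y

/-- Iteration of `exists_matrix`. Later kernels are saturated because their ambient targets are
torsion free, so only the augmentation needs a hypothesis. The recursion carries the two ranks along
with the current matrix. -/
theorem exists_isMatRes_of_aug [IsNoetherianRing B₀] {M : Type*} [AddCommGroup M] [Module B M]
    {m : ℕ} (aug : (Fin m → B) →ₗ[B] M) (hs : Function.Surjective aug)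
    (haug : ∀ y, aug ((PowerSeries.X : k⟦X⟧) • y) = 0 → aug y = 0) :
    ∃ (r : ℕ → ℕ) (D : ∀ n, Matrix (Fin (r (n + 1))) (Fin (r n)) B)
      (aug : (Fin (r 0) → B) →ₗ[B] M), IsMatRes (ι := fun n => Fin (r n)) D aug := by
  obtain ⟨t₀, D₀, hD₀⟩ := δ.exists_matrix aug haug
  have hnext : ∀ s : (Σ m t : ℕ, Matrix (Fin t) (Fin m) B),
      ∃ (t : ℕ) (D : Matrix (Fin t) (Fin s.2.1) B), ∀ x, x ᵥ* s.2.2 = 0 ↔ ∃ y, y ᵥ* D = x :=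
    fun s => δ.exists_matrix s.2.2.vecMulLinear fun y hy => by
      refine (δ.isFormal.pi (Fin s.1)).eq_zero_of_smul _ ?_
      rw [Matrix.vecMulLinear_apply] at hy ⊢
      rw [← hy, Matrix.smul_vecMul]
  choose t D hD using hnext
  let S : ℕ → (Σ m t : ℕ, Matrix (Fin t) (Fin m) B) := fun n =>
    Nat.rec ⟨m, t₀, D₀⟩ (fun _ s => ⟨s.2.1, t s, D s⟩) n
  exact ⟨fun n => (S n).1, fun n => (S n).2.2, aug, hs, hD₀, fun n => hD (S n)⟩

end HopfDeformation

end Deformation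

/-! ### Lifting cohomology from the reduction modulo X. -/

section FormalComplex

variable {k : Type*} [Field k] {M : ℕ → Type*} [∀ n, AddCommGroup (M n)]
  [∀ n, Module k⟦X⟧ (M n)] {M₀ : ℕ → Type*} [∀ n, AddCommGroup (M₀ n)] [∀ n, Module k (M₀ n)]

theorem boundaries_le_ker {R : Type*} [Ring R] {X : ℕ → Type*} [∀ n, AddCommGroup (X n)]
    [∀ n, Module R (X n)] {d : ∀ n, X n →ₗ[R] X (n + 1)}
    (hd : ∀ n x, d (n + 1) (d n x) = 0) {n : ℕ} {x : X n} (hx : x ∈ boundaries d n) :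
    d n x = 0 := by
  rcases n with _ | n
  · rw [(Submodule.mem_bot R).1 hx, map_zero]
  · obtain ⟨y, rfl⟩ := hx
    exact hd n y

/-- Degree 0 is covered by the zero map, so that successive approximation treats all degrees alike.
-/
theorem exists_range_eq_boundaries {R : Type*} [Ring R] {X : ℕ → Type*}
    [∀ n, AddCommGroup (X n)] [∀ n, Module R (X n)] (d : ∀ n, X n →ₗ[R] X (n + 1)) (n : ℕ) :
    ∃ (m : ℕ) (f : X m →ₗ[R] X n), ∀ x, x ∈ boundaries d n ↔ ∃ p, f p = x := by
  rcases n with _ | n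
  · exact ⟨0, 0, fun x => by simp [boundaries, eq_comm]⟩
  · exact ⟨n, d n, fun x => Iff.rfl⟩

/-- A complex of formal modules together with its reduction modulo `X`. -/
structure IsFormalComplex (d : ∀ n, M n →ₗ[k⟦X⟧] M (n + 1)) (d₀ : ∀ n, M₀ n →ₗ[k] M₀ (n + 1))
    (r : ∀ n, M n →ₛₗ[PowerSeries.constantCoeff (R := k)] M₀ n) : Prop where
  isFormal (n : ℕ) : IsFormal k (M n)
  comp_eq_zero (n : ℕ) (x : M n) : d (n + 1) (d n x) = 0
  surjective (n : ℕ) : Function.Surjective (r n)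
  eq_zero_iff (n : ℕ) (x : M n) : r n x = 0 ↔ ∃ y : M n, x = (PowerSeries.X : k⟦X⟧) • y
  comm (n : ℕ) (x : M n) : r (n + 1) (d n x) = d₀ n (r n x)

namespace IsFormalComplex

variable {d : ∀ n, M n →ₗ[k⟦X⟧] M (n + 1)} {d₀ : ∀ n, M₀ n →ₗ[k] M₀ (n + 1)}
  {r : ∀ n, M n →ₛₗ[PowerSeries.constantCoeff (R := k)] M₀ n} (h : IsFormalComplex d d₀ r)

include h

theorem exists_boundary_add {n : ℕ} {x : M n} (hx : r n x ∈ boundaries d₀ n) :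
    ∃ p ∈ boundaries d n, ∃ y : M n, x = p + (PowerSeries.X : k⟦X⟧) • y := by
  rcases n with _ | n
  · obtain ⟨y, hy⟩ := (h.eq_zero_iff 0 x).1 ((Submodule.mem_bot k).1 hx)
    exact ⟨0, Submodule.zero_mem _, y, by rw [zero_add, hy]⟩
  · obtain ⟨p, hp⟩ := hx
    obtain ⟨p, rfl⟩ := h.surjective n p
    obtain ⟨y, hy⟩ := (h.eq_zero_iff (n + 1) (x - d n p)).1 (by
      rw [map_sub, h.comm, hp, sub_self])
    exact ⟨d n p, ⟨p, rfl⟩, y, by rw [← hy, add_sub_cancel]⟩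

theorem apply_eq_zero_of_smul {n : ℕ} {y : M n} (hy : d n ((PowerSeries.X : k⟦X⟧) • y) = 0) :
    d n y = 0 :=
  (h.isFormal _).eq_zero_of_smul _ (by rw [← map_smul, hy])

/-- Exactness of the reduction writes a cocycle as a boundary plus X y, and y is again a cocycle
because there is no torsion; now approximate successively. -/
theorem exact {n : ℕ} (hn : ∀ x, d₀ n x = 0 → x ∈ boundaries d₀ n) (x : M n)
    (hx : d n x = 0) : x ∈ boundaries d n := by
  obtain ⟨m, f, hf⟩ := exists_range_eq_boundaries d n
  rw [hf]
  refine (h.isFormal m).exists_apply_eq (h.isFormal n) f {x | d n x = 0} (fun x hx => ?_) x hx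
  obtain ⟨p, hp, y, hy⟩ := h.exists_boundary_add (hn (r n x) (by
    rw [← h.comm, show d n x = 0 from hx, map_zero]))
  obtain ⟨q, rfl⟩ := (hf p).1 hp
  refine ⟨q, y, h.apply_eq_zero_of_smul ?_, hy⟩
  have hx' : d n x = 0 := hx
  rwa [hy, map_add, boundaries_le_ker h.comp_eq_zero hp, zero_add] at hx'

/-- If X y = d(p), then p reduces to a cocycle; exactness one degree lower gives p = b + X q with b
a boundary, whence y = d(q). So the cohomology in degree n has no X-torsion. -/
theorem mem_boundaries_of_smul {n : ℕ}
    (hn : ∀ m, m + 1 = n → ∀ x, d₀ m x = 0 → x ∈ boundaries d₀ m) {y : M n}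
    (hy : (PowerSeries.X : k⟦X⟧) • y ∈ boundaries d n) : y ∈ boundaries d n := by
  rcases n with _ | n
  · exact (Submodule.mem_bot _).2 ((h.isFormal 0).eq_zero_of_smul _ ((Submodule.mem_bot _).1 hy))
  · obtain ⟨p, hp⟩ := hy
    obtain ⟨b, hb, q, rfl⟩ := h.exists_boundary_add (hn n rfl (r n p) (by
      rw [← h.comm, hp]
      exact (h.eq_zero_iff _ _).2 ⟨y, rfl⟩))
    refine ⟨q, sub_eq_zero.1 ((h.isFormal _).eq_zero_of_smul _ ?_)⟩
    rw [smul_sub, ← hp, map_add, boundaries_le_ker h.comp_eq_zero hb, map_smul, zero_add,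
      sub_self]

/-- A generator of the reduced cohomology lifts to a cocycle ω by exactness in degree e + 1. The
class of ω is free because exactness in degree e - 1 excludes torsion, and it generates by
successive approximation. -/
theorem nonempty_cohomology_equiv {e : ℕ}
    (hex : ∀ n, n ≠ e → ∀ x, d₀ n x = 0 → x ∈ boundaries d₀ n)
    {π₀ : LinearMap.ker (d₀ e) →ₗ[k] k} (hπ₀ : IsCohomology d₀ e π₀) :
    Nonempty (Cohomology d e ≃ₗ[k⟦X⟧] k⟦X⟧) := by
  have hlift : ∀ z : M₀ e, d₀ e z = 0 → ∃ x, d e x = 0 ∧ r e x = z := by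
    intro z hz
    obtain ⟨x, rfl⟩ := h.surjective e z
    obtain ⟨w, hw⟩ := (h.eq_zero_iff _ (d e x)).1 (by rw [h.comm, hz])
    have hw0 : d (e + 1) w = 0 := h.apply_eq_zero_of_smul (by rw [← hw, h.comp_eq_zero])
    obtain ⟨v, rfl⟩ := h.exact (hex (e + 1) (by omega)) w hw0
    refine ⟨x - (PowerSeries.X : k⟦X⟧) • v, by rw [map_sub, map_smul, hw, sub_self], ?_⟩
    rw [map_sub, (h.eq_zero_iff e _).2 ⟨v, rfl⟩, sub_zero]
  obtain ⟨⟨ω₀, hω₀⟩, hπω⟩ := hπ₀.surjective 1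
  obtain ⟨ω, hω, rfl⟩ := hlift ω₀ hω₀
  have hker : ∀ x, d e x = 0 → d₀ e (r e x) = 0 := fun x hx => by rw [← h.comm, hx, map_zero]
  let mk : LinearMap.ker (d e) →ₗ[k⟦X⟧] Cohomology d e := Submodule.mkQ _
  have hmk : ∀ x, mk x = 0 ↔ (x : M e) ∈ boundaries d e := fun x =>
    (Submodule.Quotient.mk_eq_zero _).trans Iff.rfl
  refine ⟨(LinearEquiv.ofBijective (LinearMap.toSpanSingleton k⟦X⟧ (Cohomology d e)
    (mk ⟨ω, hω⟩)) ⟨?_, ?_⟩).symm⟩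
  · rw [injective_iff_map_eq_zero]
    intro c hc
    rw [LinearMap.toSpanSingleton_apply, ← map_smul, hmk] at hc
    -- If c ω is a boundary, so is its reduction, hence c has constant term 0 and a factor X can be
    -- cancelled. Repeating this puts c in every power of (X).
    have hdvd : ∀ c : k⟦X⟧, c • ω ∈ boundaries d e →
        ∃ c' : k⟦X⟧, c = PowerSeries.X * c' ∧ c' • ω ∈ boundaries d e := by
      intro c hc
      have hrb : r e (c • ω) ∈ boundaries d₀ e := by
        rcases e with _ | e
        · rw [(Submodule.mem_bot _).1 hc, map_zero]
          exact Submodule.zero_mem _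
        · obtain ⟨p, hp⟩ := hc
          rw [← hp, h.comm]
          exact ⟨_, rfl⟩
      have h0 := (hπ₀.eq_zero_iff ⟨_, hker (c • ω) (by rw [map_smul, hω, smul_zero])⟩).2 hrb
      have h1 : (⟨r e (c • ω), hker (c • ω) (by rw [map_smul, hω, smul_zero])⟩ :
          LinearMap.ker (d₀ e)) = PowerSeries.constantCoeff c • ⟨r e ω, hω₀⟩ :=
        Subtype.ext (map_smulₛₗ _ _ _)
      rw [h1, map_smul, hπω, smul_eq_mul, mul_one] at h0
      obtain ⟨c', rfl⟩ := PowerSeries.X_dvd_iff.2 h0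
      refine ⟨c', rfl, h.mem_boundaries_of_smul (fun m hm => hex m (by omega)) ?_⟩
      rwa [smul_smul]
    have hall : ∀ n : ℕ, ∃ c' : k⟦X⟧, c = PowerSeries.X ^ n * c' ∧ c' • ω ∈ boundaries d e := by
      intro n
      induction n with
      | zero => exact ⟨c, by simp, hc⟩
      | succ n ih =>
        obtain ⟨c', hc', hb⟩ := ih
        obtain ⟨c'', hc'', hb'⟩ := hdvd c' hb
        exact ⟨c'', by rw [hc', hc'', pow_succ, mul_assoc], hb'⟩
    exact isFormal_powerSeries.eq_zero_of_forall c fun n =>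
      let ⟨c', hc', _⟩ := hall n
      ⟨c', hc'⟩
  · intro z
    obtain ⟨⟨x, hx⟩, rfl⟩ := Submodule.mkQ_surjective _ z
    obtain ⟨m, f, hf⟩ := exists_range_eq_boundaries d e
    -- Approximate x by c ω plus a boundary. At each stage `π₀` supplies the next coefficient of c.
    obtain ⟨⟨c, p⟩, hcp⟩ := (isFormal_powerSeries.prod (h.isFormal m)).exists_apply_eq
      (h.isFormal e) ((LinearMap.toSpanSingleton k⟦X⟧ (M e) ω).coprod f) {x | d e x = 0}
      (fun x hx => by
        have hx' : d e x = 0 := hx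
        set a := π₀ ⟨r e x, hker x hx⟩ with ha
        have hdx : d e (x - PowerSeries.C a • ω) = 0 := by
          rw [map_sub, map_smul, hω, hx', smul_zero, sub_zero]
        have hb := (hπ₀.eq_zero_iff ⟨r e (x - PowerSeries.C a • ω), hker _ hdx⟩).1 (by
          have h1 : (⟨r e (x - PowerSeries.C a • ω), hker _ hdx⟩ :
              LinearMap.ker (d₀ e)) = ⟨r e x, hker x hx⟩ - a • ⟨r e ω, hω₀⟩ :=
            Subtype.ext (by simp [map_smulₛₗ])
          rw [h1, map_sub, map_smul, hπω, ← ha, smul_eq_mul, mul_one, sub_self])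
        obtain ⟨p, hp, y, hy⟩ := h.exists_boundary_add hb
        obtain ⟨q, rfl⟩ := (hf p).1 hp
        refine ⟨(PowerSeries.C a, q), y, h.apply_eq_zero_of_smul ?_, ?_⟩
        · rwa [hy, map_add, boundaries_le_ker h.comp_eq_zero hp, zero_add] at hdx
        · rw [LinearMap.coprod_apply, LinearMap.toSpanSingleton_apply, add_assoc, ← hy,
            add_sub_cancel]) x hx
    refine ⟨c, ?_⟩
    rw [LinearMap.toSpanSingleton_apply, ← map_smul, ← sub_eq_zero]
    change mk _ - mk ⟨x, hx⟩ = 0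
    rw [← map_sub, hmk]
    refine (hf _).2 ⟨-p, ?_⟩
    rw [map_neg]
    change - f p = c • ω - x
    rw [← hcp]
    simp

end IsFormalComplex

end FormalComplex

/-! ### Reduction modulo h of a resolution of the trivial module. -/

section Reduction

variable {k : Type u} [Field k] {B B₀ : Type u} [Ring B] [Algebra k⟦X⟧ B]
  [TopHopfAlgebra (hIdeal k) B] [Ring B₀] [HopfAlgebra k B₀] (δ : HopfDeformation k B B₀)

namespace HopfDeformation

include δ

/-- The hypothesis `hs` says that the image of D is saturated, so its cokernel has no X-torsion;
this is what exactness needs in order to survive modulo X. -/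
theorem vecMul_map_eq_zero_iff {ι κ μ : Type} [Fintype ι] [Fintype κ] [Fintype μ]
    (D : Matrix κ ι B) (D' : Matrix μ κ B) (hD : ∀ x, x ᵥ* D = 0 ↔ ∃ y, y ᵥ* D' = x)
    (hs : ∀ x y, x ᵥ* D = (PowerSeries.X : k⟦X⟧) • y → ∃ z, z ᵥ* D = y) (x : κ → B₀) :
    x ᵥ* D.map δ.toRingHom = 0 ↔ ∃ y, y ᵥ* D'.map δ.toRingHom = x := by
  constructor
  · obtain ⟨x, rfl⟩ := δ.exists_lift x
    intro hx
    rw [← comp_vecMul, comp_eq_zero_iff] at hx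
    obtain ⟨y, hy⟩ := hx
    obtain ⟨z, rfl⟩ := hs x y hy
    obtain ⟨w, hw⟩ := (hD (x - (PowerSeries.X : k⟦X⟧) • z)).1 (by
      rw [Matrix.sub_vecMul, hy, Matrix.smul_vecMul, sub_self])
    refine ⟨δ.toRingHom ∘ w, ?_⟩
    rw [← comp_vecMul, hw, eq_comm, comp_eq_comp_iff]
    exact ⟨z, by rw [sub_add_cancel]⟩
  · rintro ⟨y, rfl⟩
    obtain ⟨y, rfl⟩ := δ.exists_lift y
    rw [← comp_vecMul, ← comp_vecMul, (hD _).2 ⟨y, rfl⟩]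
    exact funext fun _ => map_zero _

/-- The image of each differential is the kernel of the next map, whose target is torsion free.
Images are therefore saturated, and the complex stays exact modulo X. -/
theorem _root_.HopfDuality.IsMatRes.reduction {ι : ℕ → Type} [∀ n, Fintype (ι n)]
    {D : ∀ n, Matrix (ι (n + 1)) (ι n) B}
    {aug : (ι 0 → B) →ₗ[B] trivialModule (TopHopfAlgebra.counit (hIdeal k) (A := B))}
    (h : IsMatRes D aug) :
    ∃ aug₀ : (ι 0 → B₀) →ₗ[B₀] trivialModule (Bialgebra.counitAlgHom k B₀),
      IsMatRes (fun n => (D n).map δ.toRingHom) aug₀ := by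
  classical
  -- The values of the augmentation are read as power series, so that divisibility by X can be used.
  let ε : (ι 0 → B) → k⟦X⟧ := aug
  have hε0 : ∀ x, aug x = 0 ↔ ε x = 0 := fun _ => Iff.rfl
  have hεX : ∀ c : k⟦X⟧, ∀ x, ε (c • x) = c * ε x := by
    intro c x
    rw [show c • x = algebraMap k⟦X⟧ B c • x from (algebraMap_smul B c x).symm]
    refine (aug.map_smul _ _).trans ?_
    change TopHopfAlgebra.counit (hIdeal k) (algebraMap k⟦X⟧ B c) * ε x = _
    rw [AlgHom.commutes]
    rfl
  have hεsub : ∀ x y, ε (x - y) = ε x - ε y := fun x y => aug.map_sub x y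
  have hε : ∀ x, ε x = ∑ i, TopHopfAlgebra.counit (hIdeal k) (x i) * ε (Pi.single i 1) := by
    intro x
    exact (DFunLike.congr_fun (linearCombination_eq_of_apply_single aug) x).symm
  let aug₀ : (ι 0 → B₀) →ₗ[B₀] trivialModule (Bialgebra.counitAlgHom k B₀) :=
    { toFun := fun x => (∑ i, Coalgebra.counit (R := k) (x i) *
        PowerSeries.constantCoeff (ε (Pi.single i 1)) : k)
      map_add' := fun x y => by
        simp only [Pi.add_apply, map_add, add_mul, Finset.sum_add_distrib]
        rfl
      map_smul' := fun b x => by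
        simp only [Pi.smul_apply, smul_eq_mul, Bialgebra.counit_mul, mul_assoc, ← Finset.mul_sum]
        rfl }
  let ε₀ : (ι 0 → B₀) → k := aug₀
  have hε₀0 : ∀ x, aug₀ x = 0 ↔ ε₀ x = 0 := fun _ => Iff.rfl
  have haug₀ : ∀ x : ι 0 → B, ε₀ (δ.toRingHom ∘ x) = PowerSeries.constantCoeff (ε x) := by
    intro x
    rw [hε, map_sum]
    change ∑ i, _ = _
    refine Finset.sum_congr rfl fun i _ => ?_
    rw [map_mul, ← δ.map_counit]
    rfl
  have hsat : ∀ y, aug ((PowerSeries.X : k⟦X⟧) • y) = 0 → aug y = 0 := by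
    intro y hy
    rw [hε0, hεX] at hy
    exact (mul_eq_zero.1 hy).resolve_left PowerSeries.X_ne_zero
  have hcomp : ∀ n x, (x ᵥ* D (n + 1)) ᵥ* D n = 0 := fun n x => (h.exact_succ n _).2 ⟨x, rfl⟩
  refine ⟨aug₀, fun c => ?_, fun x => ?_, fun n => ?_⟩
  · let c' : k := c
    obtain ⟨x, hx⟩ := h.surjective (PowerSeries.C c')
    refine ⟨δ.toRingHom ∘ x, (haug₀ x).trans ?_⟩
    rw [show ε x = PowerSeries.C c' from hx]
    exact PowerSeries.constantCoeff_C _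
  · constructor
    · obtain ⟨x, rfl⟩ := δ.exists_lift x
      intro hx
      rw [hε₀0, haug₀] at hx
      obtain ⟨c, hc⟩ := PowerSeries.X_dvd_iff.2 hx
      obtain ⟨z, hz⟩ := h.surjective c
      obtain ⟨w, hw⟩ := (h.exact_zero (x - (PowerSeries.X : k⟦X⟧) • z)).1 (by
        rw [hε0, hεsub, hεX, hc, show ε z = c from hz, sub_self])
      refine ⟨δ.toRingHom ∘ w, ?_⟩
      rw [← comp_vecMul, hw, eq_comm, comp_eq_comp_iff]
      exact ⟨z, by rw [sub_add_cancel]⟩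
    · rintro ⟨y, rfl⟩
      obtain ⟨y, rfl⟩ := δ.exists_lift y
      rw [← comp_vecMul, hε₀0, haug₀, show ε (y ᵥ* D 0) = 0 from (h.exact_zero _).2 ⟨y, rfl⟩,
        map_zero]
  · refine δ.vecMul_map_eq_zero_iff (D n) (D (n + 1)) (h.exact_succ n) fun x y hxy => ?_
    rcases n with _ | n
    · rw [← h.exact_zero]
      refine hsat y ?_
      rw [← hxy, h.exact_zero]
      exact ⟨x, rfl⟩
    · rw [← h.exact_succ]
      refine (δ.isFormal.pi _).eq_zero_of_smul _ ?_
      rw [← Matrix.smul_vecMul, ← hxy, hcomp]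

theorem exists_isMatRes [IsNoetherianRing B₀] :
    ∃ (r : ℕ → ℕ) (D : ∀ n, Matrix (Fin (r (n + 1))) (Fin (r n)) B)
      (aug : (Fin (r 0) → B) →ₗ[B] trivialModule (TopHopfAlgebra.counit (hIdeal k) (A := B))),
      IsMatRes (ι := fun n => Fin (r n)) D aug := by
  let ε := TopHopfAlgebra.counit (hIdeal k) (A := B)
  let aug : (Fin 1 → B) →ₗ[B] trivialModule ε :=
    { toFun := fun x => ε (x 0)
      map_add' := fun x y => map_add ε _ _
      map_smul' := fun b x => map_mul ε _ _ }
  refine δ.exists_isMatRes_of_aug aug (fun c => ⟨fun _ => algebraMap k⟦X⟧ B c, ?_⟩)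
    fun y hy => ?_
  · exact ε.commutes c
  · have hy' : ε ((PowerSeries.X : k⟦X⟧) • y 0) = 0 := hy
    rw [_root_.map_smul, smul_eq_mul] at hy'
    exact (mul_eq_zero.1 hy').resolve_left PowerSeries.X_ne_zero

end HopfDeformation

end Reduction

/-! ### The dual of the resolution of the trivial module, and the module Ω. -/

section DualizingModule

theorem IsMatRes.vecMul_vecMul {R : Type*} [Ring R] {ι : ℕ → Type} [∀ n, Fintype (ι n)]
    {D : ∀ n, Matrix (ι (n + 1)) (ι n) R} {M : Type*} [AddCommGroup M] [Module R M]
    {aug : (ι 0 → R) →ₗ[R] M} (h : IsMatRes D aug) (n : ℕ) (x : ι (n + 2) → R) :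
    (x ᵥ* D (n + 1)) ᵥ* D n = 0 :=
  (h.exact_succ n _).2 ⟨x, rfl⟩

theorem IsMatRes.matAct_matAct {R : Type*} [Ring R] {ι : ℕ → Type} [∀ n, Fintype (ι n)]
    {D : ∀ n, Matrix (ι (n + 1)) (ι n) R} {M : Type*} [AddCommGroup M] [Module R M]
    {aug : (ι 0 → R) →ₗ[R] M} (h : IsMatRes D aug) (L : Type*) [Semiring L] {N : Type*}
    [AddCommGroup N] [Module R N] [Module L N] [SMulCommClass R L N] (n : ℕ) (x : ι n → N) :
    matAct L (D (n + 1)) N (matAct L (D n) N x) = 0 := by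
  classical
  funext a
  have h1 := linearCombination_vecMul (D n) x (Pi.single a 1 ᵥ* D (n + 1))
  rw [h.vecMul_vecMul, map_zero, linearCombination_vecMul] at h1
  rw [Fintype.linearCombination_apply_single, one_smul] at h1
  exact h1.symm

/-- The right module `Ext^d (M, A)`. -/
def extRightModule (R : Type u) [CommRing R] {A : Type u} [Ring A] [Algebra R A]
    (M : ModuleCat.{u} A) (n : ℕ) : ModuleCat.{u} Aᵐᵒᵖ :=
  (ModuleCat.restrictScalars (extRightAction R M n).toRingHom).obj
    (ModuleCat.of (Module.End R (ExtReg R M n)) (ExtReg R M n))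

open Abelian

attribute [local instance] linearModuleCat

section OpMat

variable {R : Type*} [Ring R] {ι : ℕ → Type} [∀ n, Fintype (ι n)]
  (D : ∀ n, Matrix (ι (n + 1)) (ι n) R) (L : Type*) [Semiring L] [Module L R]
  [SMulCommClass R L R]

theorem rowComplex_opMat_apply (n : ℕ) (x : ι n → Rᵐᵒᵖ) :
    rowComplex (fun n => opMat (D n)) n x =
      MulOpposite.op ∘ matAct L (D n) R (MulOpposite.unop ∘ x) := by
  funext a
  refine MulOpposite.unop_injective ?_
  change (∑ b, x b * opMat (D n) b a).unop = ∑ b, D n a b * (x b).unop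
  rw [Finset.unop_sum]
  rfl

theorem rowComplex_opMat_eq_zero_iff (n : ℕ) (x : ι n → Rᵐᵒᵖ) :
    rowComplex (fun n => opMat (D n)) n x = 0 ↔
      matAct L (D n) R (MulOpposite.unop ∘ x) = 0 := by
  rw [rowComplex_opMat_apply D L]
  constructor
  · intro hx
    exact funext fun a => MulOpposite.op_injective (congrFun hx a)
  · intro hx
    rw [hx]
    rfl

end OpMat

theorem mem_boundaries_opMat_iff {R : Type*} [Ring R] {ι : ℕ → Type} [∀ n, Fintype (ι n)]
    (D : ∀ n, Matrix (ι (n + 1)) (ι n) R) (L : Type*) [Ring L] [Module L R]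
    [SMulCommClass R L R] (n : ℕ) (x : ι n → Rᵐᵒᵖ) :
    x ∈ boundaries (rowComplex fun n => opMat (D n)) n ↔
      MulOpposite.unop ∘ x ∈ boundaries (fun n => matAct L (D n) R) n := by
  rcases n with _ | n
  · simp only [boundaries, Submodule.mem_bot]
    constructor
    · rintro rfl
      rfl
    · intro h
      exact funext fun i => MulOpposite.unop_injective (congrFun h i)
  · constructor
    · rintro ⟨y, rfl⟩
      refine ⟨MulOpposite.unop ∘ y, ?_⟩
      rw [rowComplex_opMat_apply D L]
      rfl
    · rintro ⟨y, hy⟩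
      refine ⟨MulOpposite.op ∘ y, (rowComplex_opMat_apply D L n _).trans ?_⟩
      exact funext fun i => MulOpposite.unop_injective (congrFun hy i)

/-- The dual of a resolution computes `Ext (M, A)` as a right module. -/
theorem ExtPresentation.exists_isCohomology_opMat (R : Type u) [CommRing R] {A : Type u} [Ring A]
    [Algebra R A] {ι : ℕ → Type} [∀ n, Fintype (ι n)] {D : ∀ n, Matrix (ι (n + 1)) (ι n) A}
    {M : ModuleCat.{u} A} {n : ℕ} (P : ExtPresentation D M n) :
    ∃ π : LinearMap.ker (rowComplex (fun n => opMat (D n)) n) →ₗ[Aᵐᵒᵖ] extRightModule R M n,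
      IsCohomology (rowComplex fun n => opMat (D n)) n π := by
  let j (x : LinearMap.ker (rowComplex (fun n => opMat (D n)) n)) :
      LinearMap.ker (matAct ℤ (D n) (ModuleCat.of A A)) :=
    ⟨MulOpposite.unop ∘ x.1, (rowComplex_opMat_eq_zero_iff D ℤ n x.1).1 x.2⟩
  refine ⟨
    { toFun := fun x => P.toFun (ModuleCat.of A A) (j x)
      map_add' := fun x y => (P.toFun (ModuleCat.of A A)).map_add (j x) (j y)
      -- Right multiplication is an endomorphism of the left module `A`, so naturality of the
      -- presentation gives compatibility with the right action.
      map_smul' := fun c x => P.natural (rightMul c.unop) (j x) (j (c • x)) fun i => ?_ },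
    fun y => ?_, fun x => ?_⟩
  · rfl
  · obtain ⟨x, rfl⟩ := P.surjective (ModuleCat.of A A) y
    exact ⟨⟨MulOpposite.op ∘ x.1, (rowComplex_opMat_eq_zero_iff D ℤ n _).2 x.2⟩, rfl⟩
  · refine (P.eq_zero_iff (ModuleCat.of A A) (j x)).trans ?_
    exact (mem_boundaries_opMat_iff D ℤ n x.1).symm

/-- The cohomology of the dual of a resolution, as a module over the base ring. -/
theorem IsMatRes.nonempty_cohomology_equiv_extReg (R : Type u) [CommRing R] {A : Type u} [Ring A]
    [Algebra R A] {ι : ℕ → Type} [∀ n, Fintype (ι n)] {D : ∀ n, Matrix (ι (n + 1)) (ι n) A}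
    {M : ModuleCat.{u} A} {aug : (ι 0 → A) →ₗ[A] M} (h : IsMatRes D aug) (n : ℕ) :
    Nonempty (Cohomology (fun n => matAct R (D n) A) n ≃ₗ[R] ExtReg R M n) := by
  obtain ⟨P⟩ := h.nonempty_extPresentation n
  let : Module R (ModuleCat.of A A) := inferInstanceAs (Module R A)
  have : IsScalarTower R A (ModuleCat.of A A) := inferInstanceAs (IsScalarTower R A A)
  exact ⟨(P.isCohomology R (ModuleCat.of A A)).equiv⟩

namespace HopfDeformation

variable {k : Type u} [Field k] {B B₀ : Type u} [Ring B] [Algebra k⟦X⟧ B]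
  [TopHopfAlgebra (hIdeal k) B] [Ring B₀] [HopfAlgebra k B₀] (δ : HopfDeformation k B B₀)
  {d : ℕ} (hd : HasExtDim k B₀ d) {ι : ℕ → Type} [∀ n, Fintype (ι n)]
  {D : ∀ n, Matrix (ι (n + 1)) (ι n) B}
  {aug : (ι 0 → B) →ₗ[B] trivialModule (TopHopfAlgebra.counit (hIdeal k) (A := B))}
  (h : IsMatRes D aug)

include δ h

theorem isFormalComplex :
    IsFormalComplex (fun n => matAct k⟦X⟧ (D n) B)
      (fun n => matAct k ((D n).map δ.toRingHom) B₀)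
      (fun n => { toFun := fun x : ι n → B => δ.toRingHom ∘ x
                  map_add' := fun _ _ => funext fun _ => map_add _ _ _
                  map_smul' := fun c x => funext fun i => δ.map_smul c (x i) }) where
  isFormal _ := δ.isFormal.pi _
  comp_eq_zero n x := h.matAct_matAct _ n x
  surjective _ := δ.exists_lift
  eq_zero_iff _ x := δ.comp_eq_zero_iff x
  comm n x := δ.comp_matAct (D n) x

include hd

/-- The reduced matrices resolve k over B₀, so the cohomology of their dual is Ext of k with values
in B₀, which vanishes outside degree d. -/
theorem exact_reduction (n : ℕ) (hn : n ≠ d) (x : ι n → B₀)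
    (hx : matAct k ((D n).map δ.toRingHom) B₀ x = 0) :
    x ∈ boundaries (fun n => matAct k ((D n).map δ.toRingHom) B₀) n := by
  obtain ⟨aug₀, h₀⟩ := h.reduction δ
  obtain ⟨e⟩ := h₀.nonempty_cohomology_equiv_extReg k n
  have := hd.ext_eq_zero n hn
  have := e.toEquiv.subsingleton
  exact (Submodule.Quotient.mk_eq_zero (p := (boundaries (fun n => matAct k
    ((D n).map δ.toRingHom) B₀) n).submoduleOf _)
    (x := (⟨x, hx⟩ : LinearMap.ker (matAct k ((D n).map δ.toRingHom) B₀)))).1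
    (Subsingleton.elim _ _)

/-- The dual complex over `B` is formal, and its reduction has one-dimensional cohomology in degree
d and none elsewhere. -/
theorem nonempty_omega_equiv : Nonempty (Omega (hIdeal k) B d ≃ₗ[k⟦X⟧] k⟦X⟧) := by
  obtain ⟨aug₀, h₀⟩ := h.reduction δ
  obtain ⟨e⟩ := h₀.nonempty_cohomology_equiv_extReg k d
  obtain ⟨f⟩ := hd.ext_equiv
  obtain ⟨g⟩ := h.nonempty_cohomology_equiv_extReg k⟦X⟧ d
  obtain ⟨c⟩ := (δ.isFormalComplex h).nonempty_cohomology_equiv (δ.exact_reduction hd h)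
    (π₀ := (e.trans f).toLinearMap ∘ₗ Submodule.mkQ _)
    ⟨(e.trans f).surjective.comp (Submodule.mkQ_surjective _), fun x => by
      rw [LinearMap.comp_apply, LinearEquiv.coe_coe, LinearEquiv.map_eq_zero_iff,
        Submodule.mkQ_apply, Submodule.Quotient.mk_eq_zero]
      rfl⟩
  exact ⟨g.symm.trans c⟩

theorem concentrated_omega : Concentrated (rowComplex fun n => opMat (D n)) d
    (extRightModule k⟦X⟧ (trivialModule (TopHopfAlgebra.counit (hIdeal k) (A := B))) d) := by
  refine ⟨fun n x => ?_, fun n hn x hx => ?_, ?_⟩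
  · rw [rowComplex_opMat_eq_zero_iff D ℤ, rowComplex_opMat_apply D ℤ]
    exact h.matAct_matAct ℤ n _
  · rw [mem_boundaries_opMat_iff D k⟦X⟧]
    rw [rowComplex_opMat_eq_zero_iff D k⟦X⟧] at hx
    exact (δ.isFormalComplex h).exact (δ.exact_reduction hd h n hn) _ hx
  · obtain ⟨P⟩ := h.nonempty_extPresentation d
    exact P.exists_isCohomology_opMat k⟦X⟧

/-- The character through which a Hopf algebra acts on its dualizing module. -/
theorem exists_character : ∃ (χ : B →ₐ[k⟦X⟧] k⟦X⟧), ∀ (b : B) (ω : Omega (hIdeal k) B d),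
    extRightAction k⟦X⟧ (trivialModule (TopHopfAlgebra.counit (hIdeal k) (A := B))) d
      (MulOpposite.op b) ω = χ b • ω := by
  obtain ⟨e⟩ := δ.nonempty_omega_equiv hd h
  let ρ : Bᵐᵒᵖ →ₐ[k⟦X⟧] Module.End k⟦X⟧ (Omega (hIdeal k) B d) := extRightAction k⟦X⟧
    (trivialModule (TopHopfAlgebra.counit (hIdeal k) (A := B))) d
  -- Endomorphisms of a free module of rank one are scalars, read off here on a generator of Ω.
  let χ : B →ₗ[k⟦X⟧] k⟦X⟧ :=
    { toFun := fun b => e (ρ (MulOpposite.op b) (e.symm 1))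
      map_add' := fun b c => by simp
      map_smul' := fun c b => by simp }
  have hχ : ∀ b ω, ρ (MulOpposite.op b) ω = χ b • ω := by
    intro b ω
    obtain ⟨c, rfl⟩ := e.symm.surjective ω
    refine e.injective ?_
    have hc : e.symm c = c • e.symm 1 := by
      rw [← _root_.map_smul, smul_eq_mul, mul_one]
    rw [hc, _root_.map_smul, _root_.map_smul, _root_.map_smul, _root_.map_smul,
      e.apply_symm_apply, smul_eq_mul, smul_eq_mul, smul_eq_mul, mul_one, mul_comm]
    rfl
  refine ⟨AlgHom.ofLinearMap χ ?_ fun a b => ?_, hχ⟩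
  · change e (ρ 1 (e.symm 1)) = 1
    rw [map_one, Module.End.one_apply, e.apply_symm_apply]
  · change e (ρ (MulOpposite.op (a * b)) (e.symm 1)) = _
    rw [MulOpposite.op_mul, map_mul, Module.End.mul_apply, hχ a, hχ b, _root_.map_smul,
      _root_.map_smul, e.apply_symm_apply]
    simp [mul_comm]

end HopfDeformation

end DualizingModule

/-! ### Transport of resolutions and of their duals along ring isomorphisms. -/

section Transport

variable {R R' : Type*} [Ring R] [Ring R'] (s : R ≃+* R') {ι : ℕ → Type} [∀ n, Fintype (ι n)]

theorem comp_vecMul_map {ι κ : Type} [Fintype κ] (D : Matrix κ ι R) (x : κ → R) :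
    (s ∘ x) ᵥ* D.map s = s ∘ (x ᵥ* D) := by
  funext i
  simp [Matrix.vecMul, dotProduct]

theorem comp_symm_comp {ι : Type} (x : ι → R') : s ∘ (s.symm ∘ x) = x :=
  funext fun _ => s.apply_symm_apply _

theorem symm_comp_comp {ι : Type} (x : ι → R) : s.symm ∘ (s ∘ x) = x :=
  funext fun _ => s.symm_apply_apply _

theorem comp_injective {ι : Type} : Function.Injective fun x : ι → R => s ∘ x :=
  s.injective.comp_left

theorem comp_surjective {ι : Type} : Function.Surjective fun x : ι → R => s ∘ x :=
  fun x => ⟨_, comp_symm_comp s x⟩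

theorem comp_eq_zero_iff {ι : Type} (x : ι → R) : s ∘ x = 0 ↔ x = 0 := by
  refine Iff.trans ?_ (comp_injective s).eq_iff
  rw [show s ∘ (0 : ι → R) = 0 from funext fun _ => map_zero s]

/-- Transport of a resolution along an isomorphism of rings. -/
theorem IsMatRes.map_ringEquiv {D : ∀ n, Matrix (ι (n + 1)) (ι n) R} {M M' : Type*}
    [AddCommGroup M] [Module R M] [AddCommGroup M'] [Module R' M'] {aug : (ι 0 → R) →ₗ[R] M}
    (h : IsMatRes D aug) (f : M ≃+ M') (hf : ∀ r m, f (r • m) = s r • f m) :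
    ∃ aug' : (ι 0 → R') →ₗ[R'] M', IsMatRes (fun n => (D n).map s) aug' := by
  let aug' : (ι 0 → R') →ₗ[R'] M' :=
    { toFun := fun x => f (aug (s.symm ∘ x))
      map_add' := fun x y => by
        rw [← map_add, ← map_add]
        congr 2
        exact funext fun _ => map_add s.symm _ _
      map_smul' := fun r x => by
        have : s.symm ∘ (r • x) = s.symm r • (s.symm ∘ x) :=
          funext fun _ => map_mul s.symm _ _
        rw [this, map_smul, hf, s.apply_symm_apply, RingHom.id_apply] }
  have haug' : ∀ x, aug' (s ∘ x) = f (aug x) := fun x =>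
    congrArg (fun y => f (aug y)) (symm_comp_comp s x)
  refine ⟨aug', fun m => ?_, fun x => ?_, fun n x => ?_⟩
  · obtain ⟨x, hx⟩ := h.surjective (f.symm m)
    exact ⟨s ∘ x, by rw [haug', hx, f.apply_symm_apply]⟩
  · obtain ⟨x, rfl⟩ := comp_surjective s x
    simp only [haug', AddEquiv.map_eq_zero_iff, h.exact_zero, (comp_surjective s).exists,
      comp_vecMul_map, (comp_injective s).eq_iff]
  · obtain ⟨x, rfl⟩ := comp_surjective s x
    simp only [comp_vecMul_map, comp_eq_zero_iff, h.exact_succ, (comp_surjective s).exists,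
      (comp_injective s).eq_iff]

/-- Transport of a complex of row vectors along an isomorphism of rings. -/
theorem Concentrated.map_ringEquiv {F : ∀ n, Matrix (ι n) (ι (n + 1)) R} {e : ℕ}
    {H H' : Type*} [AddCommGroup H] [Module R H] [AddCommGroup H'] [Module R' H']
    (h : Concentrated (rowComplex F) e H) (f : H ≃+ H') (hf : ∀ r m, f (r • m) = s r • f m) :
    Concentrated (rowComplex fun n => (F n).map s) e H' := by
  have hrow : ∀ n (x : ι n → R), rowComplex (fun n => (F n).map s) n (s ∘ x) =
      s ∘ rowComplex F n x := fun n x => comp_vecMul_map s (F n) x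
  have hb : ∀ n (x : ι n → R), s ∘ x ∈ boundaries (rowComplex fun n => (F n).map s) n ↔
      x ∈ boundaries (rowComplex F) n := by
    intro n x
    rcases n with _ | n
    · exact comp_eq_zero_iff s x
    · change (∃ y, _ = _) ↔ ∃ y, _ = _
      simp only [(comp_surjective s).exists, hrow, (comp_injective s).eq_iff]
  refine ⟨fun n x => ?_, fun n hn x hx => ?_, ?_⟩
  · obtain ⟨x, rfl⟩ := comp_surjective s x
    simp only [hrow, h.comp_eq_zero]
    exact (comp_eq_zero_iff s _).2 rfl
  · obtain ⟨x, rfl⟩ := comp_surjective s x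
    simp only [hrow, comp_eq_zero_iff] at hx
    exact (hb n x).2 (h.exact n hn x hx)
  · obtain ⟨π, hπ⟩ := h.exists_cohomology
    have hker : ∀ x : LinearMap.ker (rowComplex (fun n => (F n).map s) e),
        rowComplex F e (s.symm ∘ x.1) = 0 := by
      intro x
      rw [← comp_eq_zero_iff s, ← hrow, comp_symm_comp]
      exact x.2
    let π' : LinearMap.ker (rowComplex (fun n => (F n).map s) e) →ₗ[R'] H' :=
      { toFun := fun x => f (π ⟨s.symm ∘ x.1, hker x⟩)
        map_add' := fun x y => by
          rw [← map_add, ← map_add]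
          congr 2
          exact Subtype.ext (funext fun _ => map_add s.symm _ _)
        map_smul' := fun r x => by
          have : (⟨s.symm ∘ (r • x).1, hker (r • x)⟩ : LinearMap.ker (rowComplex F e)) =
              s.symm r • ⟨s.symm ∘ x.1, hker x⟩ :=
            Subtype.ext (funext fun _ => map_mul s.symm _ _)
          rw [this, map_smul, hf, s.apply_symm_apply, RingHom.id_apply] }
    refine ⟨π', fun m => ?_, fun x => ?_⟩
    · obtain ⟨x, hx⟩ := hπ.surjective (f.symm m)
      have hsx : rowComplex (fun n => (F n).map s) e (s ∘ x.1) = 0 := by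
        rw [hrow, comp_eq_zero_iff]
        exact x.2
      refine ⟨⟨s ∘ x.1, hsx⟩, ?_⟩
      change f (π _) = m
      rw [← f.apply_symm_apply m, ← hx]
      congr 2
      exact Subtype.ext (symm_comp_comp s x.1)
    · rw [← comp_symm_comp s x.1, hb]
      exact (AddEquiv.map_eq_zero_iff f).trans (hπ.eq_zero_iff _)

end Transport

/-! ### Coordinates on a representation and on the tensor product with its dual. -/

section Coordinates

variable {K : Type*} [CommRing K] {l : Type} [Fintype l] {V : Type*}
  [AddCommGroup V] [Module K V] (v : Module.Basis l K V)

theorem apply_equivFun_symm (e : Module.End K V) (y : l → K) :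
    e (v.equivFun.symm y) = v.equivFun.symm fun i => ∑ j, matCoeff v i j e * y j := by
  refine v.equivFun.injective (funext fun i => ?_)
  rw [LinearEquiv.apply_symm_apply, v.equivFun_symm_apply, map_sum, map_sum, Finset.sum_apply]
  refine Finset.sum_congr rfl fun j _ => ?_
  simp [matCoeff_apply, mul_comm]

variable [DecidableEq l]

/-- Coordinates of the tensor product with a dual module. -/
def tensorDualEquiv (M : Type*) [AddCommGroup M] [Module K M] :
    (l → M) ≃ₗ[K] M ⊗[K] Module.Dual K V :=
  (TensorProduct.piScalarRight K K M l).symm.trans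
    (LinearEquiv.lTensor M v.dualBasis.equivFun.symm)

theorem tensorDualEquiv_apply {M : Type*} [AddCommGroup M] [Module K M] (y : l → M) :
    tensorDualEquiv v M y = ∑ i, y i ⊗ₜ[K] v.coord i := by
  conv_lhs => rw [← Finset.univ_sum_single y, map_sum]
  refine Finset.sum_congr rfl fun i _ => ?_
  simp [tensorDualEquiv, TensorProduct.piScalarRight_symm_single]

theorem transpose_coord (e : Module.End K V) (j : l) :
    Module.Dual.transpose (R := K) e (v.coord j) = ∑ i, matCoeff v j i e • v.coord i := by
  refine v.ext fun m => ?_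
  simp [Module.Dual.transpose_apply, matCoeff_apply, Finsupp.single_apply]

theorem tensorDualAction_tensorDualEquiv {B : Type*} [Ring B] [Algebra K B] {M : Type*}
    [AddCommGroup M] [Module K M] (ρ : Bᵐᵒᵖ →ₐ[K] Module.End K M) (z : B ⊗[K] Module.End K V)
    (y : l → M) : (tensorDualAction ρ V z).unop (tensorDualEquiv v M y) =
      tensorDualEquiv v M fun i =>
        ∑ j, ρ (MulOpposite.op (contract B (matCoeff v j i) z)) (y j) := by
  induction z using TensorProduct.induction_on with
  | zero =>
    simp only [map_zero, MulOpposite.unop_zero, MulOpposite.op_zero, LinearMap.zero_apply,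
      Finset.sum_const_zero]
    exact (map_zero _).symm
  | tmul b e =>
    have h1 : ∀ (m : M) (f : Module.Dual K V), (tensorDualAction ρ V (b ⊗ₜ[K] e)).unop (m ⊗ₜ[K] f) =
        ρ (MulOpposite.op b) m ⊗ₜ[K] Module.Dual.transpose (R := K) e f := by
      intro m f
      simp only [tensorDualAction]
      rfl
    simp only [tensorDualEquiv_apply, map_sum, h1, transpose_coord, TensorProduct.tmul_sum,
      contract_tmul, TensorProduct.sum_tmul, MulOpposite.op_smul, map_smul, LinearMap.smul_apply,
      TensorProduct.tmul_smul, TensorProduct.smul_tmul']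
    exact Finset.sum_comm
  | add x z hx hz =>
    rw [map_add, MulOpposite.unop_add, LinearMap.add_apply, hx, hz, ← map_add]
    congr 1
    funext i
    simp [Finset.sum_add_distrib]

/-- Passing to the dual transposes the indices, which gives exactly the form of action required by
`Concentrated.twist`. The maps `twistedComul` and `coaction` unfold to the same composite. -/
theorem twistAction_tensorDualEquiv (I : Ideal K) {B : Type*} [Ring B] [Algebra K B]
    [TopHopfAlgebra I B] [Module B V] [IsScalarTower K B V] [Module.Free K V]
    [Module.Finite K V] {M : Type*} [AddCommGroup M] [Module K M]
    (ρ : Bᵐᵒᵖ →ₐ[K] Module.End K M) (u : B) (y : l → M) :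
    twistAction I B V ρ (MulOpposite.op u) (tensorDualEquiv v M y) =
      tensorDualEquiv v M fun i => ∑ j, ρ (MulOpposite.op
        ((twistData I (leftAction K B V) v).γ j i u)) (y j) :=
  tensorDualAction_tensorDualEquiv v ρ (twistedComul I B V u) y

/-- This is why twisting a resolution of the trivial module resolves V: on l-tuples of scalars, `α`
acts through ρ. -/
theorem counit_twistData_α (I : Ideal K) [IsHausdorff I K] {B : Type*} [Ring B] [Algebra K B]
    [TopHopfAlgebra I B] [Module.Free K V] [Module.Finite K V] (ρ : B →ₐ[K] Module.End K V)
    (i j : l) (u : B) :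
    TopHopfAlgebra.counit I ((twistData I ρ v).α i j u) = matCoeff v i j (ρ u) :=
  counit_eq_of_isConv I (isConv_conv I ρ (matCoeff v i j) u)

end Coordinates

/-! ### Resolutions of a representation and of its twisted dual. -/

section Duality

/-- A commutative ring as a module through a homomorphism. -/
abbrev characterModule {R : Type u} [Ring R] {K : Type u} [CommRing K] (g : R →+* K) :
    ModuleCat.{u} R :=
  (ModuleCat.restrictScalars g).obj (ModuleCat.of K K)

namespace HopfDeformation

variable {k : Type u} [Field k] {B B₀ : Type u} [Ring B] [Algebra k⟦X⟧ B]
  [TopHopfAlgebra (hIdeal k) B] [Ring B₀] [HopfAlgebra k B₀] (δ : HopfDeformation k B B₀)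
  {d : ℕ} (hd : HasExtDim k B₀ d) (V : Type u) [AddCommGroup V] [Module k⟦X⟧ V] [Module B V]
  [IsScalarTower k⟦X⟧ B V] [Module.Free k⟦X⟧ V] [Module.Finite k⟦X⟧ V]

include δ hd

/-- A representation has a resolution whose dual is a resolution of the twisted dual. -/
theorem exists_resolution : ∃ (ι : ℕ → Type) (_ : ∀ n, Fintype (ι n))
    (D : ∀ n, Matrix (ι (n + 1)) (ι n) B) (aug : (ι 0 → B) →ₗ[B] V),
    IsMatRes D aug ∧ Concentrated (rowComplex fun n => opMat (D n)) d
      (omegaTensorDual (hIdeal k) B d V) := by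
  have : IsHausdorff (hIdeal k) k⟦X⟧ := isFormal_powerSeries.isHausdorff
  have := hd.isNoetherianRing
  obtain ⟨r, D, aug, h⟩ := δ.exists_isMatRes
  let v := Module.finBasis k⟦X⟧ V
  let t := twistData (hIdeal k) (leftAction k⟦X⟧ B V) v
  -- V is identified by a basis with a power of the trivial module, on which the operators `α` act
  -- by the matrix of ρ.
  obtain ⟨aug', h'⟩ := h.twist t (v.equivFun.symm.toAddEquiv :
      (Fin (Module.finrank k⟦X⟧ V) →
        trivialModule (TopHopfAlgebra.counit (hIdeal k) (A := B))) ≃+ V) (fun u y => by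
    refine (apply_equivFun_symm v (leftAction k⟦X⟧ B V u) y).trans ?_
    refine congrArg v.equivFun.symm (funext fun i => Finset.sum_congr rfl fun j _ => ?_)
    rw [← counit_twistData_α v (hIdeal k) (leftAction k⟦X⟧ B V) i j u]
    rfl)
  refine ⟨fun n => Fin (r n) × Fin (Module.finrank k⟦X⟧ V), inferInstance,
    fun n => t.twist (D n), aug', h', ?_⟩
  let b : (Fin (Module.finrank k⟦X⟧ V) → extRightModule k⟦X⟧
      (trivialModule (TopHopfAlgebra.counit (hIdeal k) (A := B))) d) ≃+
        omegaTensorDual (hIdeal k) B d V :=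
    (tensorDualEquiv v (Omega (hIdeal k) B d)).toAddEquiv
  exact (δ.concentrated_omega hd h).twist t b fun u y =>
    twistAction_tensorDualEquiv (M := Omega (hIdeal k) B d) v (hIdeal k) _ u y

/-- The twisted dual of a representation has a resolution whose dual is a resolution of the
representation. -/
theorem exists_resolution_omegaTensorDual : ∃ (ι : ℕ → Type) (_ : ∀ n, Fintype (ι n))
    (E : ∀ n, Matrix (ι (n + 1)) (ι n) Bᵐᵒᵖ)
    (aug : (ι 0 → Bᵐᵒᵖ) →ₗ[Bᵐᵒᵖ] omegaTensorDual (hIdeal k) B d V),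
    IsMatRes E aug ∧ Concentrated (rowComplex fun n => unopMat (E n)) d (ModuleCat.of B V) := by
  have : IsHausdorff (hIdeal k) k⟦X⟧ := isFormal_powerSeries.isHausdorff
  have := hd.isNoetherianRing
  obtain ⟨r, D, aug, h⟩ := δ.exists_isMatRes
  obtain ⟨χ, hχ⟩ := δ.exists_character hd h
  obtain ⟨e⟩ := δ.nonempty_omega_equiv hd h
  let I := hIdeal k
  let ε : B →ₐ[k⟦X⟧] k⟦X⟧ := TopHopfAlgebra.counit I
  let S : B ≃ₐ[k⟦X⟧] Bᵐᵒᵖ := TopHopfAlgebra.antipode I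
  -- The inverse antipode, as an isomorphism onto the opposite ring. It preserves the counit, so it
  -- carries the resolution to one of the trivial right module.
  let s : B ≃+* Bᵐᵒᵖ := (RingEquiv.opOp B).trans (RingEquiv.op S.symm.toRingEquiv)
  let v := Module.finBasis k⟦X⟧ V
  -- Exchanging `α` and `γ` makes the resolved module see ρ∘S² and the cohomology of the dual see ρ.
  -- The winding automorphism puts χ in place of ε on the resolved module, as the action on Ω
  -- requires.
  let t := (twistData I (leftAction k⟦X⟧ B V) v).opposite (windingEquiv I χ)
  have hSε : ∀ b, ε (S.symm (MulOpposite.op b)) = ε b := by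
    intro b
    rw [← counit_antipode I, antipodeLin_apply]
    change ε (S (S.symm _)).unop = _
    rw [S.apply_symm_apply, MulOpposite.unop_op]
  let g : Bᵐᵒᵖ →+* k⟦X⟧ := ε.toRingHom.fromOpposite fun _ _ => mul_comm _ _
  -- After transport by the inverse antipode, the action on Ω is through χ∘S.
  let g' : Bᵐᵒᵖᵐᵒᵖ →+* k⟦X⟧ := ((χ.toRingHom.fromOpposite fun _ _ => mul_comm _ _).comp
    S.toRingEquiv.toRingHom).comp (RingEquiv.opOp B).symm.toRingHom
  let W : ModuleCat.{u} Bᵐᵒᵖᵐᵒᵖ :=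
    (ModuleCat.restrictScalars (RingEquiv.opOp B).symm.toRingHom).obj (ModuleCat.of B V)
  let f : trivialModule ε ≃+ characterModule g := AddEquiv.refl k⟦X⟧
  have hf : ∀ b (m : k⟦X⟧), ε b * m = ε (S.symm (MulOpposite.op b)) * m := fun b m => by
    rw [hSε]
  obtain ⟨aug₁, h₁⟩ := h.map_ringEquiv s f hf
  let f' : extRightModule k⟦X⟧ (trivialModule ε) d ≃+ characterModule g' := e.toAddEquiv
  have hf' : ∀ b (ω : Omega I B d), e (extRightAction k⟦X⟧ (trivialModule ε) d b ω) =
      χ (S (S.symm b)).unop * e ω := fun b ω => by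
    rw [S.apply_symm_apply, ← smul_eq_mul, ← _root_.map_smul, ← hχ]
    rfl
  have hc := (δ.concentrated_omega hd h).map_ringEquiv (RingEquiv.op s) f' hf'
  let b : (Fin (Module.finrank k⟦X⟧ V) → characterModule g) ≃+ omegaTensorDual I B d V :=
    ((LinearEquiv.piCongrRight fun _ => e.symm).trans
      (tensorDualEquiv v (Omega I B d))).toAddEquiv
  have hb : ∀ x (c : k⟦X⟧), extRightAction k⟦X⟧ (trivialModule ε) d (MulOpposite.op x)
      (e.symm c) = e.symm (ε (windingEquiv I χ x) * c) := fun x c => by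
    rw [hχ, counit_windingEquiv, ← smul_eq_mul, _root_.map_smul]
  obtain ⟨aug₂, h₂⟩ := h₁.twist t b (fun u y => by
    refine (twistAction_tensorDualEquiv (M := Omega I B d) v I _ u.unop (fun i => e.symm (y i))).trans ?_
    refine congrArg (tensorDualEquiv v _) (funext fun i => ?_)
    refine Eq.trans ?_ (map_sum e.symm _ _).symm
    exact Finset.sum_congr rfl fun j _ => hb _ _)
  let b' : (Fin (Module.finrank k⟦X⟧ V) → characterModule g') ≃+ W :=
    v.equivFun.symm.toAddEquiv
  -- Writing τ for the winding automorphism, χ∘S = ε∘τ⁻¹, so χ(S(τ(α_ij(u)))) = ε(α_ij(u)), which is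
  -- the coefficient of ρ(u). The character disappears and V itself remains.
  have hc₂ := hc.twist t b' fun u y => by
    refine (apply_equivFun_symm v (leftAction k⟦X⟧ B V u.unop) y).trans ?_
    refine congrArg v.equivFun.symm (funext fun i => Finset.sum_congr rfl fun j _ => ?_)
    rw [← counit_twistData_α v I (leftAction k⟦X⟧ B V) i j u.unop,
      ← (windingEquiv I χ).symm_apply_apply ((twistData I (leftAction k⟦X⟧ B V) v).α i j u.unop),
      counit_windingEquiv_symm]
    rfl
  let f'' : W ≃+ ModuleCat.of B V := AddEquiv.refl V
  exact ⟨fun n => Fin (r n) × Fin (Module.finrank k⟦X⟧ V), inferInstance,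
    fun n => t.twist ((D n).map s), aug₂, h₂,
    hc₂.map_ringEquiv (RingEquiv.opOp B).symm f'' fun _ _ => rfl⟩

end HopfDeformation

end Duality

/-- A morphism commutes with the antipodes, which therefore identify it with its opposite. -/
theorem TopHopfHom.isRightFlat_op {K : Type*} [CommRing K] {I : Ideal K} {B A : Type u} [Ring B]
    [Algebra K B] [TopHopfAlgebra I B] [Ring A] [Algebra K A] [TopHopfAlgebra I A]
    (φ : TopHopfHom I B A) (h : IsRightFlat φ.toRingHom) : IsRightFlat φ.toRingHom.op :=
  h.of_ringEquiv _ (TopHopfAlgebra.antipode I (A := B)).toRingEquiv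
    (TopHopfAlgebra.antipode I (A := A)).toRingEquiv φ.map_antipode

attribute [local instance] linearModuleCat

/-- Isomorphisms of `Ext` groups in degrees `n + d` and `n + e` for integers `n`. -/
theorem nonempty_extZ_iso (K : Type u) [CommRing K] {A A' : Type u} [Ring A] [Algebra K A]
    [Ring A'] [Algebra K A'] {M N : ModuleCat.{u} A} {U T : ModuleCat.{u} A'} {d e : ℕ}
    (h : (∀ a b, a + e = b + d →
        Nonempty (Abelian.Ext.{u} M N a ≃ₗ[K] Abelian.Ext.{u} U T b)) ∧
      (∀ b, b + d < e → Subsingleton (Abelian.Ext.{u} U T b)) ∧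
      (∀ a, a + e < d → Subsingleton (Abelian.Ext.{u} M N a))) (n : ℤ) :
    Nonempty (extZ K M N (n + d) ≅ extZ K U T (n + e)) := by
  obtain ⟨heq, hU, hM⟩ := h
  rcases ha : n + d with a | a <;> rcases hb : n + e with b | b
  · obtain ⟨f⟩ := heq a b (by simp only [Int.ofNat_eq_natCast] at ha hb; omega)
    exact ⟨f.toModuleIso⟩
  -- Here n + e is negative, so a = n + d satisfies a + e < d and the left-hand group vanishes as
  -- well.
  · have := hM a (by simp only [Int.ofNat_eq_natCast] at ha; omega)
    exact ⟨(LinearEquiv.ofSubsingleton (Abelian.Ext.{u} M N a) PUnit.{u + 1}).toModuleIso⟩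
  · have := hU b (by simp only [Int.ofNat_eq_natCast] at hb; omega)
    exact ⟨(LinearEquiv.ofSubsingleton PUnit.{u + 1} (Abelian.Ext.{u} U T b)).toModuleIso⟩
  · exact ⟨Iso.refl _⟩

end HopfDuality

end

/-! ### The duality for induced modules. -/

open HopfDuality in
theorem mainTheorem4 {k : Type u} [Field k] [CharZero k]
    {A A₀ B B₀ C C₀ : Type u}
    [Ring A] [Algebra k⟦X⟧ A] [TopHopfAlgebra (hIdeal k) A] [Ring A₀] [HopfAlgebra k A₀]
    [Ring B] [Algebra k⟦X⟧ B] [TopHopfAlgebra (hIdeal k) B] [Ring B₀] [HopfAlgebra k B₀]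
    [Ring C] [Algebra k⟦X⟧ C] [TopHopfAlgebra (hIdeal k) C] [Ring C₀] [HopfAlgebra k C₀]
    (defA : HopfDeformation k A A₀) (defB : HopfDeformation k B B₀)
    (defC : HopfDeformation k C C₀)
    (φ : TopHopfHom (hIdeal k) B A) (ψ : TopHopfHom (hIdeal k) C A)
    (hφ : IsRightFlat φ.toRingHom) (hψ : IsRightFlat ψ.toRingHom)
    (dB dC : ℕ) (hB : HasExtDim k B₀ dB) (hC : HasExtDim k C₀ dC)
    (V : Type u) [AddCommGroup V] [Module k⟦X⟧ V] [Module B V] [IsScalarTower k⟦X⟧ B V]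
    [Module.Free k⟦X⟧ V] [Module.Finite k⟦X⟧ V]
    (W : Type u) [AddCommGroup W] [Module k⟦X⟧ W] [Module C W] [IsScalarTower k⟦X⟧ C W]
    [Module.Free k⟦X⟧ W] [Module.Finite k⟦X⟧ W] (n : ℤ) :
    Nonempty
      (extZ k⟦X⟧ (induced φ.toRingHom (ModuleCat.of B V))
          (induced ψ.toRingHom (ModuleCat.of C W)) (n + dB) ≅
        extZ k⟦X⟧ (induced ψ.toRingHom.op (omegaTensorDual (hIdeal k) C dC W))
          (induced φ.toRingHom.op (omegaTensorDual (hIdeal k) B dB V)) (n + dC)) := by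
  obtain ⟨ι, _, D, aug, hD, hDd⟩ := defB.exists_resolution hB V
  obtain ⟨κ, _, E, aug', hE, hEd⟩ := defC.exists_resolution_omegaTensorDual hC W
  obtain ⟨_, hM⟩ := IsMatRes.induced (M := ModuleCat.of B V) hφ hD
  obtain ⟨_, hU⟩ := hE.induced (ψ.isRightFlat_op hψ)
  -- The cohomology of the dual of the resolution of V consists of right modules, and that of the
  -- resolution of Ω ⊗ W* of left modules, so each induction of a dual uses flatness on the side
  -- opposite to that of its resolution. The degrees match since (n + dB) + dC = (n + dC) + dB.
  exact nonempty_extZ_iso k⟦X⟧ (ext_duality hM hU (hDd.induced (φ.isRightFlat_op hφ))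
    (hEd.induced hψ)) n
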